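/- **Setting.** Let $H^2(\mathbb R)$ be the space of $u:\mathbb R\to\mathbb C$ with square integrable weak derivatives up to order $2$, let $H^{1,1}(\mathbb R)=\{u:\ \langle x\rangle u,\ \langle x\rangle\partial_x u\in L^2(\mathbb R)\}$ with $\langle x\rangle=(1+x^2)^{1/2}$, and write $X=H^2(\mathbb R)\cap H^{1,1}(\mathbb R)$ with $\|u\|_X=\|u\|_{H^2}+\|u\|_{H^{1,1}}$. Let $\mathbb C_I=\{\lambda:\ \mathrm{Re}\,\lambda>0,\ \mathrm{Im}\,\lambda>0\}$. For $u\in X$ consider the Kaup–Newell problem $$\partial_x\psi=\Big[-i\lambda^2\sigma_3+\lambda\begin{pmatrix}0&u\\-\bar u&0\end{pmatrix}\Big]\psi,\qquad \sigma_3=\mathrm{diag}(1,-1).$$ For $\lambda\in\mathbb C_I$ the Jost functions $\varphi_-(\cdot;\lambda),\phi_+(\cdot;\lambda)$ of $u$ are the bounded functions such that $\varphi_-e^{-i\lambda^2x}$ and $\phi_+e^{i\lambda^2x}$ are solutions, $\varphi_-\to e_1=(1,0)^t$ as $x\to-\infty$ and $\phi_+\to e_2=(0,1)^t$ as $x\to+\infty$.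 Put $a(\lambda)=\det[\varphi_-e^{-i\lambda^2x},\phi_+e^{i\lambda^2x}]$ (independent of $x$). If $a(\lambda_1)=0$, the norming coefficient $\gamma_1\ne0$ is defined by $\varphi_-(x;\lambda_1)e^{-i\lambda_1^2x}=\gamma_1\phi_+(x;\lambda_1)e^{i\lambda_1^2x}$ for all $x$. For $\eta\in\mathbb C^2$ let $$d_\lambda(\eta,\eta)=\lambda|\eta_1|^2+\bar\lambda|\eta_2|^2,\quad G_\lambda(\eta)=\frac{d_{\bar\lambda}(\eta,\eta)}{d_\lambda(\eta,\eta)},\quad S_\lambda(\eta)=2i(\lambda^2-\bar\lambda^2)\frac{\eta_1\bar\eta_2}{d_\lambda(\eta,\eta)},$$ and, for $\eta:\mathbb R\to\mathbb C^2$, $\mathbf B_\lambda(\eta)u=G_\lambda(\eta)\,[-G_\lambda(\eta)u+S_\lambda(\eta)]$. For $\lambda_1\in\mathbb C_I$, $\gamma_1\neq0$ and a potential $u^{(1)}\in X$ with Jost functions $\varphi_-^{(1)},\phi_+^{(1)}$ and coefficient $a^{(1)}$ such that $a^{(1)}(\lambda_1)\ne0$, let $$\eta^{(1)}(x)=\frac{e^{-i\lambda_1^2x}\varphi_-^{(1)}(x;\lambda_1)}{\gamma_1\bar\lambda_1a^{(1)}(\lambda_1)}+\frac{e^{i\lambda_1^2x}\phi_+^{(1)}(x;\lambda_1)}{\bar\lambda_1a^{(1)}(\lambda_1)}.$$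 **Statement.** Let $\lambda_1\in\mathbb C_I$, $M>0$ and $K>0$. (1) For every $\delta>0$ there is a constant $C$, depending only on $\lambda_1,M,K,\delta$, such that: (a) if $u\in X$ has $a(\lambda_1)=0$, $a'(\lambda_1)\ne0$, $|a'(\lambda_1)|\ge\delta$, with norming coefficient $K^{-1}\le|\gamma_1|\le K$, and if $u^{(1)}=\mathbf B_{\lambda_1}(\varphi_-(\cdot;\lambda_1)e^{-i\lambda_1^2x})u$ lies in $X$ with $\|u^{(1)}\|_X\le M$, then $a^{(1)}(\lambda_1)\ne0$, $\mathbf B_{\lambda_1}(\eta^{(1)})u^{(1)}\in X$ and $\|\mathbf B_{\lambda_1}(\eta^{(1)})u^{(1)}\|_X\le C$; (b) for every $u^{(1)}\in X$ with $\|u^{(1)}\|_X\le M$ and $|a^{(1)}(\lambda_1)|\ge\delta$, and every $\gamma_1\in\mathbb C$ with $K^{-1}\le|\gamma_1|\le K$, one has $\mathbf B_{\lambda_1}(\eta^{(1)})u^{(1)}\in X$ and $\|\mathbf B_{\lambda_1}(\eta^{(1)})u^{(1)}\|_X\le C$. (2) There is a constant $C$, depending only on $\lambda_1,M,K$, such that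 the conclusion of (a) holds without the condition $|a'(\lambda_1)|\ge\delta$ for every $u$ whose coefficient $a$ has $\lambda_1$ as its only zero in $\mathbb C_I$ (and $a'(\lambda_1)\neq0$), and the conclusion of (b) holds without the condition $|a^{(1)}(\lambda_1)|\ge\delta$ for every $u^{(1)}$ whose coefficient $a^{(1)}$ has no zero in $\mathbb C_I$. -/

import Mathlib

open MeasureTheory Filter Topology
open scoped ComplexConjugate ContDiff Matrix

noncomputable section

namespace KaupNewell

/-! ## The space `H² ∩ H^{1,1}` on the line -/

/-- `g` is the weak (distributional) derivative of `f` on `ℝ`. -/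
def HasWeakDeriv (f g : ℝ → ℂ) : Prop :=
  LocallyIntegrable f ∧ LocallyIntegrable g ∧
    ∀ θ : ℝ → ℝ, ContDiff ℝ ∞ θ → HasCompactSupport θ →
      ∫ x, ((deriv θ x : ℝ) : ℂ) * f x = - ∫ x, ((θ x : ℝ) : ℂ) * g x

open Classical in
/-- A weak derivative of `f` (unique up to a null set), or `0` if there is none. -/
def weakDeriv (f : ℝ → ℂ) : ℝ → ℂ :=
  if h : ∃ g, HasWeakDeriv f g then h.choose else 0

/-- The weighted space `L^{2,1}`: functions `f` with `⟨x⟩ f ∈ L²`, `⟨x⟩ = (1 + x²)^{1/2}`. -/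
def MemL21 (f : ℝ → ℂ) : Prop :=
  MemLp (fun x : ℝ => ((Real.sqrt (1 + x ^ 2) : ℝ) : ℂ) * f x) 2 volume

/-- `H²`: the weak derivatives up to order two exist and are square integrable. -/
def MemH2 (u : ℝ → ℂ) : Prop :=
  (∃ g, HasWeakDeriv u g) ∧ (∃ g, HasWeakDeriv (weakDeriv u) g) ∧
    MemLp u 2 volume ∧ MemLp (weakDeriv u) 2 volume ∧ MemLp (weakDeriv (weakDeriv u)) 2 volume

/-- `H^{1,1}`: `u` and its weak derivative lie in `L^{2,1}`. -/
def MemH11 (u : ℝ → ℂ) : Prop :=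
  (∃ g, HasWeakDeriv u g) ∧ MemL21 u ∧ MemL21 (weakDeriv u)

/-- Membership in `H² ∩ H^{1,1}`. -/
def MemX (u : ℝ → ℂ) : Prop := MemH2 u ∧ MemH11 u

def normH2 (u : ℝ → ℂ) : ℝ :=
  Real.sqrt ((∫ x, ‖u x‖ ^ 2) + (∫ x, ‖weakDeriv u x‖ ^ 2)
    + ∫ x, ‖weakDeriv (weakDeriv u) x‖ ^ 2)

def normH11 (u : ℝ → ℂ) : ℝ :=
  Real.sqrt ((∫ x : ℝ, (1 + x ^ 2) * ‖u x‖ ^ 2) + ∫ x : ℝ, (1 + x ^ 2) * ‖weakDeriv u x‖ ^ 2)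

/-- The norm of `H² ∩ H^{1,1}` (used only for functions with `MemX u`). -/
def normX (u : ℝ → ℂ) : ℝ := normH2 u + normH11 u

/-! ## The Kaup–Newell spectral problem, Jost functions and the coefficient `a` -/

def sigma3 : Matrix (Fin 2) (Fin 2) ℂ := !![1, 0; 0, -1]

def Q (z : ℂ) : Matrix (Fin 2) (Fin 2) ℂ := !![0, z; -conj z, 0]

/-- The matrix `-iλ²σ₃ + λ Q(u(x))`. -/
def knMatrix (u : ℝ → ℂ) (lam : ℂ) (x : ℝ) : Matrix (Fin 2) (Fin 2) ℂ :=
  (-Complex.I * lam ^ 2) • sigma3 + lam • Q (u x)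

/-- `ψ` is a (Carathéodory) solution of `∂ₓψ = [-iλ²σ₃ + λ Q(u)] ψ` on `ℝ`. The integrated form
does not depend on the representative of `u`. -/
def IsKNSolution (u : ℝ → ℂ) (lam : ℂ) (ψ : ℝ → Fin 2 → ℂ) : Prop :=
  Continuous ψ ∧ LocallyIntegrable (fun y => knMatrix u lam y *ᵥ ψ y) ∧
    ∀ x : ℝ, ψ x = ψ 0 + ∫ y in (0 : ℝ)..x, knMatrix u lam y *ᵥ ψ y

/-- `φ` is a Jost function normalised at `-∞` by `e₁`. -/
def IsJostMinus (u : ℝ → ℂ) (lam : ℂ) (φ : ℝ → Fin 2 → ℂ) : Prop :=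
  IsKNSolution u lam (fun x => Complex.exp (-Complex.I * lam ^ 2 * x) • φ x) ∧
    (∃ R : ℝ, ∀ x, ‖φ x‖ ≤ R) ∧ Tendsto φ atBot (𝓝 ![1, 0])

/-- `φ` is a Jost function normalised at `+∞` by `e₂`. -/
def IsJostPlus (u : ℝ → ℂ) (lam : ℂ) (φ : ℝ → Fin 2 → ℂ) : Prop :=
  IsKNSolution u lam (fun x => Complex.exp (Complex.I * lam ^ 2 * x) • φ x) ∧
    (∃ R : ℝ, ∀ x, ‖φ x‖ ≤ R) ∧ Tendsto φ atTop (𝓝 ![0, 1])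

open Classical in
/-- The Jost function `φ₋(x;λ)` of the potential `u`, for `Im λ² > 0`. -/
def jostMinus (u : ℝ → ℂ) (lam : ℂ) : ℝ → Fin 2 → ℂ :=
  if h : ∃ φ, IsJostMinus u lam φ then h.choose else 0

open Classical in
/-- The Jost function `ϕ₊(x;λ)` of the potential `u`, for `Im λ² > 0`. -/
def jostPlus (u : ℝ → ℂ) (lam : ℂ) : ℝ → Fin 2 → ℂ :=
  if h : ∃ φ, IsJostPlus u lam φ then h.choose else 0

/-- The solution `φ₋(x;λ) e^{-iλ²x}`. -/
def psiMinus (u : ℝ → ℂ) (lam : ℂ) (x : ℝ) : Fin 2 → ℂ :=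
  Complex.exp (-Complex.I * lam ^ 2 * x) • jostMinus u lam x

/-- The solution `ϕ₊(x;λ) e^{iλ²x}`. -/
def psiPlus (u : ℝ → ℂ) (lam : ℂ) (x : ℝ) : Fin 2 → ℂ :=
  Complex.exp (Complex.I * lam ^ 2 * x) • jostPlus u lam x

/-- The Wronskian determinant of two vectors of `ℂ²`. -/
def wronskian (η ξ : Fin 2 → ℂ) : ℂ := η 0 * ξ 1 - ξ 0 * η 1

/-- The scattering coefficient `a(λ) = W(φ₋(x;λ)e^{-iλ²x}, ϕ₊(x;λ)e^{iλ²x})`, for `Im λ² > 0`;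
the Wronskian does not depend on `x`, and is taken at `x = 0`. -/
def a (u : ℝ → ℂ) (lam : ℂ) : ℂ := wronskian (psiMinus u lam 0) (psiPlus u lam 0)

/-- The open first quadrant. -/
def CI : Set ℂ := {z | 0 < z.re ∧ 0 < z.im}

/-- `λ` is a simple eigenvalue of the potential `u`: a simple zero of `a` in the first quadrant. -/
def IsSimpleEigenvalue (u : ℝ → ℂ) (lam : ℂ) : Prop :=
  lam ∈ CI ∧ a u lam = 0 ∧ deriv (a u) lam ≠ 0

/-- `γ` is the norming coefficient at `λ`: `φ₋ e^{-iλ²x} = γ ϕ₊ e^{iλ²x}` for all `x`. -/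
def IsNormingCoeff (u : ℝ → ℂ) (lam γ : ℂ) : Prop :=
  ∀ x, psiMinus u lam x = γ • psiPlus u lam x

/-! ## The Bäcklund transformation -/

def d (lam : ℂ) (η ξ : Fin 2 → ℂ) : ℂ := lam * η 0 * conj (ξ 0) + conj lam * η 1 * conj (ξ 1)

def G (lam : ℂ) (η : Fin 2 → ℂ) : ℂ := d (conj lam) η η / d lam η η

def S (lam : ℂ) (η : Fin 2 → ℂ) : ℂ :=
  2 * Complex.I * (lam ^ 2 - conj lam ^ 2) * (η 0 * conj (η 1) / d lam η η)

/-- The Bäcklund transformation `B_λ(η)u = G_λ(η)[-G_λ(η) u + S_λ(η)]`. -/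
def backlund (lam : ℂ) (η : ℝ → Fin 2 → ℂ) (u : ℝ → ℂ) (x : ℝ) : ℂ :=
  G lam (η x) * (-G lam (η x) * u x + S lam (η x))

/-- The new potential `u⁽¹⁾ = B_λ(η)u` with `η = φ₋(·;λ) e^{-iλ²x}`, `φ₋` a Jost function of `u`. -/
def newPotential (lam : ℂ) (u : ℝ → ℂ) : ℝ → ℂ := backlund lam (psiMinus u lam) u

/-- The function `η⁽¹⁾` built from the Jost functions of the potential `u1 = u⁽¹⁾`. -/
def etaOne (lam γ : ℂ) (u1 : ℝ → ℂ) (x : ℝ) : Fin 2 → ℂ :=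
  (1 / (γ * conj lam * a u1 lam)) • psiMinus u1 lam x
    + (1 / (conj lam * a u1 lam)) • psiPlus u1 lam x

/-- `B_λ(η⁽¹⁾)u⁽¹⁾` belongs to `H² ∩ H^{1,1}` and has norm at most `C`. -/
def InverseBound (lam γ : ℂ) (u1 : ℝ → ℂ) (C : ℝ) : Prop :=
  MemX (backlund lam (etaOne lam γ u1) u1) ∧ normX (backlund lam (etaOne lam γ u1) u1) ≤ C

end KaupNewell

end

noncomputable section

namespace KaupNewell

/-! ## Weak derivatives on the line -/

/-! Write b = λ₁ and β = Im b² > 0. Everything reduces to a lower bound of |a⁽¹⁾(b)|.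

Suppose |a⁽¹⁾(b)| ≥ δ. The transformation depends on η only up to a scalar, so η⁽¹⁾ may be replaced
by η = γ⁻¹ψ₋ + ψ₊. Its Wronskians with ψ₋ and ψ₊ are -a⁽¹⁾(b) and γ⁻¹a⁽¹⁾(b), while |ψ₋| and |ψ₊|
are at most multiples of e^{βx} and e^{-βx}; hence |η| ≥ c·e^{β|x|}, and η never vanishes. On the
left half line the first component of η is smaller than η by a factor e^{-2β|x|} plus an
exponentially weighted mass of u⁽¹⁾ to the right of x, and symmetrically on the right half line.
Since S is bounded by the ratio of either component to η, this gives the decay of S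
(`norm_S_le_of_le_norm_a`). Exponential averaging preserves the weighted L² space
(`weightedBound_expMass`). Finally |G| = 1, and along a solution G and S obey differential equations
polynomial in G, S, the potential and conjugates, so two derivatives of the transform are dominated
by the potential, its derivatives and S (`exists_backlund_bound`). The outcome is
`exists_inverseBound`.

The lower bound in (a) comes from the Darboux matrix, which carries the Jost functions of u to those
of u⁽¹⁾ and so relates the two coefficients by an explicit factor with a pole at b
(`a_newPotential`). Letting λ → b gives |a⁽¹⁾(b)| = |b² - b̄²| / (2|b|) · |a'(b)|. If b is the only
zero of a, then a⁽¹⁾ has no zero in the quadrant.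

For a potential without zeros the lower bound is a Harnack argument (`exists_le_norm_a`): a is close
to 1 at a point tb near the origin and is bounded above on bounded sets, both in terms of the L¹
norm alone, so the Borel–Carathéodory inequality for log a carries the bound from tb to b. -/

theorem HasWeakDeriv.congr {f g f' g' : ℝ → ℂ} (h : HasWeakDeriv f g) (hf : f =ᵐ[volume] f')
    (hg : g =ᵐ[volume] g') : HasWeakDeriv f' g' := by
  refine ⟨h.1.congr hf, h.2.1.congr hg, fun θ hθ hc => ?_⟩
  have h1 : ∫ x, ((deriv θ x : ℝ) : ℂ) * f' x = ∫ x, ((deriv θ x : ℝ) : ℂ) * f x :=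
    integral_congr_ae (by filter_upwards [hf] with x hx; rw [hx])
  have h2 : ∫ x, ((θ x : ℝ) : ℂ) * g' x = ∫ x, ((θ x : ℝ) : ℂ) * g x :=
    integral_congr_ae (by filter_upwards [hg] with x hx; rw [hx])
  rw [h1, h2, h.2.2 θ hθ hc]

theorem HasWeakDeriv.ae_unique {f g g' : ℝ → ℂ} (h : HasWeakDeriv f g) (h' : HasWeakDeriv f g') :
    g =ᵐ[volume] g' := by
  refine ae_eq_of_integral_contDiff_smul_eq h.2.1 h'.2.1 fun θ hθ hc => ?_
  have := (h.2.2 θ hθ hc).symm.trans (h'.2.2 θ hθ hc)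
  simpa [Complex.real_smul] using this

theorem hasWeakDeriv_weakDeriv {f : ℝ → ℂ} (h : ∃ g, HasWeakDeriv f g) :
    HasWeakDeriv f (weakDeriv f) := by
  rw [weakDeriv, dif_pos h]
  exact h.choose_spec

theorem HasWeakDeriv.weakDeriv_ae_eq {f g : ℝ → ℂ} (h : HasWeakDeriv f g) :
    weakDeriv f =ᵐ[volume] g :=
  (hasWeakDeriv_weakDeriv ⟨g, h⟩).ae_unique h

theorem LocallyIntegrable.integrable_mul_of_hasCompactSupport {θ f : ℝ → ℂ}
    (hf : LocallyIntegrable f) (hθ : Continuous θ) (hc : HasCompactSupport θ) :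
    Integrable (fun x => θ x * f x) := by
  simpa [smul_eq_mul] using hf.integrable_smul_left_of_hasCompactSupport hθ hc

theorem HasWeakDeriv.add {f g f' g' : ℝ → ℂ} (h : HasWeakDeriv f g) (h' : HasWeakDeriv f' g') :
    HasWeakDeriv (fun x => f x + f' x) (fun x => g x + g' x) := by
  refine ⟨h.1.add h'.1, h.2.1.add h'.2.1, fun θ hθ hc => ?_⟩
  have c1 : Continuous fun x => ((deriv θ x : ℝ) : ℂ) :=
    Complex.continuous_ofReal.comp (hθ.continuous_deriv (by simp))
  have c2 : Continuous fun x => ((θ x : ℝ) : ℂ) := Complex.continuous_ofReal.comp hθ.continuous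
  have s1 : HasCompactSupport fun x => ((deriv θ x : ℝ) : ℂ) :=
    hc.deriv.comp_left (g := fun r : ℝ => (r : ℂ)) (by simp)
  have s2 : HasCompactSupport fun x => ((θ x : ℝ) : ℂ) :=
    hc.comp_left (g := fun r : ℝ => (r : ℂ)) (by simp)
  simp only [mul_add]
  rw [integral_add, integral_add, h.2.2 θ hθ hc, h'.2.2 θ hθ hc, neg_add]
  · exact LocallyIntegrable.integrable_mul_of_hasCompactSupport h.2.1 c2 s2
  · exact LocallyIntegrable.integrable_mul_of_hasCompactSupport h'.2.1 c2 s2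
  · exact LocallyIntegrable.integrable_mul_of_hasCompactSupport h.1 c1 s1
  · exact LocallyIntegrable.integrable_mul_of_hasCompactSupport h'.1 c1 s1

theorem intervalIntegrable_of_locallyIntegrable {g : ℝ → ℂ} (hg : LocallyIntegrable g) (a b : ℝ) :
    IntervalIntegrable g volume a b :=
  (hg.integrableOn_isCompact isCompact_uIcc).intervalIntegrable

theorem continuous_primitive_of_locallyIntegrable {g : ℝ → ℂ} (hg : LocallyIntegrable g) (c : ℂ) :
    Continuous fun x : ℝ => c + ∫ y in (0 : ℝ)..x, g y :=
  continuous_const.add (intervalIntegral.continuous_primitive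
    (intervalIntegrable_of_locallyIntegrable hg) 0)

/-- Integration by parts of a compactly supported `C¹` function against a primitive. -/
theorem integral_deriv_mul_primitive {θ g : ℝ → ℂ} (hθ : ContDiff ℝ 1 θ)
    (hc : HasCompactSupport θ) (hg : LocallyIntegrable g) (c : ℂ) :
    ∫ x, deriv θ x * (c + ∫ y in (0 : ℝ)..x, g y) = - ∫ x, θ x * g x := by
  obtain ⟨R, hR0, hR⟩ : ∃ R : ℝ, 0 < R ∧ ∀ x, θ x ≠ 0 ∨ deriv θ x ≠ 0 → -R < x ∧ x ≤ R := by
    obtain ⟨R, hR⟩ := hc.isCompact.isBounded.subset_closedBall 0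
    refine ⟨|R| + 1, by positivity, fun x hx => ?_⟩
    have hx' : x ∈ tsupport θ := by
      rcases hx with hx | hx
      · exact subset_tsupport _ hx
      · exact support_deriv_subset hx
    have := hR hx'
    rw [Metric.mem_closedBall, Real.dist_eq, sub_zero, abs_le] at this
    constructor <;> linarith [this.1, this.2, le_abs_self R]
  have dc : Continuous (deriv θ) := hθ.continuous_deriv le_rfl
  have ds : HasCompactSupport (deriv θ) := hc.deriv
  have hgI : Integrable ((Set.Ioc (-R) R).indicator g) :=
    (integrable_indicator_iff measurableSet_Ioc).2
      ((hg.integrableOn_isCompact isCompact_Icc).mono_set Set.Ioc_subset_Icc_self)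
  set gR := (Set.Ioc (-R) R).indicator g with hgR
  -- Fubini on the triangle y ≤ x: integrating in y produces the primitive of `g` based at `-R`,
  -- integrating in x produces `-θ y`. Truncating `g` to `(-R, R]` makes the integrand integrable on
  -- the plane.
  set F : ℝ → ℝ → ℂ := fun x y =>
    {p : ℝ × ℝ | p.2 ≤ p.1}.indicator (fun p => deriv θ p.1 * gR p.2) (x, y) with hF
  have hFint : Integrable (Function.uncurry F) (volume.prod volume) := by
    have := (Integrable.mul_prod
      (dc.integrable_of_hasCompactSupport (μ := volume) ds) hgI).indicator
      (measurableSet_le measurable_snd measurable_fst : MeasurableSet {p : ℝ × ℝ | p.2 ≤ p.1})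
    exact this
  have hswap := integral_integral_swap hFint
  have hleft : ∀ x, ∫ y, F x y = deriv θ x * ∫ y in (-R)..x, g y := by
    intro x
    by_cases hx : deriv θ x = 0
    · have : ∀ y, F x y = 0 := fun y => by
        simp only [hF, Set.indicator_apply, hx, zero_mul, ite_self]
      simp [this, hx]
    · obtain ⟨h1, h2⟩ := hR x (Or.inr hx)
      have : ∀ y, F x y = deriv θ x * (Set.Ioc (-R) x).indicator g y := by
        intro y
        simp only [hF, hgR, Set.indicator_apply, Set.mem_ofPred_eq, Set.mem_Ioc]
        by_cases hy : y ≤ x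
        · simp [hy, hy.trans h2]
        · simp [hy]
      simp_rw [this]
      rw [integral_const_mul, integral_indicator measurableSet_Ioc,
        intervalIntegral.integral_of_le h1.le]
  have hright : ∀ y, ∫ x, F x y = - (θ y * g y) := by
    intro y
    have : ∀ x, F x y = (Set.Ici y).indicator (deriv θ) x * gR y := by
      intro x
      simp only [hF, Set.indicator_apply, Set.mem_ofPred_eq, Set.mem_Ici]
      split_ifs <;> simp
    simp_rw [this]
    rw [integral_mul_const, integral_indicator measurableSet_Ici, integral_Ici_eq_integral_Ioi,
      hc.integral_Ioi_deriv_eq hθ]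
    by_cases hy : θ y = 0
    · simp [hy]
    · obtain ⟨h1, h2⟩ := hR y (Or.inl hy)
      simp [hgR, h1, h2]
  simp_rw [hleft, hright] at hswap
  rw [integral_neg] at hswap
  rw [← hswap]
  -- Moving the base point from 0 to `-R` only changes the constant, and constants are invisible
  -- since `deriv θ` has integral zero.
  set c' := c + ∫ y in (0 : ℝ)..(-R), g y with hc'
  have hsplit : ∀ x, deriv θ x * (c + ∫ y in (0 : ℝ)..x, g y)
      = deriv θ x * c' + deriv θ x * ∫ y in (-R)..x, g y := by
    intro x
    rw [← intervalIntegral.integral_add_adjacent_intervals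
      (intervalIntegrable_of_locallyIntegrable hg 0 (-R))
      (intervalIntegrable_of_locallyIntegrable hg (-R) x), hc']
    ring
  simp_rw [hsplit]
  rw [integral_add, integral_mul_const, integral_eq_zero_of_hasDerivAt_of_integrable
    (f := θ) (f' := deriv θ), zero_mul, zero_add]
  · exact fun x => (hθ.differentiable (by simp) x).hasDerivAt
  · exact dc.integrable_of_hasCompactSupport ds
  · exact hθ.continuous.integrable_of_hasCompactSupport hc
  · exact (dc.integrable_of_hasCompactSupport ds).mul_const _
  · refine Continuous.integrable_of_hasCompactSupport (dc.mul
      (intervalIntegral.continuous_primitive (intervalIntegrable_of_locallyIntegrable hg) _)) ?_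
    exact ds.mul_right

theorem hasWeakDeriv_primitive {g : ℝ → ℂ} (hg : LocallyIntegrable g) (c : ℂ) :
    HasWeakDeriv (fun x => c + ∫ y in (0 : ℝ)..x, g y) g := by
  refine ⟨(continuous_primitive_of_locallyIntegrable hg c).locallyIntegrable, hg,
    fun θ hθ hc => ?_⟩
  have h1 : ContDiff ℝ 1 fun x => ((θ x : ℝ) : ℂ) :=
    Complex.ofRealCLM.contDiff.comp (hθ.of_le (by simp))
  have h2 : HasCompactSupport fun x => ((θ x : ℝ) : ℂ) :=
    hc.comp_left (g := fun r : ℝ => (r : ℂ)) (by simp)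
  have h3 : deriv (fun x => ((θ x : ℝ) : ℂ)) = fun x => ((deriv θ x : ℝ) : ℂ) := by
    ext x
    exact ((hθ.differentiable (by simp) x).hasDerivAt.ofReal_comp).deriv
  have := integral_deriv_mul_primitive h1 h2 hg c
  rw [h3] at this
  exact this

/-- A function with vanishing weak derivative is constant. -/
theorem HasWeakDeriv.ae_eq_const {f : ℝ → ℂ} (h : HasWeakDeriv f 0) :
    ∃ c, f =ᵐ[volume] fun _ => c := by
  obtain ⟨χ, hχ1, hχ2, hχ3⟩ : ∃ χ : ℝ → ℝ, ContDiff ℝ ∞ χ ∧ HasCompactSupport χ ∧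
      ∫ x, χ x = 1 := by
    let b : ContDiffBump (0 : ℝ) := default
    exact ⟨b.normed volume, b.contDiff_normed, b.hasCompactSupport_normed, b.integral_normed⟩
  refine ⟨∫ x, ((χ x : ℝ) : ℂ) * f x, ?_⟩
  refine ae_eq_of_integral_contDiff_smul_eq h.1 (locallyIntegrable_const _) fun θ hθ hc => ?_
  set m := ∫ x, θ x with hm
  -- Subtracting `m * χ` makes the mean zero, so that the primitive `Θ` from -∞ has compact support
  -- and is itself a test function. Testing with `Θ` gives ∫θf = m∫χf.
  set ρ : ℝ → ℝ := fun x => θ x - m * χ x with hρ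
  have ρ1 : ContDiff ℝ ∞ ρ := hθ.sub (contDiff_const.mul hχ1)
  have ρ2 : HasCompactSupport ρ := by
    have : HasCompactSupport fun x => m * χ x := hχ2.mul_left
    exact hc.sub this
  have iθ : Integrable θ := hθ.continuous.integrable_of_hasCompactSupport hc
  have iχ : Integrable χ := hχ1.continuous.integrable_of_hasCompactSupport hχ2
  have iρ : Integrable ρ := ρ1.continuous.integrable_of_hasCompactSupport ρ2
  have ρ3 : ∫ x, ρ x = 0 := by
    rw [hρ, integral_sub iθ (iχ.const_mul m), integral_const_mul, hχ3, ← hm]; ring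
  obtain ⟨R, hR⟩ : ∃ R : ℝ, ∀ x, ρ x ≠ 0 → -R ≤ x ∧ x ≤ R := by
    obtain ⟨R, hR⟩ := ρ2.isCompact.isBounded.subset_closedBall 0
    refine ⟨R, fun x hx => ?_⟩
    have := hR (subset_tsupport _ hx)
    rw [Metric.mem_closedBall, Real.dist_eq, sub_zero, abs_le] at this
    exact this
  set Θ : ℝ → ℝ := fun x => ∫ y in Set.Iic x, ρ y with hΘ
  have dΘ : ∀ x, HasDerivAt Θ (ρ x) x := by
    intro x
    have e : Θ = fun x => (∫ y in Set.Iic 0, ρ y) + ∫ y in (0 : ℝ)..x, ρ y := by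
      ext x
      rw [← intervalIntegral.integral_Iic_sub_Iic iρ.integrableOn iρ.integrableOn]
      simp [hΘ]
    rw [e]
    exact (ρ1.continuous.integral_hasStrictDerivAt 0 x).hasDerivAt.const_add _
  have Θ1 : ContDiff ℝ ∞ Θ := by
    refine (contDiff_infty_iff_deriv (𝕜 := ℝ)).2 ⟨fun x => (dΘ x).differentiableAt, ?_⟩
    have : deriv Θ = ρ := by ext x; exact (dΘ x).deriv
    rw [this]; exact ρ1
  have Θ2 : HasCompactSupport Θ := by
    refine HasCompactSupport.intro (isCompact_Icc (a := -R) (b := R)) fun x hx => ?_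
    rw [Set.mem_Icc, not_and_or, not_le, not_le] at hx
    rcases hx with hx | hx
    · have : ∀ y ∈ Set.Iic x, ρ y = 0 := by
        intro y hy
        by_contra hne
        have := (hR y hne).1
        simp only [Set.mem_Iic] at hy
        linarith
      rw [hΘ]
      simp only
      rw [setIntegral_congr_fun measurableSet_Iic this]; simp
    · rw [hΘ]
      simp only
      rw [setIntegral_eq_integral_of_forall_compl_eq_zero, ρ3]
      intro y hy
      by_contra hne
      have := (hR y hne).2
      simp only [Set.mem_Iic, not_le] at hy
      linarith
  have key := h.2.2 Θ Θ1 Θ2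
  have : deriv Θ = ρ := by ext x; exact (dΘ x).deriv
  rw [this] at key
  simp only [Pi.zero_apply, mul_zero, integral_zero, neg_zero] at key
  have i1 : Integrable fun x => ((θ x : ℝ) : ℂ) * f x :=
    LocallyIntegrable.integrable_mul_of_hasCompactSupport h.1
      (Complex.continuous_ofReal.comp hθ.continuous)
      (hc.comp_left (g := fun r : ℝ => (r : ℂ)) (by simp))
  have i2 : Integrable fun x => ((χ x : ℝ) : ℂ) * f x :=
    LocallyIntegrable.integrable_mul_of_hasCompactSupport h.1
      (Complex.continuous_ofReal.comp hχ1.continuous)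
      (hχ2.comp_left (g := fun r : ℝ => (r : ℂ)) (by simp))
  have e1 : ∀ x, ((ρ x : ℝ) : ℂ) * f x = ((θ x : ℝ) : ℂ) * f x - m * (((χ x : ℝ) : ℂ) * f x) := by
    intro x; simp only [hρ]; push_cast; ring
  simp_rw [e1] at key
  rw [integral_sub i1 (i2.const_mul _), integral_const_mul, sub_eq_zero] at key
  simp only [Complex.real_smul]
  rw [key, integral_mul_const, integral_complex_ofReal]

/-- Subtracting a primitive of `g` leaves a function with zero weak derivative. Applied twice to an
element of H², this yields the C¹ representative on which the classical theory of the linear system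
runs. -/
theorem HasWeakDeriv.exists_primitive {f g : ℝ → ℂ} (h : HasWeakDeriv f g) :
    ∃ c, f =ᵐ[volume] fun x => c + ∫ y in (0 : ℝ)..x, g y := by
  have h0 := hasWeakDeriv_primitive h.2.1.neg 0
  have h1 := h.add h0
  have h2 : HasWeakDeriv (fun x => f x + (0 + ∫ y in (0 : ℝ)..x, (-g) y)) 0 :=
    h1.congr (ae_eq_refl _) (by filter_upwards with x; simp)
  obtain ⟨c, hc⟩ := h2.ae_eq_const
  refine ⟨c, ?_⟩
  filter_upwards [hc] with x hx
  simp only [Pi.neg_apply, intervalIntegral.integral_neg, zero_add] at hx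
  linear_combination hx

theorem hasWeakDeriv_of_hasDerivAt {f f' : ℝ → ℂ} (h : ∀ x, HasDerivAt f (f' x) x)
    (hc : Continuous f') : HasWeakDeriv f f' := by
  refine (hasWeakDeriv_primitive hc.locallyIntegrable (f 0)).congr ?_ (ae_eq_refl _)
  filter_upwards with x
  rw [intervalIntegral.integral_eq_sub_of_hasDerivAt (fun y _ => h y) (hc.intervalIntegrable _ _)]
  ring

/-- Leibniz rule for the product of a `C¹` function and a weakly differentiable one. -/
theorem HasWeakDeriv.mul {A A' w g : ℝ → ℂ} (hA : ∀ x, HasDerivAt A (A' x) x)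
    (hA' : Continuous A') (h : HasWeakDeriv w g) :
    HasWeakDeriv (fun x => A x * w x) (fun x => A' x * w x + A x * g x) := by
  obtain ⟨c, hc⟩ := h.exists_primitive
  have Ac : Continuous A := continuous_iff_continuousAt.2 fun x => (hA x).continuousAt
  have Ad : deriv A = A' := by ext x; exact (hA x).deriv
  have A1 : ContDiff ℝ 1 A :=
    contDiff_one_iff_deriv.2 ⟨fun x => (hA x).differentiableAt, by rw [Ad]; exact hA'⟩
  have l1 : LocallyIntegrable fun x => A x * w x := by
    simpa [smul_eq_mul] using h.1.continuous_smul Ac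
  have l2 : LocallyIntegrable fun x => A' x * w x := by
    simpa [smul_eq_mul] using h.1.continuous_smul hA'
  have l3 : LocallyIntegrable fun x => A x * g x := by
    simpa [smul_eq_mul] using h.2.1.continuous_smul Ac
  refine ⟨l1, l2.add l3, fun θ hθ hcs => ?_⟩
  have t1 : ContDiff ℝ 1 fun x => ((θ x : ℝ) : ℂ) :=
    Complex.ofRealCLM.contDiff.comp (hθ.of_le (by simp))
  have t2 : HasCompactSupport fun x => ((θ x : ℝ) : ℂ) :=
    hcs.comp_left (g := fun r : ℝ => (r : ℂ)) (by simp)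
  have t3 : HasCompactSupport fun x => ((deriv θ x : ℝ) : ℂ) :=
    hcs.deriv.comp_left (g := fun r : ℝ => (r : ℂ)) (by simp)
  have t4 : Continuous fun x => ((deriv θ x : ℝ) : ℂ) :=
    Complex.continuous_ofReal.comp (hθ.continuous_deriv (by simp))
  -- The product `θ * A` is only C¹ and complex valued, so it is no admissible test function for
  -- `HasWeakDeriv`; integration by parts against the primitive of `g` does accept it.
  have key := integral_deriv_mul_primitive (t1.mul A1) t2.mul_right h.2.1 c
  have e0 : deriv (fun x => ((θ x : ℝ) : ℂ) * A x)
      = fun x => ((deriv θ x : ℝ) : ℂ) * A x + ((θ x : ℝ) : ℂ) * A' x := by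
    ext x
    exact (((hθ.differentiable (by simp) x).hasDerivAt.ofReal_comp).mul (hA x)).deriv
  have e1 : ∫ x, deriv (fun x => ((θ x : ℝ) : ℂ) * A x) x * (c + ∫ y in (0 : ℝ)..x, g y)
      = ∫ x, (((deriv θ x : ℝ) : ℂ) * (A x * w x) + ((θ x : ℝ) : ℂ) * (A' x * w x)) := by
    refine integral_congr_ae ?_
    filter_upwards [hc] with x hx
    rw [e0, ← hx]; ring
  have e1' := e1.symm.trans key
  rw [integral_add
    (LocallyIntegrable.integrable_mul_of_hasCompactSupport l1 t4 t3)
    (LocallyIntegrable.integrable_mul_of_hasCompactSupport l2 t1.continuous t2)] at e1'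
  simp only [mul_add]
  rw [integral_add
    (LocallyIntegrable.integrable_mul_of_hasCompactSupport l2 t1.continuous t2)
    (LocallyIntegrable.integrable_mul_of_hasCompactSupport l3 t1.continuous t2)]
  simp only [mul_assoc] at e1' ⊢
  linear_combination e1'

/-! ## Representatives of elements of `H² ∩ H^{1,1}` -/

/-- `v` is `C¹` with derivative `w`, the weak derivative of `w` is `g`, and `v`, `w` and `g` have
the integrability required of an element of `H² ∩ H^{1,1}` and its derivatives. -/
structure IsRep (v w g : ℝ → ℂ) : Prop where
  hasDerivAt : ∀ x, HasDerivAt v (w x) x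
  cont : Continuous w
  weak : HasWeakDeriv w g
  memLp : MemLp g 2 volume
  memL21 : MemL21 v
  memL21' : MemL21 w

theorem IsRep.continuous {v w g : ℝ → ℂ} (h : IsRep v w g) : Continuous v :=
  continuous_iff_continuousAt.2 fun x => (h.hasDerivAt x).continuousAt

theorem MemL21.congr {f f' : ℝ → ℂ} (h : MemL21 f) (hf : f =ᵐ[volume] f') : MemL21 f' := by
  unfold MemL21 at *
  refine (memLp_congr_ae ?_).1 h
  filter_upwards [hf] with x hx
  rw [hx]

theorem one_le_norm_weight (x : ℝ) : 1 ≤ ‖((Real.sqrt (1 + x ^ 2) : ℝ) : ℂ)‖ := by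
  rw [Complex.norm_real, Real.norm_eq_abs, abs_of_nonneg (Real.sqrt_nonneg _)]
  exact Real.one_le_sqrt.2 (by nlinarith [sq_nonneg x])

theorem MemL21.memLp {f : ℝ → ℂ} (h : MemL21 f) (hf : AEStronglyMeasurable f volume) :
    MemLp f 2 volume := by
  refine MemLp.of_le h hf ?_
  filter_upwards with x
  rw [norm_mul]
  exact le_mul_of_one_le_left (norm_nonneg _) (one_le_norm_weight x)

theorem exists_isRep_of_memX {u : ℝ → ℂ} (h : MemX u) :
    ∃ v w g, IsRep v w g ∧ u =ᵐ[volume] v := by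
  obtain ⟨⟨h1, h2, h3, h4, h5⟩, ⟨h6, h7, h8⟩⟩ := h
  have d1 := hasWeakDeriv_weakDeriv h1
  have d2 := hasWeakDeriv_weakDeriv h2
  obtain ⟨c, hc⟩ := d2.exists_primitive
  set w := fun x => c + ∫ y in (0 : ℝ)..x, weakDeriv (weakDeriv u) y with hw
  have wc : Continuous w := continuous_primitive_of_locallyIntegrable d2.2.1 c
  obtain ⟨c', hc'⟩ := (d1.congr (ae_eq_refl _) hc).exists_primitive
  refine ⟨_, w, _, ⟨fun x => ?_, wc, d2.congr hc (ae_eq_refl _), h5, h7.congr hc', h8.congr hc⟩,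
    hc'⟩
  exact (wc.integral_hasStrictDerivAt 0 x).hasDerivAt.const_add _

/-- Weak derivatives are unique up to null sets, so `normX` can be read off a representative. This
serves both to extract bounds from `normX` of the given potential and to bound `normX` of its
transform. -/
theorem IsRep.memX {u v w g : ℝ → ℂ} (h : IsRep v w g) (hu : u =ᵐ[volume] v) :
    MemX u ∧ normX u = Real.sqrt ((∫ x, ‖v x‖ ^ 2) + (∫ x, ‖w x‖ ^ 2) + ∫ x, ‖g x‖ ^ 2) +
      Real.sqrt ((∫ x : ℝ, (1 + x ^ 2) * ‖v x‖ ^ 2) + ∫ x : ℝ, (1 + x ^ 2) * ‖w x‖ ^ 2) := by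
  have d1 : HasWeakDeriv u w :=
    (hasWeakDeriv_of_hasDerivAt h.hasDerivAt h.cont).congr hu.symm (ae_eq_refl _)
  have e1 := d1.weakDeriv_ae_eq
  have d2 : HasWeakDeriv (weakDeriv u) g := h.weak.congr e1.symm (ae_eq_refl _)
  have e2 := d2.weakDeriv_ae_eq
  refine ⟨⟨⟨⟨w, d1⟩, ⟨g, d2⟩, ?_, ?_, ?_⟩, ⟨⟨w, d1⟩, h.memL21.congr hu.symm,
    h.memL21'.congr e1.symm⟩⟩, ?_⟩
  · exact (memLp_congr_ae hu).2 (h.memL21.memLp h.continuous.aestronglyMeasurable)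
  · exact (memLp_congr_ae e1).2 (h.memL21'.memLp h.cont.aestronglyMeasurable)
  · exact (memLp_congr_ae e2).2 h.memLp
  · unfold normX normH2 normH11
    congr 2
    · congr 1
      · congr 1
        · exact integral_congr_ae (by filter_upwards [hu] with x hx; rw [hx])
        · exact integral_congr_ae (by filter_upwards [e1] with x hx; rw [hx])
      · exact integral_congr_ae (by filter_upwards [e2] with x hx; rw [hx])
    · congr 1
      · exact integral_congr_ae (by filter_upwards [hu] with x hx; rw [hx])
      · exact integral_congr_ae (by filter_upwards [e1] with x hx; rw [hx])

/-! ## Classical solutions of the Kaup–Newell problem -/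

/-- Continuous, bounded and integrable potentials. -/
structure IsPotential (u : ℝ → ℂ) : Prop where
  cont : Continuous u
  integrable : Integrable u
  bdd : ∃ B, ∀ x, ‖u x‖ ≤ B

/-- Classical solutions of the Kaup–Newell problem. -/
def IsSol (u : ℝ → ℂ) (lam : ℂ) (ψ : ℝ → Fin 2 → ℂ) : Prop :=
  ∀ x, HasDerivAt ψ (knMatrix u lam x *ᵥ ψ x) x

theorem knMatrix_mulVec (u : ℝ → ℂ) (lam : ℂ) (x : ℝ) (z : Fin 2 → ℂ) :
    knMatrix u lam x *ᵥ z = ![-Complex.I * lam ^ 2 * z 0 + lam * u x * z 1,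
      Complex.I * lam ^ 2 * z 1 - lam * conj (u x) * z 0] := by
  ext i
  fin_cases i
  · simp [knMatrix, sigma3, Q, Matrix.mulVec, dotProduct, Fin.sum_univ_two]
  · simp [knMatrix, sigma3, Q, Matrix.mulVec, dotProduct, Fin.sum_univ_two]; ring

theorem isSol_iff {u : ℝ → ℂ} {lam : ℂ} {ψ : ℝ → Fin 2 → ℂ} : IsSol u lam ψ ↔
    (∀ x, HasDerivAt (fun x => ψ x 0) (-Complex.I * lam ^ 2 * ψ x 0 + lam * u x * ψ x 1) x) ∧
    ∀ x, HasDerivAt (fun x => ψ x 1)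
      (Complex.I * lam ^ 2 * ψ x 1 - lam * conj (u x) * ψ x 0) x := by
  unfold IsSol
  simp only [knMatrix_mulVec]
  constructor
  · intro h
    exact ⟨fun x => hasDerivAt_pi.1 (h x) 0, fun x => hasDerivAt_pi.1 (h x) 1⟩
  · rintro ⟨h0, h1⟩ x
    refine hasDerivAt_pi.2 fun i => ?_
    fin_cases i
    · exact h0 x
    · exact h1 x

theorem IsSol.continuous {u : ℝ → ℂ} {lam : ℂ} {ψ : ℝ → Fin 2 → ℂ} (h : IsSol u lam ψ) :
    Continuous ψ :=
  continuous_iff_continuousAt.2 fun x => (h x).continuousAt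

theorem continuous_knMatrix_mulVec {u : ℝ → ℂ} (hu : Continuous u) (lam : ℂ)
    {ψ : ℝ → Fin 2 → ℂ} (hψ : Continuous ψ) : Continuous fun y => knMatrix u lam y *ᵥ ψ y := by
  simp only [knMatrix_mulVec]
  have h0 : Continuous fun y => ψ y 0 := (continuous_apply 0).comp hψ
  have h1 : Continuous fun y => ψ y 1 := (continuous_apply 1).comp hψ
  have hc : Continuous fun y => conj (u y) := Complex.continuous_conj.comp hu
  refine continuous_pi fun i => ?_
  fin_cases i
  · exact (continuous_const.mul h0).add ((continuous_const.mul hu).mul h1)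
  · exact (continuous_const.mul h1).sub ((continuous_const.mul hc).mul h0)

theorem isKNSolution_iff {u : ℝ → ℂ} (hu : Continuous u) {lam : ℂ} {ψ : ℝ → Fin 2 → ℂ} :
    IsKNSolution u lam ψ ↔ IsSol u lam ψ := by
  constructor
  · rintro ⟨hc, -, h⟩ x
    have hm := continuous_knMatrix_mulVec hu lam hc
    exact ((hm.integral_hasStrictDerivAt 0 x).hasDerivAt.const_add (ψ 0)).congr_of_eventuallyEq
      (Eventually.of_forall h)
  · intro h
    have hm := continuous_knMatrix_mulVec hu lam h.continuous
    refine ⟨h.continuous, hm.locallyIntegrable, fun x => ?_⟩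
    rw [intervalIntegral.integral_eq_sub_of_hasDerivAt (fun y _ => h y)
      (hm.intervalIntegrable _ _)]
    abel

theorem IsKNSolution.congr_potential {u v : ℝ → ℂ} (h : u =ᵐ[volume] v) {lam : ℂ}
    {ψ : ℝ → Fin 2 → ℂ} (hu : IsKNSolution u lam ψ) : IsKNSolution v lam ψ := by
  have e : (fun y => knMatrix u lam y *ᵥ ψ y) =ᵐ[volume] fun y => knMatrix v lam y *ᵥ ψ y := by
    filter_upwards [h] with y hy
    simp only [knMatrix, hy]
  refine ⟨hu.1, hu.2.1.congr e, fun x => ?_⟩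
  rw [hu.2.2 x, intervalIntegral.integral_congr_ae]
  filter_upwards [e] with y hy _ using hy

/-- Potentials equal almost everywhere have the same predicate `IsJostMinus`, so the choice in the
definition returns the same function. All scattering data may therefore be computed for the C¹
representative. -/
theorem jostMinus_congr {u v : ℝ → ℂ} (h : u =ᵐ[volume] v) : jostMinus u = jostMinus v := by
  have : IsJostMinus u = IsJostMinus v := by
    ext lam φ
    exact ⟨fun H => ⟨H.1.congr_potential h, H.2⟩, fun H => ⟨H.1.congr_potential h.symm, H.2⟩⟩
  unfold jostMinus
  rw [this]

theorem jostPlus_congr {u v : ℝ → ℂ} (h : u =ᵐ[volume] v) : jostPlus u = jostPlus v := by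
  have : IsJostPlus u = IsJostPlus v := by
    ext lam φ
    exact ⟨fun H => ⟨H.1.congr_potential h, H.2⟩, fun H => ⟨H.1.congr_potential h.symm, H.2⟩⟩
  unfold jostPlus
  rw [this]

theorem psiMinus_congr {u v : ℝ → ℂ} (h : u =ᵐ[volume] v) : psiMinus u = psiMinus v := by
  ext lam x : 2
  rw [psiMinus, psiMinus, jostMinus_congr h]

theorem psiPlus_congr {u v : ℝ → ℂ} (h : u =ᵐ[volume] v) : psiPlus u = psiPlus v := by
  ext lam x : 2
  rw [psiPlus, psiPlus, jostPlus_congr h]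

theorem a_congr {u v : ℝ → ℂ} (h : u =ᵐ[volume] v) : a u = a v := by
  ext lam
  rw [a, a, psiMinus_congr h, psiPlus_congr h]

theorem etaOne_congr {u v : ℝ → ℂ} (h : u =ᵐ[volume] v) (lam γ : ℂ) :
    etaOne lam γ u = etaOne lam γ v := by
  ext x : 1
  rw [etaOne, etaOne, psiMinus_congr h, psiPlus_congr h, a_congr h]

/-! ### Uniqueness of solutions, the Wronskian, uniqueness of the Jost function at -∞. -/

theorem IsSol.unique {u : ℝ → ℂ} (hu : IsPotential u) {lam : ℂ} {ψ χ : ℝ → Fin 2 → ℂ}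
    (hψ : IsSol u lam ψ) (hχ : IsSol u lam χ) {x₀ : ℝ} (h : ψ x₀ = χ x₀) : ψ = χ := by
  obtain ⟨B, hB⟩ := hu.bdd
  have hB0 : 0 ≤ B := (norm_nonneg _).trans (hB 0)
  set K : NNReal := ⟨‖lam‖ ^ 2 + ‖lam‖ * B, by positivity⟩ with hK
  refine ODE_solution_unique_univ (v := fun t z => knMatrix u lam t *ᵥ z) (K := K)
    (s := fun _ => Set.univ) (fun t => ?_) (fun t => ⟨hψ t, trivial⟩) (fun t => ⟨hχ t, trivial⟩) h
  refine (LipschitzWith.of_dist_le_mul fun z z' => ?_).lipschitzOnWith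
  have e : ∀ i, ‖z i - z' i‖ ≤ dist z z' := fun i => by
    rw [← dist_eq_norm]; exact dist_le_pi_dist z z' i
  -- Both rows of the system have the form `s * lam ^ 2 * p + lam * c * q` with |s| = 1 and |c| =
  -- |u|, so one estimate gives the Lipschitz constant for both.
  have key : ∀ p q : ℂ, ‖p‖ ≤ dist z z' → ‖q‖ ≤ dist z z' → ∀ c : ℂ, ‖c‖ = ‖u t‖ →
      ∀ s : ℂ, ‖s‖ = 1 → ‖s * lam ^ 2 * p + lam * c * q‖ ≤ (‖lam‖ ^ 2 + ‖lam‖ * B) * dist z z' := by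
    intro p q hp hq c hc s hs
    refine (norm_add_le _ _).trans ?_
    rw [norm_mul, norm_mul, norm_mul, norm_mul, norm_pow, hs, one_mul, add_mul, hc]
    have := hB t
    gcongr
  change dist (knMatrix u lam t *ᵥ z) (knMatrix u lam t *ᵥ z') ≤ (‖lam‖ ^ 2 + ‖lam‖ * B) * dist z z'
  refine (dist_pi_le_iff (by positivity)).2 fun i => ?_
  rw [dist_eq_norm]
  fin_cases i
  · have := key _ _ (e 0) (e 1) (u t) rfl (-Complex.I) (by simp)
    simp only [knMatrix_mulVec, Fin.zero_eta, Matrix.cons_val_zero]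
    refine le_of_eq_of_le ?_ this
    congr 1; ring
  · have := key _ _ (e 1) (e 0) (-conj (u t)) (by simp) Complex.I (by simp)
    simp only [knMatrix_mulVec, Fin.mk_one, Matrix.cons_val_one]
    refine le_of_eq_of_le ?_ this
    congr 1; simp; ring

theorem isSol_zero (u : ℝ → ℂ) (lam : ℂ) : IsSol u lam 0 := by
  intro x
  simp only [Pi.zero_apply, Matrix.mulVec_zero]
  exact hasDerivAt_const x (0 : Fin 2 → ℂ)

theorem IsSol.smul {u : ℝ → ℂ} {lam : ℂ} {ψ : ℝ → Fin 2 → ℂ} (h : IsSol u lam ψ) (c : ℂ) :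
    IsSol u lam (fun x => c • ψ x) := by
  intro x
  rw [Matrix.mulVec_smul]
  exact (h x).const_smul c

theorem IsSol.add {u : ℝ → ℂ} {lam : ℂ} {ψ χ : ℝ → Fin 2 → ℂ} (h : IsSol u lam ψ)
    (h' : IsSol u lam χ) : IsSol u lam (fun x => ψ x + χ x) := by
  intro x
  rw [Matrix.mulVec_add]
  exact (h x).add (h' x)

/-- Liouville's formula: the matrix of the system has trace zero. -/
theorem IsSol.wronskian_eq {u : ℝ → ℂ} {lam : ℂ} {ψ χ : ℝ → Fin 2 → ℂ} (hψ : IsSol u lam ψ)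
    (hχ : IsSol u lam χ) (x y : ℝ) : wronskian (ψ x) (χ x) = wronskian (ψ y) (χ y) := by
  obtain ⟨p0, p1⟩ := isSol_iff.1 hψ
  obtain ⟨q0, q1⟩ := isSol_iff.1 hχ
  have hd : ∀ x, HasDerivAt (fun x => wronskian (ψ x) (χ x)) 0 x := by
    intro x
    refine (((p0 x).mul (q1 x)).sub ((q0 x).mul (p1 x))).congr_deriv ?_
    ring
  exact is_const_of_deriv_eq_zero (fun x => (hd x).differentiableAt) (fun x => (hd x).deriv) x y

theorem wronskian_smul_smul (c c' : ℂ) (η ξ : Fin 2 → ℂ) :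
    wronskian (c • η) (c' • ξ) = c * c' * wronskian η ξ := by
  simp [wronskian]; ring

theorem CI_im_sq {lam : ℂ} (h : lam ∈ CI) : 0 < (lam ^ 2).im := by
  have : (lam ^ 2).im = 2 * (lam.re * lam.im) := by
    rw [sq, Complex.mul_im]; ring
  rw [this]
  have := mul_pos h.1 h.2
  positivity

theorem isOpen_CI : IsOpen CI :=
  (isOpen_lt continuous_const Complex.continuous_re).inter
    (isOpen_lt continuous_const Complex.continuous_im)

theorem norm_exp_I_mul (lam : ℂ) (x : ℝ) :
    ‖Complex.exp (Complex.I * lam ^ 2 * x)‖ = Real.exp (-((lam ^ 2).im * x)) := by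
  rw [Complex.norm_exp]
  congr 1
  simp [Complex.mul_re, Complex.mul_im]

theorem norm_exp_neg_I_mul (lam : ℂ) (x : ℝ) :
    ‖Complex.exp (-Complex.I * lam ^ 2 * x)‖ = Real.exp ((lam ^ 2).im * x) := by
  rw [Complex.norm_exp]
  congr 1
  simp [Complex.mul_re, Complex.mul_im]

/-- The Jost function at `-∞` is unique. -/
theorem IsJostMinus.unique {u : ℝ → ℂ} (hu : IsPotential u) {lam : ℂ} (hlam : lam ∈ CI)
    {φ φ' : ℝ → Fin 2 → ℂ} (h : IsJostMinus u lam φ) (h' : IsJostMinus u lam φ') : φ = φ' := by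
  have s := (isKNSolution_iff hu.cont).1 h.1
  have s' := (isKNSolution_iff hu.cont).1 h'.1
  have hβ := CI_im_sq hlam
  set E : ℝ → ℂ := fun x => Complex.exp (-Complex.I * lam ^ 2 * x) with hE
  have hE0 : ∀ x, E x ≠ 0 := fun x => Complex.exp_ne_zero _
  have hEt : Tendsto E atBot (𝓝 0) := by
    rw [tendsto_zero_iff_norm_tendsto_zero]
    simp only [hE, norm_exp_neg_I_mul]
    exact Real.tendsto_exp_atBot.comp (tendsto_id.const_mul_atBot hβ)
  have cont_w : Continuous fun p : (Fin 2 → ℂ) × (Fin 2 → ℂ) => wronskian p.1 p.2 := by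
    unfold wronskian
    fun_prop
  -- The Wronskian is constant and equals e^{-2iλ²x} W(φ, φ'), which tends to 0 at -∞ because Im λ²
  -- > 0. Two candidates are therefore proportional, and the common limit at -∞ makes the factor 1.
  have hw : ∀ x, wronskian (E x • φ x) (E x • φ' x) = 0 := by
    intro x
    have t1 : Tendsto (fun y => wronskian (E y • φ y) (E y • φ' y)) atBot (𝓝 0) := by
      have : Tendsto (fun y => E y * E y * wronskian (φ y) (φ' y)) atBot
          (𝓝 (0 * 0 * wronskian ![1, 0] ![1, 0])) :=
        (hEt.mul hEt).mul ((cont_w.tendsto _).comp (h.2.2.prodMk_nhds h'.2.2))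
      simpa [wronskian_smul_smul] using this
    refine tendsto_nhds_unique (tendsto_const_nhds.congr fun y => ?_) t1
    exact s.wronskian_eq s' x y
  have hne : φ 0 ≠ 0 := by
    intro h0
    have hz : (fun x => E x • φ x) = 0 :=
      s.unique hu (isSol_zero u lam) (x₀ := 0) (by simp [h0])
    have : φ = fun _ => 0 := by
      ext x : 1
      simpa [hE0 x] using congrFun hz x
    have hl := h.2.2
    rw [this] at hl
    have := tendsto_nhds_unique hl tendsto_const_nhds
    simpa using congrFun this 0
  obtain ⟨c, hc⟩ : ∃ c : ℂ, φ' 0 = c • φ 0 := by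
    have w0 := hw 0
    rw [wronskian_smul_smul, mul_eq_zero] at w0
    have w1 := w0.resolve_left (mul_ne_zero (hE0 0) (hE0 0))
    unfold wronskian at w1
    by_cases h0 : φ 0 0 = 0
    · have h1 : φ 0 1 ≠ 0 := fun h1 => hne (by ext i; fin_cases i <;> simp [h0, h1])
      refine ⟨φ' 0 1 / φ 0 1, ?_⟩
      ext i; fin_cases i
      · simp only [h0, zero_mul, zero_sub, neg_eq_zero, mul_eq_zero] at w1
        simp [h0, w1.resolve_right h1]
      · simp [h1]
    · refine ⟨φ' 0 0 / φ 0 0, ?_⟩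
      ext i; fin_cases i
      · simp [h0]
      · simp only [Fin.mk_one, Pi.smul_apply, smul_eq_mul]
        field_simp
        linear_combination w1
  have hall : (fun x => E x • φ' x) = fun x => c • E x • φ x :=
    s'.unique hu (s.smul c) (x₀ := 0) (by simp only [hc]; rw [smul_comm])
  have hφ : ∀ x, φ' x = c • φ x := by
    intro x
    have := congrFun hall x
    rw [smul_comm c] at this
    exact smul_right_injective _ (hE0 x) this
  have hl : Tendsto (fun x => c • φ x) atBot (𝓝 (c • ![1, 0])) := h.2.2.const_smul c
  have := tendsto_nhds_unique hl (h'.2.2.congr hφ)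
  have hc1 : c = 1 := by simpa using congrFun this 0
  ext x : 1
  rw [hφ x, hc1, one_smul]

theorem IsJostMinus.eq_jostMinus {u : ℝ → ℂ} (hu : IsPotential u) {lam : ℂ} (hlam : lam ∈ CI)
    {φ : ℝ → Fin 2 → ℂ} (h : IsJostMinus u lam φ) : jostMinus u lam = φ := by
  have hex : ∃ φ, IsJostMinus u lam φ := ⟨φ, h⟩
  rw [jostMinus, dif_pos hex]
  exact hex.choose_spec.unique hu hlam h

/-! ## Reflection -/

/-- The reflected potential `x ↦ conj u(-x)`. -/
def reflect (u : ℝ → ℂ) (x : ℝ) : ℂ := conj (u (-x))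

/-- Reflection of the line combined with the exchange of the two components. -/
def swapVec (φ : ℝ → Fin 2 → ℂ) (x : ℝ) : Fin 2 → ℂ := ![φ (-x) 1, φ (-x) 0]

theorem reflect_reflect (u : ℝ → ℂ) : reflect (reflect u) = u := by
  ext x; simp [reflect]

theorem swapVec_swapVec (φ : ℝ → Fin 2 → ℂ) : swapVec (swapVec φ) = φ := by
  ext x i; fin_cases i <;> simp [swapVec]

theorem IsPotential.reflect {u : ℝ → ℂ} (hu : IsPotential u) : IsPotential (reflect u) := by
  obtain ⟨B, hB⟩ := hu.bdd
  refine ⟨Complex.continuous_conj.comp (hu.cont.comp continuous_neg), ?_, B, fun x => ?_⟩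
  · have := hu.integrable.comp_neg
    exact (Complex.conjCLE.toContinuousLinearMap.integrable_comp this)
  · simpa [KaupNewell.reflect] using hB (-x)

theorem integral_norm_reflect (u : ℝ → ℂ) : ∫ x, ‖reflect u x‖ = ∫ x, ‖u x‖ := by
  simp only [reflect, RCLike.norm_conj]
  exact integral_neg_eq_self (fun x => ‖u x‖) volume

/-- The sign produced by x ↦ -x is undone by exchanging the components, with the same `lam`. The
symmetry interchanges the two ends of the line, so every fact about `jostPlus` follows from one
about `jostMinus`. -/
theorem IsSol.swapVec {u : ℝ → ℂ} {lam : ℂ} {ψ : ℝ → Fin 2 → ℂ} (h : IsSol u lam ψ) :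
    IsSol (KaupNewell.reflect u) lam (swapVec ψ) := by
  obtain ⟨h0, h1⟩ := isSol_iff.1 h
  refine isSol_iff.2 ⟨fun x => ?_, fun x => ?_⟩
  · have := (h1 (-x)).scomp x (hasDerivAt_neg x)
    refine this.congr_deriv ?_
    simp [KaupNewell.swapVec, KaupNewell.reflect]; ring
  · have := (h0 (-x)).scomp x (hasDerivAt_neg x)
    refine this.congr_deriv ?_
    simp [KaupNewell.swapVec, KaupNewell.reflect]; ring

theorem norm_swapVec (φ : ℝ → Fin 2 → ℂ) (x : ℝ) : ‖swapVec φ x‖ ≤ ‖φ (-x)‖ := by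
  refine (pi_norm_le_iff_of_nonneg (norm_nonneg _)).2 fun i => ?_
  fin_cases i
  · exact norm_le_pi_norm (φ (-x)) 1
  · exact norm_le_pi_norm (φ (-x)) 0

theorem tendsto_swapVec {φ : ℝ → Fin 2 → ℂ} {l l' : Filter ℝ} (hl : Tendsto Neg.neg l' l)
    {z : Fin 2 → ℂ} (h : Tendsto φ l (𝓝 z)) : Tendsto (swapVec φ) l' (𝓝 ![z 1, z 0]) := by
  have := h.comp hl
  refine tendsto_pi_nhds.2 fun i => ?_
  fin_cases i
  · exact tendsto_pi_nhds.1 this 1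
  · exact tendsto_pi_nhds.1 this 0

theorem IsJostMinus.swapVec {u : ℝ → ℂ} (hu : Continuous u) {lam : ℂ} {φ : ℝ → Fin 2 → ℂ}
    (h : IsJostMinus u lam φ) : IsJostPlus (KaupNewell.reflect u) lam (swapVec φ) := by
  obtain ⟨h1, ⟨R, hR⟩, h3⟩ := h
  have hu' : Continuous (KaupNewell.reflect u) :=
    Complex.continuous_conj.comp (hu.comp continuous_neg)
  refine ⟨(isKNSolution_iff hu').2 ?_, ⟨R, fun x => (norm_swapVec φ x).trans (hR _)⟩, ?_⟩
  · have := ((isKNSolution_iff hu).1 h1).swapVec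
    convert this using 2 with x
    ext i; fin_cases i <;> simp [KaupNewell.swapVec]
  · simpa using tendsto_swapVec tendsto_neg_atTop_atBot h3

theorem IsJostPlus.swapVec {u : ℝ → ℂ} (hu : Continuous u) {lam : ℂ} {φ : ℝ → Fin 2 → ℂ}
    (h : IsJostPlus u lam φ) : IsJostMinus (KaupNewell.reflect u) lam (swapVec φ) := by
  obtain ⟨h1, ⟨R, hR⟩, h3⟩ := h
  have hu' : Continuous (KaupNewell.reflect u) :=
    Complex.continuous_conj.comp (hu.comp continuous_neg)
  refine ⟨(isKNSolution_iff hu').2 ?_, ⟨R, fun x => (norm_swapVec φ x).trans (hR _)⟩, ?_⟩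
  · have := ((isKNSolution_iff hu).1 h1).swapVec
    convert this using 2 with x
    ext i; fin_cases i <;> simp [KaupNewell.swapVec]
  · simpa using tendsto_swapVec tendsto_neg_atBot_atTop h3

theorem IsJostPlus.eq_jostPlus {u : ℝ → ℂ} (hu : IsPotential u) {lam : ℂ} (hlam : lam ∈ CI)
    {φ : ℝ → Fin 2 → ℂ} (h : IsJostPlus u lam φ) : jostPlus u lam = φ := by
  have hex : ∃ φ, IsJostPlus u lam φ := ⟨φ, h⟩
  rw [jostPlus, dif_pos hex]
  have := (hex.choose_spec.swapVec hu.cont).unique hu.reflect hlam (h.swapVec hu.cont)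
  rw [← swapVec_swapVec hex.choose, this, swapVec_swapVec]

theorem jostPlus_eq_swapVec {u : ℝ → ℂ} (hu : IsPotential u) {lam : ℂ} (hlam : lam ∈ CI)
    {φ : ℝ → Fin 2 → ℂ} (h : IsJostMinus (reflect u) lam φ) : jostPlus u lam = swapVec φ := by
  have := h.swapVec hu.reflect.cont
  rw [reflect_reflect] at this
  exact this.eq_jostPlus hu hlam

/-! ## Integrals depending holomorphically on a parameter -/

/-- Domination of `F` itself suffices: Cauchy's estimate on discs of radius ρ bounds the derivative
in the parameter by `bound y / ρ`. -/
theorem differentiableOn_integral_of_bound {Ω : Set ℂ} (hΩ : IsOpen Ω) {F : ℂ → ℝ → ℂ}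
    {μ : Measure ℝ} (hm : ∀ z ∈ Ω, AEStronglyMeasurable (F z) μ)
    (hd : ∀ᵐ y ∂μ, DifferentiableOn ℂ (fun z => F z y) Ω)
    (hb : ∀ z ∈ Ω, ∃ r > 0, ∃ bound : ℝ → ℝ, Integrable bound μ ∧
      ∀ᵐ y ∂μ, ∀ w ∈ Ω ∩ Metric.ball z r, ‖F w y‖ ≤ bound y) :
    DifferentiableOn ℂ (fun z => ∫ y, F z y ∂μ) Ω := by
  intro z hz
  obtain ⟨r, hr, bound, hbi, hbb⟩ := hb z hz
  -- The radius is doubled so that a disc of radius ρ about any point of the ball of radius ρ stays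
  -- in the domain.
  obtain ⟨ρ, hρ, hsub⟩ : ∃ ρ > 0, Metric.closedBall z (2 * ρ) ⊆ Ω ∩ Metric.ball z r := by
    obtain ⟨ε, hε, h⟩ := Metric.nhds_basis_closedBall.mem_iff.1
      ((hΩ.inter Metric.isOpen_ball).mem_nhds ⟨hz, Metric.mem_ball_self hr⟩)
    exact ⟨ε / 2, by positivity, by rw [mul_div_cancel₀ _ (two_ne_zero)]; exact h⟩
  have hF0 : ∀ᵐ y ∂μ, ‖F z y‖ ≤ bound y := by
    filter_upwards [hbb] with y hy using hy z ⟨hz, Metric.mem_ball_self hr⟩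
  have hball : ∀ w ∈ Metric.ball z ρ, Metric.closedBall w ρ ⊆ Metric.closedBall z (2 * ρ) := by
    intro w hw
    refine Metric.closedBall_subset_closedBall' ?_
    rw [Metric.mem_ball] at hw
    linarith
  have hdiff : ∀ᵐ y ∂μ, ∀ w ∈ Metric.ball z ρ,
      HasDerivAt (fun z => F z y) (deriv (fun z => F z y) w) w := by
    filter_upwards [hd] with y hy w hw
    refine ((hy w ?_).differentiableAt (hΩ.mem_nhds ?_)).hasDerivAt
    all_goals exact (hsub (hball w hw (Metric.mem_closedBall_self hρ.le))).1
  have hmeas : AEStronglyMeasurable (fun y => deriv (fun z => F z y) z) μ := by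
    -- The derivative in the parameter is measurable in `y` as a limit of difference quotients along
    -- a sequence tending to `z`.
    set s : ℕ → ℂ := fun n => z + ((ρ / (n + 1) : ℝ) : ℂ) with hs
    have hpos : ∀ n : ℕ, 0 < ρ / ((n : ℝ) + 1) := fun n => by positivity
    have hsz : ∀ n, s n ≠ z := fun n h => by
      have : ((ρ / (n + 1) : ℝ) : ℂ) = 0 := by simpa [hs] using h
      exact (hpos n).ne' (by exact_mod_cast this)
    have hsΩ : ∀ n, s n ∈ Ω := fun n => by
      refine (hsub ?_).1
      rw [Metric.mem_closedBall, dist_eq_norm]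
      simp only [hs, add_sub_cancel_left, Complex.norm_real, Real.norm_eq_abs, abs_of_pos (hpos n)]
      refine (div_le_self hρ.le ?_).trans (by linarith)
      linarith [n.cast_nonneg (α := ℝ)]
    have hst : Tendsto s atTop (𝓝[≠] z) := by
      refine tendsto_nhdsWithin_iff.2 ⟨?_, Eventually.of_forall hsz⟩
      have h1 : Tendsto (fun n : ℕ => ρ / ((n : ℝ) + 1)) atTop (𝓝 0) := by
        simpa [div_eq_mul_inv] using (tendsto_one_div_add_atTop_nhds_zero_nat (𝕜 := ℝ)).const_mul ρ
      have h2 := (Complex.continuous_ofReal.tendsto 0).comp h1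
      simpa [hs, Function.comp_def] using h2.const_add z
    refine aestronglyMeasurable_of_tendsto_ae atTop
      (f := fun n y => slope (fun z => F z y) z (s n)) (fun n => ?_) ?_
    · simp only [slope_def_field]
      simp only [div_eq_mul_inv]
      exact ((hm _ (hsΩ n)).sub (hm z hz)).mul_const _
    · filter_upwards [hdiff] with y hy
      exact ((hy z (Metric.mem_ball_self hρ)).tendsto_slope).comp hst
  refine (hasDerivAt_integral_of_dominated_loc_of_deriv_le (s := Metric.ball z ρ)
    (F' := fun w y => deriv (fun z => F z y) w) (bound := fun y => bound y / ρ)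
    (Metric.ball_mem_nhds z hρ) ?_ (hbi.mono' (hm z hz) hF0) hmeas ?_ (hbi.div_const _)
    hdiff).2.differentiableAt.differentiableWithinAt
  · filter_upwards [hΩ.mem_nhds hz] with w hw using hm w hw
  · filter_upwards [hd, hbb] with y hy hyb w hw
    have hsub' : Metric.closedBall w ρ ⊆ Ω ∩ Metric.ball z r := (hball w hw).trans hsub
    refine Complex.norm_deriv_le_of_forall_mem_sphere_norm_le hρ ?_ fun v hv =>
      hyb v (hsub' (Metric.sphere_subset_closedBall hv))
    refine DifferentiableOn.diffContOnCl ?_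
    rw [closure_ball _ hρ.ne']
    exact hy.mono fun v hv => (hsub' hv).1

theorem hasDerivAt_integral_Iic {E : Type*} [NormedAddCommGroup E] [NormedSpace ℝ E]
    [CompleteSpace E] {h : ℝ → E} (hc : Continuous h)
    (hi : ∀ x, IntegrableOn h (Set.Iic x)) (x : ℝ) :
    HasDerivAt (fun x => ∫ y in Set.Iic x, h y) (h x) x := by
  have e : (fun x => ∫ y in Set.Iic x, h y)
      = fun x => (∫ y in Set.Iic 0, h y) + ∫ y in (0 : ℝ)..x, h y := by
    ext x
    rw [← intervalIntegral.integral_Iic_sub_Iic (hi 0) (hi x)]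
    abel
  rw [e]
  exact (hc.integral_hasStrictDerivAt 0 x).hasDerivAt.const_add _

theorem tendsto_integral_Iic_atBot {E : Type*} [NormedAddCommGroup E] [NormedSpace ℝ E]
    {h : ℝ → E} (hi : Integrable h) : Tendsto (fun x => ∫ y in Set.Iic x, h y) atBot (𝓝 0) := by
  have h0 : ∫ x in (∅ : Set ℝ), h x = 0 := by simp
  -- Indexing by the order dual turns `atBot` into `atTop` for a decreasing family of half lines
  -- with empty intersection.
  have : Tendsto (fun i : ℝᵒᵈ => ∫ y in Set.Iic (OrderDual.ofDual i), h y) atTop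
      (𝓝 (∫ y in ⋂ i : ℝᵒᵈ, Set.Iic (OrderDual.ofDual i), h y)) := by
    refine tendsto_setIntegral_of_antitone (fun i => measurableSet_Iic) ?_
      ⟨OrderDual.toDual 0, hi.integrableOn⟩
    intro i j hij
    exact Set.Iic_subset_Iic.2 hij
  have he : (⋂ i : ℝᵒᵈ, Set.Iic (OrderDual.ofDual i)) = (∅ : Set ℝ) := by
    ext y
    simp only [Set.mem_iInter, Set.mem_Iic, Set.mem_empty_iff_false, iff_false, not_forall, not_le]
    exact ⟨OrderDual.toDual (y - 1), by simp⟩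
  rw [he, h0] at this
  exact this

/-! ## The Volterra operators -/

/-- The mass of `u` to the left of `x`. -/
def mass (u : ℝ → ℂ) (x : ℝ) : ℝ := ∫ y in Set.Iic x, ‖u y‖

theorem IsPotential.mass_le {u : ℝ → ℂ} (hu : IsPotential u) (x : ℝ) :
    mass u x ≤ ∫ y, ‖u y‖ :=
  setIntegral_le_integral hu.integrable.norm (Eventually.of_forall fun _ => norm_nonneg _)

theorem IsPotential.hasDerivAt_mass {u : ℝ → ℂ} (hu : IsPotential u) (x : ℝ) :
    HasDerivAt (mass u) ‖u x‖ x :=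
  hasDerivAt_integral_Iic hu.cont.norm (fun _ => hu.integrable.norm.integrableOn) x

theorem IsPotential.continuous_mass {u : ℝ → ℂ} (hu : IsPotential u) : Continuous (mass u) :=
  continuous_iff_continuousAt.2 fun x => (hu.hasDerivAt_mass x).continuousAt

theorem IsPotential.tendsto_mass {u : ℝ → ℂ} (hu : IsPotential u) :
    Tendsto (mass u) atBot (𝓝 0) :=
  tendsto_integral_Iic_atBot hu.integrable.norm

/-- The integrand times `A` is the derivative of `exp (2 * A * mass u) / 2`. This is the source of
the contraction factor 1/2 below. -/
theorem IsPotential.integral_mul_exp_mass_le {u : ℝ → ℂ} (hu : IsPotential u) {A : ℝ} (hA : 0 ≤ A)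
    (x : ℝ) : A * ∫ y in Set.Iic x, ‖u y‖ * Real.exp (2 * A * mass u y)
      ≤ Real.exp (2 * A * mass u x) / 2 := by
  have hd : ∀ y, HasDerivAt (fun y => Real.exp (2 * A * mass u y) / 2)
      (A * (‖u y‖ * Real.exp (2 * A * mass u y))) y := by
    intro y
    refine ((((hu.hasDerivAt_mass y).const_mul (2 * A)).exp).div_const 2).congr_deriv ?_
    ring
  have hi : Integrable fun y => A * (‖u y‖ * Real.exp (2 * A * mass u y)) := by
    refine Integrable.const_mul (hu.integrable.norm.mul_bdd
      (c := Real.exp (2 * A * ∫ y, ‖u y‖)) ?_ ?_) A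
    · exact (Real.continuous_exp.comp
        (continuous_const.mul hu.continuous_mass)).aestronglyMeasurable
    · refine Eventually.of_forall fun y => ?_
      rw [Real.norm_eq_abs, abs_of_pos (Real.exp_pos _)]
      have := hu.mass_le y
      gcongr
  have ht : Tendsto (fun y => Real.exp (2 * A * mass u y) / 2) atBot
      (𝓝 (Real.exp (2 * A * 0) / 2)) :=
    ((Real.continuous_exp.tendsto _).comp (hu.tendsto_mass.const_mul _)).div_const _
  rw [← integral_const_mul, integral_Iic_of_hasDerivAt_of_tendsto' (fun y _ => hd y)
    hi.integrableOn ht]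
  simp

/-- The Volterra operator with exponential kernel. -/
def volt (lam κ : ℂ) (c f : ℝ → ℂ) (x : ℝ) : ℂ :=
  lam * ∫ y in Set.Iic x, Complex.exp (κ * (x - y)) * (c y * f y)

theorem norm_exp_mul_sub_le {κ : ℂ} (hκ : κ.re ≤ 0) {x y : ℝ} (h : y ≤ x) :
    ‖Complex.exp (κ * (x - y))‖ ≤ 1 := by
  rw [Complex.norm_exp, Real.exp_le_one_iff]
  have : (κ * (x - y)).re = κ.re * (x - y) := by
    rw [← Complex.ofReal_sub, Complex.re_mul_ofReal]
  rw [this]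
  exact mul_nonpos_of_nonpos_of_nonneg hκ (by linarith)

theorem continuous_kernel {κ : ℂ} {c f : ℝ → ℂ} (hc : Continuous c) (hf : Continuous f) (x : ℝ) :
    Continuous fun y : ℝ => Complex.exp (κ * (x - y)) * (c y * f y) := by
  fun_prop

theorem norm_kernel_le {κ : ℂ} (hκ : κ.re ≤ 0) {u c f : ℝ → ℂ} (hcu : ∀ y, ‖c y‖ = ‖u y‖)
    {B : ℝ} {x y : ℝ} (hB : ‖f y‖ ≤ B) (h : y ≤ x) :
    ‖Complex.exp (κ * (x - y)) * (c y * f y)‖ ≤ ‖u y‖ * B := by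
  rw [norm_mul, norm_mul, hcu]
  calc _ ≤ 1 * (‖u y‖ * B) := by
        gcongr
        exact norm_exp_mul_sub_le hκ h
    _ = _ := one_mul _

theorem integrableOn_kernel {κ : ℂ} (hκ : κ.re ≤ 0) {u c f : ℝ → ℂ} (hu : IsPotential u)
    (hc : Continuous c) (hcu : ∀ y, ‖c y‖ = ‖u y‖) (hf : Continuous f) {B : ℝ}
    (hB : ∀ y, ‖f y‖ ≤ B) (x : ℝ) :
    IntegrableOn (fun y : ℝ => Complex.exp (κ * (x - y)) * (c y * f y)) (Set.Iic x) := by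
  refine Integrable.mono' (hu.integrable.norm.mul_const B).integrableOn
    (continuous_kernel hc hf x).aestronglyMeasurable ?_
  filter_upwards [ae_restrict_mem measurableSet_Iic] with y hy
  exact norm_kernel_le hκ hcu (hB y) hy

/-- In the supremum norm weighted by `exp (-2‖lam‖ mass u)` the Volterra operator has norm at most
1/2, however large `u` is. Hence the Neumann series converges without a smallness assumption. -/
theorem norm_volt_le {κ : ℂ} (hκ : κ.re ≤ 0) {u c f : ℝ → ℂ} (hu : IsPotential u)
    (hcu : ∀ y, ‖c y‖ = ‖u y‖) {lam : ℂ} {K : ℝ}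
    (hK : 0 ≤ K) (hfK : ∀ y, ‖f y‖ ≤ K * Real.exp (2 * ‖lam‖ * mass u y)) (x : ℝ) :
    ‖volt lam κ c f x‖ ≤ K / 2 * Real.exp (2 * ‖lam‖ * mass u x) := by
  have hE : Continuous fun y => Real.exp (2 * ‖lam‖ * mass u y) :=
    Real.continuous_exp.comp (continuous_const.mul hu.continuous_mass)
  have hi : Integrable fun y => ‖u y‖ * Real.exp (2 * ‖lam‖ * mass u y) := by
    refine hu.integrable.norm.mul_bdd (c := Real.exp (2 * ‖lam‖ * ∫ y, ‖u y‖))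
      hE.aestronglyMeasurable (Eventually.of_forall fun y => ?_)
    rw [Real.norm_eq_abs, abs_of_pos (Real.exp_pos _)]
    have := hu.mass_le y
    gcongr
  have h1 : ‖∫ y in Set.Iic x, Complex.exp (κ * (x - y)) * (c y * f y)‖
      ≤ ∫ y in Set.Iic x, K * (‖u y‖ * Real.exp (2 * ‖lam‖ * mass u y)) := by
    refine norm_integral_le_of_norm_le (hi.const_mul K).integrableOn ?_
    filter_upwards [ae_restrict_mem measurableSet_Iic] with y hy
    refine (norm_kernel_le hκ hcu (hfK y) hy).trans (le_of_eq (by ring))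
  rw [integral_const_mul] at h1
  have h2 := hu.integral_mul_exp_mass_le (norm_nonneg lam) x
  rw [volt, norm_mul]
  calc _ ≤ ‖lam‖ * (K * ∫ y in Set.Iic x, ‖u y‖ * Real.exp (2 * ‖lam‖ * mass u y)) := by gcongr
    _ = K * (‖lam‖ * ∫ y in Set.Iic x, ‖u y‖ * Real.exp (2 * ‖lam‖ * mass u y)) := by ring
    _ ≤ K * (Real.exp (2 * ‖lam‖ * mass u x) / 2) := by gcongr
    _ = _ := by ring

theorem hasDerivAt_volt {κ : ℂ} (hκ : κ.re ≤ 0) {u c f : ℝ → ℂ} (hu : IsPotential u)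
    (hc : Continuous c) (hcu : ∀ y, ‖c y‖ = ‖u y‖) (hf : Continuous f) {B : ℝ}
    (hB : ∀ y, ‖f y‖ ≤ B) (lam : ℂ) (x : ℝ) :
    HasDerivAt (volt lam κ c f) (κ * volt lam κ c f x + lam * c x * f x) x := by
  -- The kernel factors as e^{κx} e^{-κy}; after this splitting the product rule and the fundamental
  -- theorem apply.
  set h : ℝ → ℂ := fun y => Complex.exp (-κ * y) * (c y * f y) with hh
  have hcont : Continuous h := by fun_prop
  have e : ∀ x y : ℝ, Complex.exp (κ * (x - y)) * (c y * f y) = Complex.exp (κ * x) * h y := by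
    intro x y
    have e1 : Complex.exp (κ * (x - y)) = Complex.exp (κ * x) * Complex.exp (-κ * y) := by
      rw [← Complex.exp_add]; congr 1; ring
    rw [e1, mul_assoc]
  have hi : ∀ x, IntegrableOn h (Set.Iic x) := by
    intro x
    have := (integrableOn_kernel hκ hu hc hcu hf hB x).const_mul (Complex.exp (-κ * x))
    refine this.congr (Eventually.of_forall fun y => ?_)
    simp only
    rw [e x y, ← mul_assoc, ← Complex.exp_add]
    simp
  have ev : volt lam κ c f = fun x : ℝ => lam * (Complex.exp (κ * x) * ∫ y in Set.Iic x, h y) := by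
    ext x
    rw [volt]
    simp_rw [e x]
    rw [integral_const_mul]
  have hexp : HasDerivAt (fun x : ℝ => Complex.exp (κ * x)) (κ * Complex.exp (κ * x)) x := by
    have := ((Complex.ofRealCLM.hasDerivAt (x := x)).const_mul κ).cexp
    refine this.congr_deriv ?_
    simp; ring
  have := (hexp.mul (hasDerivAt_integral_Iic hcont hi x)).const_mul lam
  rw [ev]
  refine this.congr_deriv ?_
  have h1 : Complex.exp (κ * x) * h x = c x * f x := by
    rw [hh, ← mul_assoc, ← Complex.exp_add]; simp
  linear_combination lam * h1

theorem continuous_volt {κ : ℂ} (hκ : κ.re ≤ 0) {u c f : ℝ → ℂ} (hu : IsPotential u)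
    (hc : Continuous c) (hcu : ∀ y, ‖c y‖ = ‖u y‖) (hf : Continuous f) {B : ℝ}
    (hB : ∀ y, ‖f y‖ ≤ B) (lam : ℂ) : Continuous (volt lam κ c f) :=
  continuous_iff_continuousAt.2 fun x => (hasDerivAt_volt hκ hu hc hcu hf hB lam x).continuousAt

/-- The summands of the Neumann series of the Jost function: the even ones contribute to the first
component, the odd ones to the second. -/
def jostIter (u : ℝ → ℂ) (lam : ℂ) : ℕ → ℝ → ℂ
  | 0 => fun _ => 1
  | n + 1 => if Even n then volt lam (2 * Complex.I * lam ^ 2) (fun y => -conj (u y))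
      (jostIter u lam n) else volt lam 0 u (jostIter u lam n)

theorem re_two_I_mul_sq (lam : ℂ) : (2 * Complex.I * lam ^ 2).re = -(2 * (lam ^ 2).im) := by
  simp [Complex.mul_re, Complex.mul_im]

theorem re_two_I_mul_sq_nonpos {lam : ℂ} (h : lam ∈ CI) : (2 * Complex.I * lam ^ 2).re ≤ 0 := by
  rw [re_two_I_mul_sq]
  linarith [CI_im_sq h]

theorem exp_mass_le {u : ℝ → ℂ} (hu : IsPotential u) (lam : ℂ) (x : ℝ) :
    Real.exp (2 * ‖lam‖ * mass u x) ≤ Real.exp (2 * ‖lam‖ * ∫ y, ‖u y‖) := by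
  have := hu.mass_le x
  gcongr

theorem jostIter_bound {u : ℝ → ℂ} (hu : IsPotential u) {lam : ℂ} (hlam : lam ∈ CI) (n : ℕ) :
    Continuous (jostIter u lam n) ∧
      ∀ x, ‖jostIter u lam n x‖ ≤ (1 / 2) ^ n * Real.exp (2 * ‖lam‖ * mass u x) := by
  induction n with
  | zero =>
    refine ⟨continuous_const, fun x => ?_⟩
    simp only [jostIter, norm_one, pow_zero, one_mul]
    refine Real.one_le_exp ?_
    have : 0 ≤ mass u x := setIntegral_nonneg measurableSet_Iic fun _ _ => norm_nonneg _
    positivity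
  | succ n ih =>
    obtain ⟨hc, hb⟩ := ih
    have hb' : ∀ x, ‖jostIter u lam n x‖
        ≤ (1 / 2) ^ n * Real.exp (2 * ‖lam‖ * ∫ y, ‖u y‖) := fun x =>
      (hb x).trans (by have := exp_mass_le hu lam x; gcongr)
    have hcc : Continuous fun y => -conj (u y) := (Complex.continuous_conj.comp hu.cont).neg
    have e : ∀ x : ℝ, (1 / 2 : ℝ) ^ (n + 1) * x = (1 / 2) ^ n / 2 * x := fun x => by ring
    simp only [jostIter, e]
    split_ifs
    · exact ⟨continuous_volt (re_two_I_mul_sq_nonpos hlam) hu hcc (by simp) hc hb' lam,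
        norm_volt_le (re_two_I_mul_sq_nonpos hlam) hu (by simp) (by positivity) hb⟩
    · exact ⟨continuous_volt (by simp) hu hu.cont (fun _ => rfl) hc hb' lam,
        norm_volt_le (by simp) hu (fun _ => rfl) (by positivity) hb⟩

theorem norm_jostIter_le {u : ℝ → ℂ} (hu : IsPotential u) {lam : ℂ} (hlam : lam ∈ CI) (n : ℕ)
    (x : ℝ) : ‖jostIter u lam n x‖ ≤ (1 / 2) ^ n * Real.exp (2 * ‖lam‖ * ∫ y, ‖u y‖) :=
  ((jostIter_bound hu hlam n).2 x).trans (by have := exp_mass_le hu lam x; gcongr)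

theorem differentiableOn_volt {u c : ℝ → ℂ} (hu : IsPotential u) (hc : Continuous c)
    (hcu : ∀ y, ‖c y‖ = ‖u y‖) {κ : ℂ → ℂ} (hκ : ∀ lam ∈ CI, (κ lam).re ≤ 0)
    (hκd : Differentiable ℂ κ) {f : ℂ → ℝ → ℂ} (hf : ∀ lam ∈ CI, Continuous (f lam))
    (hfd : ∀ y, DifferentiableOn ℂ (fun lam => f lam y) CI)
    (hb : ∀ lam ∈ CI, ∀ y, ‖f lam y‖ ≤ Real.exp (2 * ‖lam‖ * ∫ y, ‖u y‖)) (x : ℝ) :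
    DifferentiableOn ℂ (fun lam => volt lam (κ lam) c (f lam) x) CI := by
  unfold volt
  refine differentiableOn_id.mul (differentiableOn_integral_of_bound isOpen_CI ?_ ?_ ?_)
  · intro lam hlam
    exact (continuous_kernel hc (hf lam hlam) x).aestronglyMeasurable
  · refine Eventually.of_forall fun y => ?_
    exact ((hκd.mul_const _).cexp.differentiableOn).mul ((hfd y).const_mul (c y))
  · intro lam _
    have hint : 0 ≤ ∫ y, ‖u y‖ := integral_nonneg fun _ => norm_nonneg _
    refine ⟨1, one_pos, fun y => ‖u y‖ * Real.exp (2 * (‖lam‖ + 1) * ∫ y, ‖u y‖),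
      (hu.integrable.norm.mul_const _).integrableOn, ?_⟩
    filter_upwards [ae_restrict_mem measurableSet_Iic] with y hy w hw
    refine norm_kernel_le (hκ w hw.1) hcu ((hb w hw.1 y).trans ?_) hy
    have : ‖w‖ ≤ ‖lam‖ + 1 := by
      have h1 := hw.2
      rw [Metric.mem_ball, dist_eq_norm] at h1
      have := norm_le_norm_add_norm_sub' w lam
      linarith
    gcongr

theorem differentiableOn_jostIter {u : ℝ → ℂ} (hu : IsPotential u) (n : ℕ) (x : ℝ) :
    DifferentiableOn ℂ (fun lam => jostIter u lam n x) CI := by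
  induction n generalizing x with
  | zero => exact differentiableOn_const _
  | succ n ih =>
    have hcc : Continuous fun y => -conj (u y) := (Complex.continuous_conj.comp hu.cont).neg
    have hb : ∀ lam ∈ CI, ∀ y, ‖jostIter u lam n y‖ ≤ Real.exp (2 * ‖lam‖ * ∫ y, ‖u y‖) := by
      intro lam hlam y
      refine (norm_jostIter_le hu hlam n y).trans (mul_le_of_le_one_left (Real.exp_pos _).le ?_)
      exact pow_le_one₀ (by norm_num) (by norm_num)
    by_cases hn : Even n
    · simp only [jostIter, hn, if_true]
      exact differentiableOn_volt hu hcc (by simp) (fun lam => re_two_I_mul_sq_nonpos)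
        (by fun_prop) (fun lam hlam => (jostIter_bound hu hlam n).1) ih hb x
    · simp only [jostIter, hn, if_false]
      exact differentiableOn_volt hu hu.cont (fun _ => rfl) (κ := fun _ => 0)
        (fun lam _ => by simp) (by fun_prop)
        (fun lam hlam => (jostIter_bound hu hlam n).1) ih hb x

theorem summable_half_pow_mul (e : ℕ → ℕ) (he : ∀ k, k ≤ e k) (K : ℝ) (hK : 0 ≤ K) :
    (Summable fun k => (1 / 2 : ℝ) ^ e k * K) ∧ ∑' k, (1 / 2 : ℝ) ^ e k * K ≤ 2 * K := by
  have h1 : ∀ k, (1 / 2 : ℝ) ^ e k * K ≤ (1 / 2 : ℝ) ^ k * K := fun k => by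
    have : (1 / 2 : ℝ) ^ e k ≤ (1 / 2) ^ k :=
      pow_le_pow_of_le_one (by norm_num) (by norm_num) (he k)
    gcongr
  have h2 : HasSum (fun k => (1 / 2 : ℝ) ^ k * K) (2 * K) := hasSum_geometric_two.mul_right K
  have h3 : Summable fun k => (1 / 2 : ℝ) ^ e k * K :=
    Summable.of_nonneg_of_le (fun k => by positivity) h1 h2.summable
  exact ⟨h3, (h3.tsum_le_tsum h1 h2.summable).trans h2.tsum_eq.le⟩

theorem volt_tsum {κ : ℂ} (hκ : κ.re ≤ 0) {u c : ℝ → ℂ} (hu : IsPotential u)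
    (hc : Continuous c) (hcu : ∀ y, ‖c y‖ = ‖u y‖) {f : ℕ → ℝ → ℂ} (hf : ∀ k, Continuous (f k))
    {b : ℕ → ℝ} (hb : ∀ k y, ‖f k y‖ ≤ b k) (hs : Summable b) (lam : ℂ) (x : ℝ) :
    volt lam κ c (fun y => ∑' k, f k y) x = ∑' k, volt lam κ c (f k) x := by
  unfold volt
  rw [tsum_mul_left]
  congr 1
  have hi := fun k => integrableOn_kernel hκ hu hc hcu (hf k) (hb k) x
  have hsum : Summable fun k => ∫ y in Set.Iic x,
      ‖Complex.exp (κ * (x - y)) * (c y * f k y)‖ := by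
    refine Summable.of_nonneg_of_le (fun k => integral_nonneg fun _ => norm_nonneg _)
      (fun k => ?_) (hs.mul_left (∫ y in Set.Iic x, ‖u y‖))
    rw [← integral_mul_const]
    refine integral_mono_ae (hi k).norm (hu.integrable.norm.mul_const _).integrableOn ?_
    filter_upwards [ae_restrict_mem measurableSet_Iic] with y hy
    exact norm_kernel_le hκ hcu (hb k y) hy
  rw [(hasSum_integral_of_summable_integral_norm hi hsum).tsum_eq]
  simp_rw [tsum_mul_left]

/-- The components of the Jost function at `-∞`, as functions of the spectral parameter. -/
theorem exists_volterra_solution {u : ℝ → ℂ} (hu : IsPotential u) : ∃ p q : ℂ → ℝ → ℂ,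
    (∀ lam ∈ CI, Continuous (p lam) ∧ Continuous (q lam) ∧
      (∀ x, ‖p lam x‖ ≤ 2 * Real.exp (2 * ‖lam‖ * ∫ y, ‖u y‖)) ∧
      (∀ x, ‖q lam x‖ ≤ 2 * Real.exp (2 * ‖lam‖ * ∫ y, ‖u y‖)) ∧
      (∀ x, p lam x = 1 + volt lam 0 u (q lam) x) ∧
      ∀ x, q lam x = volt lam (2 * Complex.I * lam ^ 2) (fun y => -conj (u y)) (p lam) x) ∧
    ∀ x, DifferentiableOn ℂ (fun lam => p lam x) CI ∧ DifferentiableOn ℂ (fun lam => q lam x) CI := by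
  have hcc : Continuous fun y => -conj (u y) := (Complex.continuous_conj.comp hu.cont).neg
  have hint : 0 ≤ ∫ y, ‖u y‖ := integral_nonneg fun _ => norm_nonneg _
  have he : ∀ k, k ≤ 2 * k := fun k => by omega
  have ho : ∀ k, k ≤ 2 * k + 1 := fun k => by omega
  have gen : ∀ e : ℕ → ℕ, (∀ k, k ≤ e k) →
      (∀ lam ∈ CI, Continuous (fun x => ∑' k, jostIter u lam (e k) x) ∧
        ∀ x, ‖∑' k, jostIter u lam (e k) x‖ ≤ 2 * Real.exp (2 * ‖lam‖ * ∫ y, ‖u y‖)) ∧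
      ∀ x, DifferentiableOn ℂ (fun lam => ∑' k, jostIter u lam (e k) x) CI := by
    intro e he
    refine ⟨fun lam hlam => ?_, fun x => ?_⟩
    · obtain ⟨s1, s2⟩ := summable_half_pow_mul e he _ (Real.exp_pos (2 * ‖lam‖ * ∫ y, ‖u y‖)).le
      refine ⟨continuous_tsum (fun k => (jostIter_bound hu hlam _).1) s1
        fun k x => norm_jostIter_le hu hlam _ x, fun x => ?_⟩
      exact (tsum_of_norm_bounded s1.hasSum fun k => norm_jostIter_le hu hlam _ x).trans s2
    · intro lam hlam
      -- The majorant depends on |λ|, so the convergence is uniform only locally: on a unit ball |w|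
      -- ≤ |λ| + 1 gives a single geometric majorant.
      set V := CI ∩ Metric.ball lam 1 with hV
      have hVo : IsOpen V := isOpen_CI.inter Metric.isOpen_ball
      have hVl : lam ∈ V := ⟨hlam, Metric.mem_ball_self one_pos⟩
      have s1 := (summable_half_pow_mul e he _
        (Real.exp_pos (2 * (‖lam‖ + 1) * ∫ y, ‖u y‖)).le).1
      refine ((Complex.differentiableOn_tsum_of_summable_norm s1
        (fun k => (differentiableOn_jostIter hu (e k) x).mono Set.inter_subset_left) hVo
        fun k w hw => ?_).differentiableAt (hVo.mem_nhds hVl)).differentiableWithinAt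
      refine (norm_jostIter_le hu hw.1 _ x).trans ?_
      have : ‖w‖ ≤ ‖lam‖ + 1 := by
        have h1 := hw.2
        rw [Metric.mem_ball, dist_eq_norm] at h1
        have := norm_le_norm_add_norm_sub' w lam
        linarith
      gcongr
  refine ⟨fun lam x => ∑' k, jostIter u lam (2 * k) x, fun lam x => ∑' k, jostIter u lam (2 * k + 1) x,
    fun lam hlam => ⟨((gen _ he).1 lam hlam).1, ((gen _ ho).1 lam hlam).1,
      ((gen _ he).1 lam hlam).2, ((gen _ ho).1 lam hlam).2, fun x => ?_, fun x => ?_⟩,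
    fun x => ⟨(gen _ he).2 x, (gen _ ho).2 x⟩⟩
  · have s0 := (summable_half_pow_mul _ he _ (Real.exp_pos (2 * ‖lam‖ * ∫ y, ‖u y‖)).le).1
    have s1 := (summable_half_pow_mul _ ho _ (Real.exp_pos (2 * ‖lam‖ * ∫ y, ‖u y‖)).le).1
    have s2 : Summable fun k => jostIter u lam (2 * k) x :=
      Summable.of_norm_bounded s0 fun k => norm_jostIter_le hu hlam _ x
    simp only
    rw [volt_tsum (by simp) hu hu.cont (fun _ => rfl) (fun k => (jostIter_bound hu hlam _).1)
      (fun k y => norm_jostIter_le hu hlam _ y) s1, s2.tsum_eq_zero_add]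
    congr 1
    -- Term 2k + 2 of the first component is the image of the odd term 2k + 1; the leading 1 is term
    -- 0.
    refine tsum_congr fun k => ?_
    have : 2 * (k + 1) = (2 * k + 1) + 1 := by ring
    rw [this]
    have h2 : ¬ Even (2 * k + 1) := by simp
    conv_lhs => rw [jostIter]
    rw [if_neg h2]
  · have s0 := (summable_half_pow_mul _ he _ (Real.exp_pos (2 * ‖lam‖ * ∫ y, ‖u y‖)).le).1
    simp only
    rw [volt_tsum (re_two_I_mul_sq_nonpos hlam) hu hcc (by simp)
      (fun k => (jostIter_bound hu hlam _).1) (fun k y => norm_jostIter_le hu hlam _ y) s0]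
    refine tsum_congr fun k => ?_
    have h2 : Even (2 * k) := by simp
    conv_lhs => rw [jostIter]
    rw [if_pos h2]

/-! ## Existence and bounds of the Jost functions -/

/-- The exponentially weighted mass of `u` to the left of `x`. -/
def expMass (β : ℝ) (u : ℝ → ℂ) (x : ℝ) : ℝ :=
  ∫ y in Set.Iic x, Real.exp (-(2 * β * (x - y))) * ‖u y‖

/-- Differentiating the integral equations gives p' = λuq and q' = 2iλ²q - λūp, the system for
e^{-iλ²x}(p, q). The limits at -∞ hold because the mass to the left of x tends to 0. -/
theorem isJostMinus_of_volterra {u : ℝ → ℂ} (hu : IsPotential u) {lam : ℂ} (hlam : lam ∈ CI)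
    {p q : ℝ → ℂ} (hp : Continuous p) (hq : Continuous q) {B : ℝ} (hpB : ∀ x, ‖p x‖ ≤ B)
    (hqB : ∀ x, ‖q x‖ ≤ B) (ep : ∀ x, p x = 1 + volt lam 0 u q x)
    (eq : ∀ x, q x = volt lam (2 * Complex.I * lam ^ 2) (fun y => -conj (u y)) p x) :
    IsJostMinus u lam (fun x => ![p x, q x]) := by
  have hcc : Continuous fun y => -conj (u y) := (Complex.continuous_conj.comp hu.cont).neg
  have hB : 0 ≤ B := (norm_nonneg _).trans (hpB 0)
  have dp : ∀ x, HasDerivAt p (lam * u x * q x) x := by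
    intro x
    rw [show p = fun x => 1 + volt lam 0 u q x from funext ep]
    exact ((hasDerivAt_volt (by simp) hu hu.cont (fun _ => rfl) hq hqB lam x).const_add
      1).congr_deriv (by ring)
  have dq : ∀ x, HasDerivAt q (2 * Complex.I * lam ^ 2 * q x - lam * conj (u x) * p x) x := by
    intro x
    have := hasDerivAt_volt (re_two_I_mul_sq_nonpos hlam) hu hcc (by simp) hp hpB lam x
    rw [← eq x] at this
    exact (this.congr_of_eventuallyEq (Eventually.of_forall eq)).congr_deriv (by ring)
  have hexp : ∀ x : ℝ, HasDerivAt (fun x : ℝ => Complex.exp (-Complex.I * lam ^ 2 * x))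
      (-Complex.I * lam ^ 2 * Complex.exp (-Complex.I * lam ^ 2 * x)) x := by
    intro x
    have := ((Complex.ofRealCLM.hasDerivAt (x := x)).const_mul (-Complex.I * lam ^ 2)).cexp
    refine this.congr_deriv ?_
    simp; ring
  have small : ∀ {κ : ℂ} (_ : κ.re ≤ 0) {c f : ℝ → ℂ} (_ : ∀ y, ‖c y‖ = ‖u y‖)
      (_ : ∀ y, ‖f y‖ ≤ B), Tendsto (volt lam κ c f) atBot (𝓝 0) := by
    intro κ hκ c f hcu hf
    have h0 : Tendsto (fun x => ‖lam‖ * (mass u x * B)) atBot (𝓝 (‖lam‖ * (0 * B))) :=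
      (hu.tendsto_mass.mul_const B).const_mul _
    rw [zero_mul, mul_zero] at h0
    refine squeeze_zero_norm (fun x => ?_) h0
    rw [volt, norm_mul]
    refine mul_le_mul_of_nonneg_left ?_ (norm_nonneg _)
    rw [mass, ← integral_mul_const]
    refine norm_integral_le_of_norm_le (hu.integrable.norm.mul_const _).integrableOn ?_
    filter_upwards [ae_restrict_mem measurableSet_Iic] with y hy
    exact norm_kernel_le hκ hcu (hf y) hy
  refine ⟨(isKNSolution_iff hu.cont).2 (isSol_iff.2 ⟨fun x => ?_, fun x => ?_⟩), ⟨B, fun x => ?_⟩, ?_⟩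
  · refine ((hexp x).mul (dp x)).congr_deriv ?_
    simp; ring
  · refine ((hexp x).mul (dq x)).congr_deriv ?_
    simp; ring
  · refine (pi_norm_le_iff_of_nonneg hB).2 fun i => ?_
    fin_cases i
    · exact hpB x
    · exact hqB x
  · refine tendsto_pi_nhds.2 fun i => ?_
    fin_cases i
    · have := (small (κ := 0) (by simp) (fun _ => rfl) hqB).const_add 1
      simpa [← ep] using this
    · have := small (re_two_I_mul_sq_nonpos hlam) (c := fun y => -conj (u y)) (by simp) hpB
      simpa using this.congr fun x => (eq x).symm

theorem norm_volt_le_mul {κ : ℂ} (hκ : κ.re ≤ 0) {u c f : ℝ → ℂ} (hu : IsPotential u)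
    (hcu : ∀ y, ‖c y‖ = ‖u y‖) {B : ℝ} (hf : ∀ y, ‖f y‖ ≤ B) (lam : ℂ) (x : ℝ) :
    ‖volt lam κ c f x‖ ≤ ‖lam‖ * B * ∫ y, ‖u y‖ := by
  have hB : 0 ≤ B := (norm_nonneg _).trans (hf 0)
  rw [volt, norm_mul, mul_assoc]
  refine mul_le_mul_of_nonneg_left ?_ (norm_nonneg _)
  have : ‖∫ y in Set.Iic x, Complex.exp (κ * (x - y)) * (c y * f y)‖ ≤ mass u x * B := by
    rw [mass, ← integral_mul_const]
    refine norm_integral_le_of_norm_le (hu.integrable.norm.mul_const _).integrableOn ?_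
    filter_upwards [ae_restrict_mem measurableSet_Iic] with y hy
    exact norm_kernel_le hκ hcu (hf y) hy
  have h2 := hu.mass_le x
  calc _ ≤ _ := this
    _ ≤ (∫ y, ‖u y‖) * B := by gcongr
    _ = _ := mul_comm _ _

/-- Here the decay e^{-2β(x-y)} of the kernel is kept instead of being bounded by 1. It puts the
second component of `jostMinus` in weighted L², which the plain bound by the mass cannot do. -/
theorem norm_volt_le_expMass {β : ℝ} (hβ : 0 ≤ β) {κ : ℂ} (hκ : κ.re = -(2 * β)) {u c f : ℝ → ℂ}
    (hu : IsPotential u) (hcu : ∀ y, ‖c y‖ = ‖u y‖) {B : ℝ} (hf : ∀ y, ‖f y‖ ≤ B) (lam : ℂ)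
    (x : ℝ) : ‖volt lam κ c f x‖ ≤ ‖lam‖ * B * expMass β u x := by
  rw [volt, norm_mul, mul_assoc]
  refine mul_le_mul_of_nonneg_left ?_ (norm_nonneg _)
  rw [expMass, ← integral_const_mul]
  refine norm_integral_le_of_norm_le (Integrable.const_mul ?_ B) ?_
  · refine Integrable.mono' hu.integrable.norm.integrableOn ?_ ?_
    · have := hu.cont
      exact Continuous.aestronglyMeasurable (by fun_prop)
    · filter_upwards [ae_restrict_mem measurableSet_Iic] with y hy
      rw [norm_mul, norm_norm, Real.norm_eq_abs, abs_of_pos (Real.exp_pos _)]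
      refine mul_le_of_le_one_left (norm_nonneg _) (Real.exp_le_one_iff.2 ?_)
      have : 0 ≤ x - y := sub_nonneg.2 hy
      have : 0 ≤ 2 * β * (x - y) := by positivity
      linarith
  · refine Eventually.of_forall fun y => ?_
    have e : ‖Complex.exp (κ * (x - y))‖ = Real.exp (-(2 * β * (x - y))) := by
      rw [Complex.norm_exp, ← Complex.ofReal_sub, Complex.re_mul_ofReal, hκ]
      congr 1; ring
    rw [norm_mul, norm_mul, e, hcu]
    have := hf y
    calc _ ≤ Real.exp (-(2 * β * (x - y))) * (‖u y‖ * B) := by gcongr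
      _ = _ := by ring

/-- The constant bounding the Jost functions of potentials of mass `N`. -/
def jostBound (lam : ℂ) (N : ℝ) : ℝ := 2 * Real.exp (2 * ‖lam‖ * N)

theorem jostBound_pos (lam : ℂ) (N : ℝ) : 0 < jostBound lam N := by
  unfold jostBound; positivity

theorem jostBound_mono (lam : ℂ) {N N' : ℝ} (h : N ≤ N') : jostBound lam N ≤ jostBound lam N' := by
  unfold jostBound; gcongr

/-- The estimates have separate uses: the size bounds `a` from above, the distance to the limit
vector gives `half_le_norm_a`, and the bound by `expMass` gives the decay of `S`. -/
theorem jostMinus_spec {u : ℝ → ℂ} (hu : IsPotential u) :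
    (∀ lam ∈ CI, IsJostMinus u lam (jostMinus u lam) ∧
      (∀ x i, ‖jostMinus u lam x i‖ ≤ jostBound lam (∫ y, ‖u y‖)) ∧
      (∀ x, ‖jostMinus u lam x 0 - 1‖ ≤
        ‖lam‖ * jostBound lam (∫ y, ‖u y‖) * ∫ y, ‖u y‖) ∧
      (∀ x, ‖jostMinus u lam x 1‖ ≤ ‖lam‖ * jostBound lam (∫ y, ‖u y‖) * ∫ y, ‖u y‖) ∧
      (∀ x, ‖jostMinus u lam x 1‖ ≤
        ‖lam‖ * jostBound lam (∫ y, ‖u y‖) * expMass (lam ^ 2).im u x)) ∧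
    ∀ x i, DifferentiableOn ℂ (fun lam => jostMinus u lam x i) CI := by
  obtain ⟨p, q, h, hd⟩ := exists_volterra_solution hu
  have e : ∀ lam ∈ CI, jostMinus u lam = fun x => ![p lam x, q lam x] := by
    intro lam hlam
    obtain ⟨h1, h2, h3, h4, h5, h6⟩ := h lam hlam
    exact (isJostMinus_of_volterra hu hlam h1 h2 h3 h4 h5 h6).eq_jostMinus hu hlam
  refine ⟨fun lam hlam => ?_, fun x i => ?_⟩
  · obtain ⟨h1, h2, h3, h4, h5, h6⟩ := h lam hlam
    rw [e lam hlam]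
    refine ⟨isJostMinus_of_volterra hu hlam h1 h2 h3 h4 h5 h6, fun x i => ?_, fun x => ?_,
      fun x => ?_, fun x => ?_⟩
    · fin_cases i
      · exact h3 x
      · exact h4 x
    · simp only [Matrix.cons_val_zero]
      rw [h5, add_sub_cancel_left]
      exact norm_volt_le_mul (by simp) hu (fun _ => rfl) h4 lam x
    · simp only [Matrix.cons_val_one]
      rw [h6]
      exact norm_volt_le_mul (re_two_I_mul_sq_nonpos hlam) hu (by simp) h3 lam x
    · simp only [Matrix.cons_val_one]
      rw [h6]
      exact norm_volt_le_expMass (CI_im_sq hlam).le (re_two_I_mul_sq lam) hu (by simp) h3 lam x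
  · fin_cases i
    · exact (hd x).1.congr fun lam hlam => by rw [e lam hlam]; rfl
    · exact (hd x).2.congr fun lam hlam => by rw [e lam hlam]; rfl

theorem jostPlus_eq {u : ℝ → ℂ} (hu : IsPotential u) {lam : ℂ} (hlam : lam ∈ CI) :
    jostPlus u lam = swapVec (jostMinus (reflect u) lam) :=
  jostPlus_eq_swapVec hu hlam ((jostMinus_spec hu.reflect).1 lam hlam).1

theorem jostPlus_spec {u : ℝ → ℂ} (hu : IsPotential u) :
    (∀ lam ∈ CI, IsJostPlus u lam (jostPlus u lam) ∧
      (∀ x i, ‖jostPlus u lam x i‖ ≤ jostBound lam (∫ y, ‖u y‖)) ∧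
      (∀ x, ‖jostPlus u lam x 1 - 1‖ ≤ ‖lam‖ * jostBound lam (∫ y, ‖u y‖) * ∫ y, ‖u y‖) ∧
      (∀ x, ‖jostPlus u lam x 0‖ ≤ ‖lam‖ * jostBound lam (∫ y, ‖u y‖) * ∫ y, ‖u y‖) ∧
      (∀ x, ‖jostPlus u lam x 0‖ ≤
        ‖lam‖ * jostBound lam (∫ y, ‖u y‖) * expMass (lam ^ 2).im (reflect u) (-x))) ∧
    ∀ x i, DifferentiableOn ℂ (fun lam => jostPlus u lam x i) CI := by
  obtain ⟨h, hd⟩ := jostMinus_spec hu.reflect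
  refine ⟨fun lam hlam => ?_, fun x i => ?_⟩
  · obtain ⟨h1, h2, h3, h4, h5⟩ := h lam hlam
    rw [integral_norm_reflect] at h2 h3 h4 h5
    rw [jostPlus_eq hu hlam]
    refine ⟨?_, fun x i => ?_, fun x => h3 _, fun x => h4 _, fun x => h5 _⟩
    · have := h1.swapVec hu.reflect.cont
      rwa [reflect_reflect] at this
    · fin_cases i
      · exact h2 (-x) 1
      · exact h2 (-x) 0
  · fin_cases i
    · exact (hd (-x) 1).congr fun lam hlam => by rw [jostPlus_eq hu hlam]; rfl
    · exact (hd (-x) 0).congr fun lam hlam => by rw [jostPlus_eq hu hlam]; rfl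

/-! ### The scattering coefficient: holomorphy, upper bound, closeness to 1 for small spectral
parameter. -/

theorem isSol_psiMinus {u : ℝ → ℂ} (hu : IsPotential u) {lam : ℂ} (hlam : lam ∈ CI) :
    IsSol u lam (psiMinus u lam) :=
  (isKNSolution_iff hu.cont).1 ((jostMinus_spec hu).1 lam hlam).1.1

theorem isSol_psiPlus {u : ℝ → ℂ} (hu : IsPotential u) {lam : ℂ} (hlam : lam ∈ CI) :
    IsSol u lam (psiPlus u lam) :=
  (isKNSolution_iff hu.cont).1 ((jostPlus_spec hu).1 lam hlam).1.1

theorem wronskian_psi {u : ℝ → ℂ} (hu : IsPotential u) {lam : ℂ} (hlam : lam ∈ CI) (x : ℝ) :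
    wronskian (psiMinus u lam x) (psiPlus u lam x) = a u lam :=
  (isSol_psiMinus hu hlam).wronskian_eq (isSol_psiPlus hu hlam) x 0

theorem a_eq (u : ℝ → ℂ) (lam : ℂ) : a u lam = jostMinus u lam 0 0 * jostPlus u lam 0 1 -
    jostPlus u lam 0 0 * jostMinus u lam 0 1 := by
  simp [a, psiMinus, psiPlus, wronskian]

theorem differentiableOn_a {u : ℝ → ℂ} (hu : IsPotential u) : DifferentiableOn ℂ (a u) CI := by
  rw [show a u = _ from funext (a_eq u)]
  have h := (jostMinus_spec hu).2
  have h' := (jostPlus_spec hu).2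
  exact ((h 0 0).mul (h' 0 1)).sub ((h' 0 0).mul (h 0 1))

theorem norm_a_le {u : ℝ → ℂ} (hu : IsPotential u) {lam : ℂ} (hlam : lam ∈ CI) {L N : ℝ}
    (hL : ‖lam‖ ≤ L) (hN : ∫ y, ‖u y‖ ≤ N) : ‖a u lam‖ ≤ 8 * Real.exp (4 * L * N) := by
  obtain ⟨-, h, -⟩ := (jostMinus_spec hu).1 lam hlam
  obtain ⟨-, h', -⟩ := (jostPlus_spec hu).1 lam hlam
  have hint : 0 ≤ ∫ y, ‖u y‖ := integral_nonneg fun _ => norm_nonneg _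
  have hL0 : 0 ≤ L := (norm_nonneg _).trans hL
  have hB : jostBound lam (∫ y, ‖u y‖) ≤ 2 * Real.exp (2 * L * N) := by
    unfold jostBound; gcongr
  have h1 := fun x i => (h x i).trans hB
  have h2 := fun x i => (h' x i).trans hB
  have he : Real.exp (4 * L * N) = Real.exp (2 * L * N) * Real.exp (2 * L * N) := by
    rw [← Real.exp_add]; congr 1; ring
  rw [a_eq, he]
  refine (norm_sub_le _ _).trans ?_
  rw [norm_mul, norm_mul]
  calc _ ≤ 2 * Real.exp (2 * L * N) * (2 * Real.exp (2 * L * N)) +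
        2 * Real.exp (2 * L * N) * (2 * Real.exp (2 * L * N)) := by
        gcongr
        exacts [h1 0 0, h2 0 1, h2 0 0, h1 0 1]
    _ = _ := by ring

/-- When |λ| times the mass is small, the components of the Jost functions are within 1/10 of their
limits, so |a - 1| ≤ 0.22. This is the anchor of the Harnack argument. -/
theorem half_le_norm_a {u : ℝ → ℂ} (hu : IsPotential u) {lam : ℂ} (hlam : lam ∈ CI)
    (hsmall : ‖lam‖ * ∫ y, ‖u y‖ ≤ 1 / 40) : 1 / 2 ≤ ‖a u lam‖ := by
  obtain ⟨-, -, h1, h2, -⟩ := (jostMinus_spec hu).1 lam hlam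
  obtain ⟨-, -, h3, h4, -⟩ := (jostPlus_spec hu).1 lam hlam
  have hint : 0 ≤ ∫ y, ‖u y‖ := integral_nonneg fun _ => norm_nonneg _
  have hε : ‖lam‖ * jostBound lam (∫ y, ‖u y‖) * ∫ y, ‖u y‖ ≤ 1 / 10 := by
    have hexp : Real.exp (2 * ‖lam‖ * ∫ y, ‖u y‖) ≤ 2 := by
      have : Real.exp (2 * ‖lam‖ * ∫ y, ‖u y‖) ≤ Real.exp (1 / 2) := by
        apply Real.exp_le_exp.2
        rw [mul_assoc]; linarith
      refine this.trans ?_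
      have h := Real.exp_one_lt_d9
      have h2 : Real.exp (1 / 2) * Real.exp (1 / 2) = Real.exp 1 := by
        rw [← Real.exp_add]; norm_num
      nlinarith [Real.exp_pos (1 / 2)]
    have hn : 0 ≤ ‖lam‖ * ∫ y, ‖u y‖ := by positivity
    calc _ = ‖lam‖ * (∫ y, ‖u y‖) * (2 * Real.exp (2 * ‖lam‖ * ∫ y, ‖u y‖)) := by
          unfold jostBound; ring
      _ ≤ 1 / 40 * (2 * 2) := by gcongr
      _ = _ := by norm_num
  have g1 := (h1 0).trans hε
  have g2 := (h2 0).trans hε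
  have g3 := (h3 0).trans hε
  have g4 := (h4 0).trans hε
  have e : a u lam - 1 = (jostMinus u lam 0 0 - 1) * (jostPlus u lam 0 1 - 1) +
      ((jostMinus u lam 0 0 - 1) + (jostPlus u lam 0 1 - 1)) -
      jostPlus u lam 0 0 * jostMinus u lam 0 1 := by
    rw [a_eq]; ring
  have hb : ‖a u lam - 1‖ ≤ 1 / 10 * (1 / 10) + (1 / 10 + 1 / 10) + 1 / 10 * (1 / 10) := by
    rw [e]
    refine (norm_sub_le _ _).trans (add_le_add ((norm_add_le _ _).trans (add_le_add ?_
      ((norm_add_le _ _).trans (add_le_add g1 g3)))) ?_)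
    · rw [norm_mul]; gcongr
    · rw [norm_mul]; gcongr
  have : ‖(1 : ℂ)‖ ≤ ‖a u lam‖ + ‖a u lam - 1‖ := by
    have := norm_sub_le (a u lam) (a u lam - 1)
    simpa using this
  rw [norm_one] at this
  linarith

/-! ## The algebra of the Bäcklund transformation -/

theorem conj_d (lam : ℂ) (η : Fin 2 → ℂ) : conj (d lam η η) = d (conj lam) η η := by
  simp [d]; ring

/-- The positive real part of `lam` makes `d lam η η` comparable to |η|² from below, so `G` and `S`
have no singularities where `η` is nonzero. -/
theorem d_re (lam : ℂ) (η : Fin 2 → ℂ) : (d lam η η).re = lam.re * (‖η 0‖ ^ 2 + ‖η 1‖ ^ 2) := by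
  have h : ∀ z : ℂ, z * conj z = ((‖z‖ ^ 2 : ℝ) : ℂ) := fun z => by
    rw [Complex.mul_conj, Complex.normSq_eq_norm_sq]
  have e : d lam η η = lam * ((‖η 0‖ ^ 2 : ℝ) : ℂ) + conj lam * ((‖η 1‖ ^ 2 : ℝ) : ℂ) := by
    rw [d, mul_assoc, mul_assoc, h, h]
  rw [e, Complex.add_re, Complex.re_mul_ofReal, Complex.re_mul_ofReal, Complex.conj_re]
  ring

theorem le_norm_d {lam : ℂ} (η : Fin 2 → ℂ) :
    lam.re * (‖η 0‖ ^ 2 + ‖η 1‖ ^ 2) ≤ ‖d lam η η‖ := by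
  rw [← d_re]
  exact Complex.re_le_norm _

theorem norm_sq_le (η : Fin 2 → ℂ) : ‖η‖ ^ 2 ≤ ‖η 0‖ ^ 2 + ‖η 1‖ ^ 2 := by
  have : ‖η‖ ≤ Real.sqrt (‖η 0‖ ^ 2 + ‖η 1‖ ^ 2) := by
    refine (pi_norm_le_iff_of_nonneg (Real.sqrt_nonneg _)).2 fun i => Real.le_sqrt_of_sq_le ?_
    fin_cases i
    · exact le_add_of_nonneg_right (sq_nonneg _)
    · exact le_add_of_nonneg_left (sq_nonneg _)
  calc _ ≤ Real.sqrt (‖η 0‖ ^ 2 + ‖η 1‖ ^ 2) ^ 2 := by gcongr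
    _ = _ := Real.sq_sqrt (by positivity)

theorem d_ne_zero {lam : ℂ} (hlam : lam ∈ CI) {η : Fin 2 → ℂ} (hη : η ≠ 0) : d lam η η ≠ 0 := by
  have h1 := le_norm_d (lam := lam) η
  have h2 := norm_sq_le η
  have h3 : 0 < ‖η‖ := norm_pos_iff.2 hη
  have h4 : 0 < lam.re := hlam.1
  have : 0 < lam.re * (‖η 0‖ ^ 2 + ‖η 1‖ ^ 2) := mul_pos h4 (by nlinarith)
  exact norm_pos_iff.1 (this.trans_le h1)

theorem d_conj_ne_zero {lam : ℂ} (hlam : lam ∈ CI) {η : Fin 2 → ℂ} (hη : η ≠ 0) :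
    d (conj lam) η η ≠ 0 := by
  rw [← conj_d]
  exact (map_ne_zero _).2 (d_ne_zero hlam hη)

theorem conj_G (lam : ℂ) (η : Fin 2 → ℂ) : conj (G lam η) = d lam η η / d (conj lam) η η := by
  rw [G, map_div₀, conj_d, conj_d, Complex.conj_conj]

theorem conj_S (lam : ℂ) (η : Fin 2 → ℂ) : conj (S lam η) =
    2 * Complex.I * (lam ^ 2 - conj lam ^ 2) * (conj (η 0) * η 1 / d (conj lam) η η) := by
  simp only [S, map_mul, map_div₀, conj_d, Complex.conj_conj, map_sub, map_pow, Complex.conj_I,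
    map_ofNat]
  ring

theorem G_mul_conj {lam : ℂ} (hlam : lam ∈ CI) {η : Fin 2 → ℂ} (hη : η ≠ 0) :
    G lam η * conj (G lam η) = 1 := by
  have h1 := d_ne_zero hlam hη
  have h2 := d_conj_ne_zero hlam hη
  rw [conj_G, G]
  field_simp

theorem norm_G {lam : ℂ} (hlam : lam ∈ CI) {η : Fin 2 → ℂ} (hη : η ≠ 0) : ‖G lam η‖ = 1 := by
  have := congrArg norm (G_mul_conj hlam hη)
  rw [norm_mul, RCLike.norm_conj, norm_one] at this
  nlinarith [norm_nonneg (G lam η)]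

/-- The bound of `S`. -/
def boundS (lam : ℂ) : ℝ := 2 * ‖lam ^ 2 - conj lam ^ 2‖ / lam.re

theorem boundS_nonneg {lam : ℂ} (hlam : lam ∈ CI) : 0 ≤ boundS lam := by
  have : 0 < lam.re := hlam.1
  unfold boundS
  positivity

theorem norm_S_le {lam : ℂ} (hlam : lam ∈ CI) {η : Fin 2 → ℂ} (hη : η ≠ 0) :
    ‖S lam η‖ ≤ boundS lam * (‖η 0‖ * ‖η 1‖ / ‖η‖ ^ 2) := by
  have h0 : 0 < lam.re := hlam.1
  have h3 : 0 < ‖η‖ := norm_pos_iff.2 hη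
  have h4 : lam.re * ‖η‖ ^ 2 ≤ ‖d lam η η‖ :=
    (mul_le_mul_of_nonneg_left (norm_sq_le η) h0.le).trans (le_norm_d η)
  simp only [S, norm_mul, norm_div, RCLike.norm_conj, Complex.norm_I, Complex.norm_ofNat, mul_one]
  calc _ ≤ 2 * ‖lam ^ 2 - conj lam ^ 2‖ * (‖η 0‖ * ‖η 1‖ / (lam.re * ‖η‖ ^ 2)) := by gcongr
    _ = _ := by unfold boundS; field_simp

theorem norm_S_le_boundS {lam : ℂ} (hlam : lam ∈ CI) {η : Fin 2 → ℂ} (hη : η ≠ 0) :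
    ‖S lam η‖ ≤ boundS lam := by
  refine (norm_S_le hlam hη).trans (mul_le_of_le_one_right (boundS_nonneg hlam) ?_)
  refine div_le_one_of_le₀ ?_ (by positivity)
  rw [sq]
  exact mul_le_mul (norm_le_pi_norm _ _) (norm_le_pi_norm _ _) (norm_nonneg _) (norm_nonneg _)

/-- `S` is small as soon as either component is small relative to η. The decay estimate uses
component 0 on the left half line and component 1 on the right. -/
theorem norm_S_le_div {lam : ℂ} (hlam : lam ∈ CI) {η : Fin 2 → ℂ} (hη : η ≠ 0) (i : Fin 2) :
    ‖S lam η‖ ≤ boundS lam * (‖η i‖ / ‖η‖) := by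
  have h3 : 0 < ‖η‖ := norm_pos_iff.2 hη
  refine (norm_S_le hlam hη).trans (mul_le_mul_of_nonneg_left ?_ (boundS_nonneg hlam))
  rw [div_le_div_iff₀ (by positivity) h3]
  have a0 := norm_le_pi_norm η 0
  have a1 := norm_le_pi_norm η 1
  fin_cases i
  · have := mul_le_mul_of_nonneg_left a1 (by positivity : 0 ≤ ‖η 0‖ * ‖η‖)
    calc _ = ‖η 0‖ * ‖η‖ * ‖η 1‖ := by ring
      _ ≤ _ := this
      _ = _ := by simp; ring
  · have := mul_le_mul_of_nonneg_left a0 (by positivity : 0 ≤ ‖η 1‖ * ‖η‖)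
    calc _ = ‖η 1‖ * ‖η‖ * ‖η 0‖ := by ring
      _ ≤ _ := this
      _ = _ := by simp; ring

theorem G_smul {c : ℂ} (hc : c ≠ 0) (lam : ℂ) (η : Fin 2 → ℂ) : G lam (c • η) = G lam η := by
  have hc' : c * conj c ≠ 0 := mul_ne_zero hc ((map_ne_zero _).2 hc)
  have e : ∀ l, d l (c • η) (c • η) = (c * conj c) * d l η η := fun l => by
    simp [d]; ring
  rw [G, e, e, mul_div_mul_left _ _ hc', G]

theorem S_smul {c : ℂ} (hc : c ≠ 0) (lam : ℂ) (η : Fin 2 → ℂ) : S lam (c • η) = S lam η := by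
  have hc' : c * conj c ≠ 0 := mul_ne_zero hc ((map_ne_zero _).2 hc)
  have e : ∀ l, d l (c • η) (c • η) = (c * conj c) * d l η η := fun l => by
    simp [d]; ring
  have e2 : (c • η) 0 * conj ((c • η) 1) = (c * conj c) * (η 0 * conj (η 1)) := by
    simp; ring
  rw [S, e, e2, mul_div_mul_left _ _ hc', S]

theorem backlund_smul {c : ℂ} (hc : c ≠ 0) (lam : ℂ) (η : ℝ → Fin 2 → ℂ) (u : ℝ → ℂ) :
    backlund lam (fun x => c • η x) u = backlund lam η u := by
  ext x
  simp only [backlund, G_smul hc, S_smul hc]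

/-! ### Differential equations for `G` and `S`, and the Darboux matrix. -/

theorem hasDerivAt_conj {f : ℝ → ℂ} {f' : ℂ} {x : ℝ} (h : HasDerivAt f f' x) :
    HasDerivAt (fun x => conj (f x)) (conj f') x :=
  Complex.conjCLE.toContinuousLinearMap.hasFDerivAt.comp_hasDerivAt x h

theorem hasDerivAt_d {u : ℝ → ℂ} {lam : ℂ} {η : ℝ → Fin 2 → ℂ} (h : IsSol u lam η) (l : ℂ)
    (x : ℝ) : HasDerivAt (fun x => d l (η x) (η x))
      (l * ((-Complex.I * lam ^ 2 * η x 0 + lam * u x * η x 1) * conj (η x 0) +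
          η x 0 * (Complex.I * conj lam ^ 2 * conj (η x 0) + conj lam * conj (u x) * conj (η x 1))) +
        conj l * ((Complex.I * lam ^ 2 * η x 1 - lam * conj (u x) * η x 0) * conj (η x 1) +
          η x 1 * (-Complex.I * conj lam ^ 2 * conj (η x 1) - conj lam * u x * conj (η x 0)))) x := by
  obtain ⟨h0, h1⟩ := isSol_iff.1 h
  refine ((((h0 x).const_mul l).mul (hasDerivAt_conj (h0 x))).add
    (((h1 x).const_mul (conj l)).mul (hasDerivAt_conj (h1 x)))).congr_deriv ?_
  simp; ring

/-- The derivative is again a polynomial in `G`, `S`, `u` and conjugates, so the equations for `G`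
and `S` can be differentiated once more without returning to η. Each term has two factors among `u`,
`S` and their conjugates. -/
theorem hasDerivAt_G {u : ℝ → ℂ} {lam : ℂ} (hlam : lam ∈ CI) {η : ℝ → Fin 2 → ℂ}
    (h : IsSol u lam η) {x : ℝ} (hη : η x ≠ 0) : HasDerivAt (fun x => G lam (η x))
      (Complex.I / 2 * (G lam (η x) ^ 2 * u x * conj (S lam (η x)) -
        G lam (η x) * S lam (η x) * conj (S lam (η x)) + S lam (η x) * conj (u x))) x := by
  have n1 := d_ne_zero hlam hη
  have n2 := d_conj_ne_zero hlam hη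
  refine ((hasDerivAt_d h (conj lam) x).div (hasDerivAt_d h lam x) n1).congr_deriv ?_
  rw [conj_S, G, S]
  field_simp
  simp only [d, Complex.conj_conj]
  -- With η, `u`, `lam` and their conjugates taken as independent variables, what remains is a
  -- polynomial identity modulo I² = -1.
  have hI := Complex.I_sq
  generalize Complex.I = k at *
  generalize η x 0 = A, η x 1 = B, u x = U at *
  generalize conj A = A', conj B = B', conj U = U', conj lam = m at *
  grind

theorem hasDerivAt_S {u : ℝ → ℂ} {lam : ℂ} (hlam : lam ∈ CI) {η : ℝ → Fin 2 → ℂ}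
    (h : IsSol u lam η) {x : ℝ} (hη : η x ≠ 0) : HasDerivAt (fun x => S lam (η x))
      (-2 * Complex.I * (lam * conj lam) *
        ((1 - G lam (η x) ^ 2) * u x + G lam (η x) * S lam (η x))) x := by
  have n1 := d_ne_zero hlam hη
  obtain ⟨h0, h1⟩ := isSol_iff.1 h
  refine ((((h0 x).mul (hasDerivAt_conj (h1 x))).div (hasDerivAt_d h lam x) n1).const_mul
    (2 * Complex.I * (lam ^ 2 - conj lam ^ 2))).congr_deriv ?_
  rw [G, S]
  field_simp
  simp only [d, Pi.mul_apply, map_sub, map_mul, Complex.conj_I, Complex.conj_conj]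
  have hI := Complex.I_sq
  generalize Complex.I = k at *
  generalize η x 0 = A, η x 1 = B, u x = U at *
  generalize conj A = A', conj B = B', conj U = U', conj lam = m at *
  grind

/-- The Darboux transformation of solutions. -/
def darboux (b : ℂ) (η : Fin 2 → ℂ) (lam : ℂ) (z : Fin 2 → ℂ) : Fin 2 → ℂ :=
  ![(lam ^ 2 * G b η - b * conj b) * z 0 + Complex.I * lam / 2 * S b η * z 1,
    -(Complex.I * lam / 2 * conj (S b η) * z 0) + (b * conj b - lam ^ 2 * conj (G b η)) * z 1]

/-- Once the derivatives of `G` and `S` are inserted, this is a polynomial identity modulo |G|² = 1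
and I² = -1. -/
theorem IsSol.darboux {u : ℝ → ℂ} {b lam : ℂ} (hb : b ∈ CI) {η ψ : ℝ → Fin 2 → ℂ}
    (hη : IsSol u b η) (hη0 : ∀ x, η x ≠ 0) (hψ : IsSol u lam ψ) :
    IsSol (backlund b η u) lam (fun x => KaupNewell.darboux b (η x) lam (ψ x)) := by
  obtain ⟨p0, p1⟩ := isSol_iff.1 hψ
  have hGG := fun x => G_mul_conj hb (hη0 x)
  have dG := fun x => hasDerivAt_G hb hη (hη0 x)
  have dS := fun x => hasDerivAt_S hb hη (hη0 x)
  refine isSol_iff.2 ⟨fun x => ?_, fun x => ?_⟩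
  · have := ((((dG x).const_mul (lam ^ 2)).sub_const (b * conj b)).mul (p0 x)).add
      (((dS x).const_mul (Complex.I * lam / 2)).mul (p1 x))
    refine this.congr_deriv ?_
    have hI := Complex.I_sq
    have hg := hGG x
    simp only [KaupNewell.darboux, backlund, Matrix.cons_val_zero, Matrix.cons_val_one]
    generalize G b (η x) = g, S b (η x) = s, u x = U, ψ x 0 = P, ψ x 1 = R at *
    generalize conj g = g', conj s = s', conj U = U', conj b = m, Complex.I = k at *
    grind
  · have := (((hasDerivAt_conj (dS x)).const_mul (Complex.I * lam / 2)).mul (p0 x)).neg.add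
      ((((hasDerivAt_conj (dG x)).const_mul (lam ^ 2)).const_sub (b * conj b)).mul (p1 x))
    refine this.congr_deriv ?_
    have hI := Complex.I_sq
    have hg := hGG x
    simp only [KaupNewell.darboux, backlund, Matrix.cons_val_zero, Matrix.cons_val_one, map_mul,
      map_add, map_sub, map_neg, map_pow, Complex.conj_conj, Complex.conj_I, map_div₀, map_ofNat,
      map_one]
    generalize G b (η x) = g, S b (η x) = s, u x = U, ψ x 0 = P, ψ x 1 = R at *
    generalize conj g = g', conj s = s', conj U = U', conj b = m, Complex.I = k at *
    grind

/-- The left side is the coefficient of λ² in the determinant of the Darboux matrix; its value makes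
that determinant -(λ² - b²)(λ² - b̄²), independent of η. -/
theorem G_add_conj {b : ℂ} (hb : b ∈ CI) {η : Fin 2 → ℂ} (hη : η ≠ 0) :
    b * conj b * (G b η + conj (G b η)) - S b η * conj (S b η) / 4 = b ^ 2 + conj b ^ 2 := by
  have n1 := d_ne_zero hb hη
  have n2 := d_conj_ne_zero hb hη
  rw [conj_G, conj_S, G, S]
  field_simp
  simp only [d, Complex.conj_conj]
  have hI := Complex.I_sq
  generalize Complex.I = k at *
  generalize η 0 = A, η 1 = B at *
  generalize conj A = A', conj B = B', conj b = m at *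
  grind

theorem wronskian_darboux {b : ℂ} (hb : b ∈ CI) {η : Fin 2 → ℂ} (hη : η ≠ 0) (lam : ℂ)
    (z w : Fin 2 → ℂ) : wronskian (darboux b η lam z) (darboux b η lam w) =
      -((lam ^ 2 - b ^ 2) * (lam ^ 2 - conj b ^ 2)) * wronskian z w := by
  have h1 := G_add_conj hb hη
  have h2 := G_mul_conj hb hη
  have hI := Complex.I_sq
  simp only [wronskian, darboux, Matrix.cons_val_zero, Matrix.cons_val_one]
  generalize G b η = g, S b η = s at *
  generalize conj g = g', conj s = s', conj b = m, Complex.I = k at *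
  grind

/-! ## The Darboux transformation of the Jost functions -/

theorem darboux_smul (b : ℂ) (η : Fin 2 → ℂ) (lam c : ℂ) (z : Fin 2 → ℂ) :
    darboux b η lam (c • z) = c • darboux b η lam z := by
  ext i; fin_cases i <;> simp [darboux] <;> ring

theorem norm_darboux_le {b : ℂ} (hb : b ∈ CI) {η : Fin 2 → ℂ} (hη : η ≠ 0) (lam : ℂ)
    (z : Fin 2 → ℂ) : ‖darboux b η lam z‖ ≤
      (‖lam‖ ^ 2 + ‖b‖ * ‖b‖ + ‖lam‖ / 2 * boundS b) * ‖z‖ := by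
  have hG := norm_G hb hη
  have hS := norm_S_le_boundS hb hη
  have hB := boundS_nonneg hb
  have n1 : ‖lam ^ 2 * G b η - b * conj b‖ ≤ ‖lam‖ ^ 2 + ‖b‖ * ‖b‖ := by
    refine (norm_sub_le _ _).trans (le_of_eq ?_)
    rw [norm_mul, norm_mul, norm_pow, hG, RCLike.norm_conj, mul_one]
  have n2 : ‖b * conj b - lam ^ 2 * conj (G b η)‖ ≤ ‖lam‖ ^ 2 + ‖b‖ * ‖b‖ := by
    refine (norm_sub_le _ _).trans (le_of_eq ?_)
    rw [norm_mul, norm_mul, norm_pow, RCLike.norm_conj, RCLike.norm_conj, hG]; ring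
  have n3 : ‖Complex.I * lam / 2 * S b η‖ ≤ ‖lam‖ / 2 * boundS b := by
    simp only [norm_mul, norm_div, Complex.norm_I, one_mul, Complex.norm_ofNat]
    gcongr
  have n4 : ‖Complex.I * lam / 2 * conj (S b η)‖ ≤ ‖lam‖ / 2 * boundS b := by
    simp only [norm_mul, norm_div, Complex.norm_I, one_mul, Complex.norm_ofNat, RCLike.norm_conj]
    gcongr
  have z0 := norm_le_pi_norm z 0
  have z1 := norm_le_pi_norm z 1
  refine (pi_norm_le_iff_of_nonneg (by positivity)).2 fun i => ?_
  fin_cases i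
  · simp only [darboux, Fin.zero_eta, Matrix.cons_val_zero]
    refine (norm_add_le _ _).trans ?_
    rw [norm_mul, norm_mul _ (z 1), add_mul]
    gcongr
  · simp only [darboux, Fin.mk_one, Matrix.cons_val_one]
    refine (norm_add_le _ _).trans ?_
    rw [norm_neg, norm_mul, norm_mul _ (z 1), add_comm, add_mul]
    gcongr

theorem continuousAt_d (l : ℂ) (z : Fin 2 → ℂ) :
    ContinuousAt (fun η : Fin 2 → ℂ => d l η η) z := by
  have h0 : Continuous fun η : Fin 2 → ℂ => η 0 := continuous_apply 0
  have h1 : Continuous fun η : Fin 2 → ℂ => η 1 := continuous_apply 1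
  have h2 := Complex.continuous_conj.comp h0
  have h3 := Complex.continuous_conj.comp h1
  exact (((continuous_const.mul h0).mul h2).add ((continuous_const.mul h1).mul h3)).continuousAt

theorem continuousAt_G {b : ℂ} (hb : b ∈ CI) {z : Fin 2 → ℂ} (hz : z ≠ 0) :
    ContinuousAt (G b) z :=
  (continuousAt_d _ z).div (continuousAt_d _ z) (d_ne_zero hb hz)

theorem continuousAt_S {b : ℂ} (hb : b ∈ CI) {z : Fin 2 → ℂ} (hz : z ≠ 0) :
    ContinuousAt (S b) z := by
  have h0 : Continuous fun η : Fin 2 → ℂ => η 0 := continuous_apply 0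
  have h1 : Continuous fun η : Fin 2 → ℂ => η 1 := continuous_apply 1
  have h3 := Complex.continuous_conj.comp h1
  exact ((h0.mul h3).continuousAt.div (continuousAt_d _ z) (d_ne_zero hb hz)).const_mul _

theorem tendsto_darboux {b : ℂ} (hb : b ∈ CI) {z w : Fin 2 → ℂ} (hz : z ≠ 0) {l : Filter ℝ}
    {ζ φ : ℝ → Fin 2 → ℂ} (hζ : Tendsto ζ l (𝓝 z)) (hφ : Tendsto φ l (𝓝 w)) (lam : ℂ) :
    Tendsto (fun x => darboux b (ζ x) lam (φ x)) l (𝓝 (darboux b z lam w)) := by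
  have hG := (continuousAt_G hb hz).tendsto.comp hζ
  have hS := (continuousAt_S hb hz).tendsto.comp hζ
  have hG' := (Complex.continuous_conj.tendsto _).comp hG
  have hS' := (Complex.continuous_conj.tendsto _).comp hS
  have h0 := tendsto_pi_nhds.1 hφ 0
  have h1 := tendsto_pi_nhds.1 hφ 1
  refine tendsto_pi_nhds.2 fun i => ?_
  fin_cases i
  · exact (((hG.const_mul _).sub_const _).mul h0).add ((hS.const_mul _).mul h1)
  · exact (((hS'.const_mul _).mul h0).neg).add (((hG'.const_mul _).const_sub _).mul h1)

theorem IsSol.ne_zero {u : ℝ → ℂ} (hu : IsPotential u) {lam : ℂ} {ψ : ℝ → Fin 2 → ℂ}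
    (h : IsSol u lam ψ) {x₀ : ℝ} (h0 : ψ x₀ ≠ 0) (x : ℝ) : ψ x ≠ 0 := by
  intro hx
  have := h.unique hu (isSol_zero u lam) (x₀ := x) (by simpa using hx)
  exact h0 (by simp [this])

theorem psiMinus_ne_zero {u : ℝ → ℂ} (hu : IsPotential u) {lam : ℂ} (hlam : lam ∈ CI) (x : ℝ) :
    psiMinus u lam x ≠ 0 := by
  obtain ⟨x₀, h0⟩ : ∃ x₀, psiMinus u lam x₀ ≠ 0 := by
    by_contra! hall
    have hz : jostMinus u lam = fun _ => 0 := by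
      ext x : 1
      have := hall x
      rw [psiMinus, smul_eq_zero] at this
      exact this.resolve_left (Complex.exp_ne_zero _)
    have hl := ((jostMinus_spec hu).1 lam hlam).1.2.2
    rw [hz] at hl
    simpa using congrFun (tendsto_nhds_unique hl tendsto_const_nhds) 0
  exact (isSol_psiMinus hu hlam).ne_zero hu h0 x

theorem continuous_backlund {u : ℝ → ℂ} (hu : Continuous u) {b : ℂ} (hb : b ∈ CI)
    {η : ℝ → Fin 2 → ℂ} (hη : Continuous η) (hη0 : ∀ x, η x ≠ 0) :
    Continuous (backlund b η u) := by
  have hG : Continuous fun x => G b (η x) := continuous_iff_continuousAt.2 fun x =>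
    (continuousAt_G hb (hη0 x)).comp hη.continuousAt
  have hS : Continuous fun x => S b (η x) := continuous_iff_continuousAt.2 fun x =>
    (continuousAt_S hb (hη0 x)).comp hη.continuousAt
  exact hG.mul ((hG.neg.mul hu).add hS)

theorem norm_backlund_le {b : ℂ} (hb : b ∈ CI) {η : ℝ → Fin 2 → ℂ} {x : ℝ} (hη : η x ≠ 0)
    (u : ℝ → ℂ) : ‖backlund b η u x‖ ≤ ‖u x‖ + ‖S b (η x)‖ := by
  rw [backlund, norm_mul, norm_G hb hη, one_mul]
  refine (norm_add_le _ _).trans (le_of_eq ?_)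
  rw [norm_mul, norm_neg, norm_G hb hη, one_mul]

theorem isPotential_backlund {u : ℝ → ℂ} (hu : IsPotential u) {b : ℂ} (hb : b ∈ CI)
    {η : ℝ → Fin 2 → ℂ} (hη : Continuous η) (hη0 : ∀ x, η x ≠ 0)
    (hi : Integrable (backlund b η u)) : IsPotential (backlund b η u) := by
  obtain ⟨B, hB⟩ := hu.bdd
  exact ⟨continuous_backlund hu.cont hb hη hη0, hi, B + boundS b, fun x =>
    (norm_backlund_le hb (hη0 x) u).trans (add_le_add (hB x) (norm_S_le_boundS hb (hη0 x)))⟩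

theorem eq_of_sq_eq_sq_of_mem_CI {z w : ℂ} (hz : z ∈ CI) (hw : w ∈ CI) (h : z ^ 2 = w ^ 2) :
    z = w := by
  rcases sq_eq_sq_iff_eq_or_eq_neg.1 h with h | h
  · exact h
  · have h1 : 0 < z.re := hz.1
    have h2 : 0 < w.re := hw.1
    rw [h, Complex.neg_re] at h1
    linarith

/-- The scattering coefficient of the transformed potential. -/
theorem a_newPotential {u : ℝ → ℂ} (hu : IsPotential u) {b γ : ℂ} (hb : b ∈ CI)
    (hγ0 : γ ≠ 0) (hγ : IsNormingCoeff u b γ) (hi : Integrable (newPotential b u)) {lam : ℂ}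
    (hlam : lam ∈ CI) (hne : lam ≠ b) :
    a (newPotential b u) lam =
      (b / conj b) ^ 2 * (lam ^ 2 - conj b ^ 2) / (lam ^ 2 - b ^ 2) * a u lam := by
  have hη := isSol_psiMinus hu hb
  have hη0 := psiMinus_ne_zero hu hb
  have hv : IsPotential (newPotential b u) :=
    isPotential_backlund hu hb hη.continuous hη0 hi
  have hb0 : b ≠ 0 := fun h => by
    have : 0 < b.re := hb.1
    simp [h] at this
  have hbc : conj b ≠ 0 := (map_ne_zero _).2 hb0
  have hsq : lam ^ 2 - b ^ 2 ≠ 0 :=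
    sub_ne_zero.2 fun h => hne (eq_of_sq_eq_sq_of_mem_CI hlam hb h)
  -- At η = e₁ the Darboux matrix maps e₁ to c·e₁, and at η = e₂ it maps e₂ to -c·e₂. Dividing by
  -- these constants restores the Jost normalisations.
  set c := conj b / b * (lam ^ 2 - b ^ 2) with hc
  have hc0 : c ≠ 0 := mul_ne_zero (div_ne_zero hbc hb0) hsq
  set K := ‖lam‖ ^ 2 + ‖b‖ * ‖b‖ + ‖lam‖ / 2 * boundS b with hK
  have hK0 : 0 ≤ K := by have := boundS_nonneg hb; positivity
  have e1 : (![1, 0] : Fin 2 → ℂ) ≠ 0 := fun h => by simpa using congrFun h 0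
  have e2 : (![0, 1] : Fin 2 → ℂ) ≠ 0 := fun h => by simpa using congrFun h 1
  obtain ⟨⟨s1, ⟨R1, r1⟩, t1⟩, -⟩ := (jostMinus_spec hu).1 lam hlam
  obtain ⟨⟨s2, ⟨R2, r2⟩, t2⟩, -⟩ := (jostPlus_spec hu).1 lam hlam
  obtain ⟨⟨-, -, t3⟩, -⟩ := (jostMinus_spec hu).1 b hb
  obtain ⟨⟨-, -, t4⟩, -⟩ := (jostPlus_spec hu).1 b hb
  have m1 : IsJostMinus (newPotential b u) lam
      (fun x => c⁻¹ • darboux b (psiMinus u b x) lam (jostMinus u lam x)) := by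
    refine ⟨(isKNSolution_iff hv.cont).2 ?_, ⟨‖c⁻¹‖ * (K * R1), fun x => ?_⟩, ?_⟩
    · have := (hη.darboux hb hη0 ((isKNSolution_iff hu.cont).1 s1)).smul c⁻¹
      simp only [darboux_smul] at this
      change IsSol (backlund b (psiMinus u b) u) lam _
      convert this using 2 with x
      rw [smul_comm]
    · rw [norm_smul]
      have h1 := norm_darboux_le hb (hη0 x) lam (jostMinus u lam x)
      have h2 := r1 x
      calc _ ≤ ‖c⁻¹‖ * (K * ‖jostMinus u lam x‖) := by gcongr
        _ ≤ _ := by gcongr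
    -- The Darboux matrix depends only on the direction of η, so the exponential drops out and the
    -- limit at -∞ is the value at e₁.
    · have hd : ∀ x z, darboux b (psiMinus u b x) lam z = darboux b (jostMinus u b x) lam z := by
        intro x z
        simp only [darboux, psiMinus, G_smul (Complex.exp_ne_zero _), S_smul (Complex.exp_ne_zero _)]
      simp only [hd]
      have := (tendsto_darboux hb e1 t3 t1 lam).const_smul c⁻¹
      convert this using 2
      have : darboux b ![1, 0] lam ![1, 0] = ![c, 0] := by
        ext i; fin_cases i
        · simp [darboux, G, S, d, hc]; field_simp
        · simp [darboux, S]
      rw [this]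
      ext i; fin_cases i <;> simp [hc0]
  have m2 : IsJostPlus (newPotential b u) lam
      (fun x => (-c⁻¹) • darboux b (psiMinus u b x) lam (jostPlus u lam x)) := by
    refine ⟨(isKNSolution_iff hv.cont).2 ?_, ⟨‖-c⁻¹‖ * (K * R2), fun x => ?_⟩, ?_⟩
    · have := (hη.darboux hb hη0 ((isKNSolution_iff hu.cont).1 s2)).smul (-c⁻¹)
      simp only [darboux_smul] at this
      change IsSol (backlund b (psiMinus u b) u) lam _
      convert this using 2 with x
      rw [smul_comm]
    · rw [norm_smul]
      have h1 := norm_darboux_le hb (hη0 x) lam (jostPlus u lam x)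
      have h2 := r2 x
      calc _ ≤ ‖-c⁻¹‖ * (K * ‖jostPlus u lam x‖) := by gcongr
        _ ≤ _ := by gcongr
    -- At the eigenvalue η = γψ₊, so its direction at +∞ is that of e₂; this is where the norming
    -- relation enters.
    · have hd : ∀ x z, darboux b (psiMinus u b x) lam z = darboux b (jostPlus u b x) lam z := by
        intro x z
        rw [hγ x]
        simp only [darboux, psiPlus, G_smul (Complex.exp_ne_zero _), S_smul (Complex.exp_ne_zero _),
          G_smul hγ0, S_smul hγ0]
      simp only [hd]
      have := (tendsto_darboux hb e2 t4 t2 lam).const_smul (-c⁻¹)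
      convert this using 2
      have : darboux b ![0, 1] lam ![0, 1] = ![0, -c] := by
        ext i; fin_cases i
        · simp [darboux, S]
        · simp [darboux, G, S, d, hc]; field_simp; ring
      rw [this]
      ext i; fin_cases i <;> simp [hc0]
  have a0 : ∀ w : ℝ → ℂ, a w lam = wronskian (jostMinus w lam 0) (jostPlus w lam 0) := by
    intro w
    rw [a_eq, wronskian]
  rw [a0, m1.eq_jostMinus hv hlam, m2.eq_jostPlus hv hlam, wronskian_smul_smul,
    wronskian_darboux hb (hη0 0), ← a0 u, hc]
  field_simp

/-- The value at the eigenvalue of the scattering coefficient of the transformed potential. -/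
theorem norm_a_newPotential_self {u : ℝ → ℂ} (hu : IsPotential u) {b γ : ℂ} (hb : b ∈ CI)
    (hγ0 : γ ≠ 0) (hγ : IsNormingCoeff u b γ) (ha : a u b = 0)
    (hi : Integrable (newPotential b u)) :
    ‖a (newPotential b u) b‖ = ‖b ^ 2 - conj b ^ 2‖ / (2 * ‖b‖) * ‖deriv (a u) b‖ := by
  have hv : IsPotential (newPotential b u) :=
    isPotential_backlund hu hb (isSol_psiMinus hu hb).continuous (psiMinus_ne_zero hu hb) hi
  have hb0 : b ≠ 0 := fun h => by
    have : 0 < b.re := hb.1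
    simp [h] at this
  have hCI := isOpen_CI.mem_nhds hb
  have hc : ContinuousAt (a (newPotential b u)) b :=
    ((differentiableOn_a hv).differentiableAt hCI).continuousAt
  have hd : HasDerivAt (a u) (deriv (a u) b) b :=
    ((differentiableOn_a hu).differentiableAt hCI).hasDerivAt
  have h1 : Tendsto (a (newPotential b u)) (𝓝[≠] b) (𝓝 (a (newPotential b u) b)) :=
    hc.tendsto.mono_left nhdsWithin_le_nhds
  -- Writing λ² - b² = (λ - b)(λ + b), the factor 1/(λ - b) turns a(λ) into a difference quotient
  -- with limit a'(b), and continuity of the new coefficient identifies its value at b.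
  have hcont : ContinuousAt (fun lam : ℂ => (b / conj b) ^ 2 * (lam ^ 2 - conj b ^ 2) / (lam + b)) b := by
    refine ContinuousAt.div (by fun_prop) (by fun_prop) ?_
    rw [← two_mul]
    exact mul_ne_zero two_ne_zero hb0
  have h2 := (hcont.tendsto.mono_left (nhdsWithin_le_nhds (s := {b}ᶜ))).mul hd.tendsto_slope
  have h3 : a (newPotential b u) b =
      (b / conj b) ^ 2 * (b ^ 2 - conj b ^ 2) / (b + b) * deriv (a u) b := by
    refine tendsto_nhds_unique (h1.congr' ?_) h2
    filter_upwards [self_mem_nhdsWithin, mem_nhdsWithin_of_mem_nhds hCI] with lam hne hlam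
    rw [a_newPotential hu hb hγ0 hγ hi hlam hne, slope_def_field, ha, sub_zero]
    have n1 : lam - b ≠ 0 := sub_ne_zero.2 hne
    have n2 : lam + b ≠ 0 := fun h => by
      have r1 : 0 < b.re := hb.1
      have r2 : 0 < lam.re := hlam.1
      have := congrArg Complex.re h
      simp at this
      linarith
    have : lam ^ 2 - b ^ 2 = (lam - b) * (lam + b) := by ring
    rw [this]
    field_simp
  rw [h3, ← two_mul]
  have hbn : ‖b‖ ≠ 0 := norm_ne_zero_iff.2 hb0
  simp only [norm_mul, norm_div, norm_pow, RCLike.norm_conj, Complex.norm_ofNat]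
  field_simp

/-! ## Uniform bounds for families of functions -/

/-- A family of `C¹` functions dominated by `D₀`, with derivatives dominated by `D₁`, up to a
constant that is uniform over the family. -/
structure FamBound {ι : Type*} (D₀ D₁ : ι → ℝ → ℝ) (f f' : ι → ℝ → ℂ) : Prop where
  hasDerivAt : ∀ i x, HasDerivAt (f i) (f' i x) x
  cont : ∀ i, Continuous (f' i)
  bound : ∃ c, 0 ≤ c ∧ ∀ i x, ‖f i x‖ ≤ c * D₀ i x ∧ ‖f' i x‖ ≤ c * D₁ i x

namespace FamBound

variable {ι : Type*} {D₀ D₁ : ι → ℝ → ℝ} {f f' g g' : ι → ℝ → ℂ}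

theorem continuous (h : FamBound D₀ D₁ f f') (i : ι) : Continuous (f i) :=
  continuous_iff_continuousAt.2 fun x => (h.hasDerivAt i x).continuousAt

theorem congr_left (h : FamBound D₀ D₁ f f') (e : ∀ i x, g i x = f i x) : FamBound D₀ D₁ g f' := by
  rwa [show g = f from funext fun i => funext fun x => e i x]

theorem add (hf : FamBound D₀ D₁ f f') (hg : FamBound D₀ D₁ g g') :
    FamBound D₀ D₁ (fun i x => f i x + g i x) (fun i x => f' i x + g' i x) := by
  obtain ⟨c, hc, h⟩ := hf.bound
  obtain ⟨c', hc', h'⟩ := hg.bound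
  refine ⟨fun i x => (hf.hasDerivAt i x).add (hg.hasDerivAt i x),
    fun i => (hf.cont i).add (hg.cont i), c + c', by positivity, fun i x => ⟨?_, ?_⟩⟩
  · rw [add_mul]
    exact (norm_add_le _ _).trans (add_le_add (h i x).1 (h' i x).1)
  · rw [add_mul]
    exact (norm_add_le _ _).trans (add_le_add (h i x).2 (h' i x).2)

theorem const_mul (hf : FamBound D₀ D₁ f f') (k : ℂ) :
    FamBound D₀ D₁ (fun i x => k * f i x) (fun i x => k * f' i x) := by
  obtain ⟨c, hc, h⟩ := hf.bound
  refine ⟨fun i x => (hf.hasDerivAt i x).const_mul k,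
    fun i => continuous_const.mul (hf.cont i), ‖k‖ * c, by positivity, fun i x => ⟨?_, ?_⟩⟩
  · rw [norm_mul, mul_assoc]
    exact mul_le_mul_of_nonneg_left (h i x).1 (norm_nonneg _)
  · rw [norm_mul, mul_assoc]
    exact mul_le_mul_of_nonneg_left (h i x).2 (norm_nonneg _)

theorem conjugate (hf : FamBound D₀ D₁ f f') :
    FamBound D₀ D₁ (fun i x => starRingEnd ℂ (f i x)) (fun i x => starRingEnd ℂ (f' i x)) := by
  obtain ⟨c, hc, h⟩ := hf.bound
  refine ⟨fun i x => hasDerivAt_conj (hf.hasDerivAt i x),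
    fun i => Complex.continuous_conj.comp (hf.cont i), c, hc, fun i x => ?_⟩
  rw [RCLike.norm_conj, RCLike.norm_conj]
  exact h i x

/-- One factor need only be bounded, so the product inherits the decay `D₀` of the other. In the
derivative, f'g is absorbed in `D₁` because `D₀ ≤ m`. -/
theorem mul {m : ℝ} (hf : FamBound (fun _ _ => 1) D₁ f f') (hg : FamBound D₀ D₁ g g')
    (h0 : ∀ i x, 0 ≤ D₀ i x) (hm : ∀ i x, D₀ i x ≤ m) (h1 : ∀ i x, 0 ≤ D₁ i x) :
    FamBound D₀ D₁ (fun i x => f i x * g i x) (fun i x => f' i x * g i x + f i x * g' i x) := by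
  obtain ⟨c, hc, h⟩ := hf.bound
  obtain ⟨c', hc', h'⟩ := hg.bound
  refine ⟨fun i x => (hf.hasDerivAt i x).mul (hg.hasDerivAt i x),
    fun i => ((hf.cont i).mul (hg.continuous i)).add ((hf.continuous i).mul (hg.cont i)),
    c * c' * (|m| + 1), by positivity, fun i x => ?_⟩
  obtain ⟨a1, a2⟩ := h i x
  obtain ⟨b1, b2⟩ := h' i x
  rw [mul_one] at a1
  have z0 := h0 i x
  have z1 := h1 i x
  have zm : D₀ i x ≤ |m| := (hm i x).trans (le_abs_self m)
  constructor
  · rw [norm_mul]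
    calc _ ≤ c * (c' * D₀ i x) := by gcongr
      _ = c * c' * 1 * D₀ i x := by ring
      _ ≤ _ := by gcongr; linarith [abs_nonneg m]
  · refine (norm_add_le _ _).trans ?_
    rw [norm_mul, norm_mul]
    have b1' : ‖g i x‖ ≤ c' * |m| := b1.trans (by gcongr)
    calc _ ≤ c * D₁ i x * (c' * |m|) + c * (c' * D₁ i x) := by gcongr
      _ = _ := by ring

theorem to_one {m : ℝ} (hf : FamBound D₀ D₁ f f') (hm : ∀ i x, D₀ i x ≤ m)
    (h1 : ∀ i x, 0 ≤ D₁ i x) : FamBound (fun _ _ => 1) D₁ f f' := by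
  obtain ⟨c, hc, h⟩ := hf.bound
  refine ⟨hf.hasDerivAt, hf.cont, c * (|m| + 1), by positivity, fun i x => ⟨?_, ?_⟩⟩
  · refine (h i x).1.trans ?_
    rw [mul_one]
    have := (hm i x).trans (le_abs_self m)
    gcongr
    linarith
  · refine (h i x).2.trans ?_
    have := h1 i x
    have hm0 := abs_nonneg m
    have : 0 ≤ c * D₁ i x := by positivity
    calc _ ≤ c * D₁ i x + |m| * (c * D₁ i x) := le_add_of_nonneg_right (by positivity)
      _ = _ := by ring

end FamBound

/-- The pointwise derivative bounds of Bäcklund transforms, uniform over families of potentials and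
solutions. -/
theorem exists_backlund_bound {b : ℂ} (hb : b ∈ CI) {ι : Type*} {v w g : ι → ℝ → ℂ}
    {η : ι → ℝ → Fin 2 → ℂ} (hv : ∀ i, IsRep (v i) (w i) (g i)) (hη : ∀ i, IsSol (v i) b (η i))
    (hη0 : ∀ i x, η i x ≠ 0) {m : ℝ} (hm : ∀ i x, ‖v i x‖ ≤ m) :
    ∃ C, 0 ≤ C ∧ ∀ i, ∃ V₁ V₂ : ℝ → ℂ, (∀ x, HasDerivAt (backlund b (η i) (v i)) (V₁ x) x) ∧
      Continuous V₁ ∧ HasWeakDeriv V₁ V₂ ∧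
      (∀ x, ‖V₁ x‖ ≤ C * (‖v i x‖ + ‖S b (η i x)‖ + ‖w i x‖)) ∧
      ∀ x, ‖V₂ x‖ ≤ C * (‖v i x‖ + ‖S b (η i x)‖ + ‖w i x‖ + ‖g i x‖) := by
  -- `D₀` dominates the potential and `S`, and `D₁` adds the derivative of the potential: these are
  -- the majorants for a function and for its derivative.
  set D₀ : ι → ℝ → ℝ := fun i x => ‖v i x‖ + ‖S b (η i x)‖ with hD₀
  set D₁ : ι → ℝ → ℝ := fun i x => D₀ i x + ‖w i x‖ with hD₁
  set n := m + boundS b with hn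
  have h0 : ∀ i x, 0 ≤ D₀ i x := fun i x => by positivity
  have h1 : ∀ i x, 0 ≤ D₁ i x := fun i x => by positivity
  have h01 : ∀ i x, D₀ i x ≤ D₁ i x := fun i x => le_add_of_nonneg_right (norm_nonneg _)
  have hDn : ∀ i x, D₀ i x ≤ n := fun i x => add_le_add (hm i x) (norm_S_le_boundS hb (hη0 i x))
  set Gf : ι → ℝ → ℂ := fun i x => G b (η i x) with hGf
  set Sf : ι → ℝ → ℂ := fun i x => S b (η i x) with hSf
  set G₁ : ι → ℝ → ℂ := fun i x => Complex.I / 2 * (Gf i x ^ 2 * v i x * conj (Sf i x) -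
        Gf i x * Sf i x * conj (Sf i x) + Sf i x * conj (v i x)) with hG₁
  set S₁ : ι → ℝ → ℂ := fun i x => -2 * Complex.I * (b * conj b) *
        ((1 - Gf i x ^ 2) * v i x + Gf i x * Sf i x) with hS₁
  have nG : ∀ i x, ‖Gf i x‖ = 1 := fun i x => norm_G hb (hη0 i x)
  have dG : ∀ i x, HasDerivAt (Gf i) (G₁ i x) x := fun i x => hasDerivAt_G hb (hη i) (hη0 i x)
  have dS : ∀ i x, HasDerivAt (Sf i) (S₁ i x) x := fun i x => hasDerivAt_S hb (hη i) (hη0 i x)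
  have cG : ∀ i, Continuous (Gf i) := fun i =>
    continuous_iff_continuousAt.2 fun x => (dG i x).continuousAt
  have cS : ∀ i, Continuous (Sf i) := fun i =>
    continuous_iff_continuousAt.2 fun x => (dS i x).continuousAt
  have cv := fun i => (hv i).continuous
  have ccS : ∀ i, Continuous fun x => conj (Sf i x) := fun i => Complex.continuous_conj.comp (cS i)
  have ccv : ∀ i, Continuous fun x => conj (v i x) := fun i => Complex.continuous_conj.comp (cv i)
  have cG₁ : ∀ i, Continuous (G₁ i) := fun i => by
    have := cG i; have := cS i; have := cv i; have := ccS i; have := ccv i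
    simp only [hG₁]; fun_prop
  have cS₁ : ∀ i, Continuous (S₁ i) := fun i => by
    have := cG i; have := cS i; have := cv i
    simp only [hS₁]; fun_prop
  have nG₁ : ∀ i x, ‖G₁ i x‖ ≤ |n| * D₀ i x := by
    intro i x
    have hI : ‖Complex.I / 2‖ = 1 / 2 := by simp
    have e1 : ‖G₁ i x‖ ≤ 1 / 2 * (‖v i x‖ * ‖Sf i x‖ + ‖Sf i x‖ * ‖Sf i x‖ + ‖Sf i x‖ * ‖v i x‖) := by
      simp only [hG₁]
      rw [norm_mul, hI]
      refine mul_le_mul_of_nonneg_left ?_ (by norm_num)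
      refine (norm_add_le _ _).trans (add_le_add ((norm_sub_le _ _).trans (add_le_add ?_ ?_)) ?_)
      all_goals simp [nG]
    have hs : ‖Sf i x‖ ≤ D₀ i x := le_add_of_nonneg_left (norm_nonneg _)
    have hnn : D₀ i x ≤ |n| := (hDn i x).trans (le_abs_self n)
    calc _ ≤ _ := e1
      _ ≤ ‖Sf i x‖ * D₀ i x := by
        simp only [hD₀]; nlinarith [norm_nonneg (Sf i x), mul_self_nonneg ‖Sf i x‖]
      _ ≤ _ := by have := h0 i x; gcongr; exact hs.trans hnn
  have nS₁ : ∀ i x, ‖S₁ i x‖ ≤ 4 * (‖b‖ * ‖b‖) * D₁ i x := by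
    intro i x
    have hI : ‖-2 * Complex.I * (b * conj b)‖ = 2 * (‖b‖ * ‖b‖) := by simp
    simp only [hS₁]
    rw [norm_mul, hI]
    have e1 : ‖(1 - Gf i x ^ 2) * v i x + Gf i x * Sf i x‖ ≤ 2 * ‖v i x‖ + ‖Sf i x‖ := by
      refine (norm_add_le _ _).trans (add_le_add ?_ (by simp [nG]))
      rw [norm_mul]
      refine mul_le_mul_of_nonneg_right ((norm_sub_le _ _).trans ?_) (norm_nonneg _)
      simp [nG]; norm_num
    have : 2 * ‖v i x‖ + ‖Sf i x‖ ≤ 2 * D₁ i x := by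
      simp only [hD₁, hD₀]
      linarith [norm_nonneg (Sf i x), norm_nonneg (w i x)]
    calc _ ≤ 2 * (‖b‖ * ‖b‖) * (2 * D₁ i x) := by gcongr; exact e1.trans this
      _ = _ := by ring
  have FG : FamBound (fun _ _ => 1) D₁ Gf G₁ := by
    refine ⟨dG, cG₁, |n| + 1, by positivity, fun i x => ⟨?_, ?_⟩⟩
    · rw [nG]; linarith [abs_nonneg n]
    · refine (nG₁ i x).trans ?_
      have := h0 i x
      have := h1 i x
      have := h01 i x
      gcongr
      linarith
  have Fv : FamBound D₀ D₁ v w := by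
    refine ⟨fun i => (hv i).hasDerivAt, fun i => (hv i).cont, 1, zero_le_one, fun i x => ⟨?_, ?_⟩⟩
    · rw [one_mul]; exact le_add_of_nonneg_right (norm_nonneg _)
    · rw [one_mul]; exact le_add_of_nonneg_left (h0 i x)
  have FS : FamBound D₀ D₁ Sf S₁ := by
    refine ⟨dS, cS₁, 1 + 4 * (‖b‖ * ‖b‖), by positivity, fun i x => ⟨?_, ?_⟩⟩
    · have : ‖Sf i x‖ ≤ D₀ i x := le_add_of_nonneg_left (norm_nonneg _)
      have := h0 i x
      rw [add_mul, one_mul]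
      exact le_add_of_le_of_nonneg ‹_› (by positivity)
    · refine (nS₁ i x).trans ?_
      have := h1 i x
      gcongr
      linarith
  have one : ∀ {f f' : ι → ℝ → ℂ}, FamBound D₀ D₁ f f' → FamBound (fun _ _ => 1) D₁ f f' :=
    fun h => h.to_one hDn h1
  have mul : ∀ {f f' g g' : ι → ℝ → ℂ}, FamBound (fun _ _ => 1) D₁ f f' → FamBound D₀ D₁ g g' →
      FamBound D₀ D₁ (fun i x => f i x * g i x) (fun i x => f' i x * g i x + f i x * g' i x) :=
    fun hf hg => hf.mul hg h0 hDn h1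
  have FG₁ : ∃ G₂, FamBound D₀ D₁ G₁ G₂ := by
    have := ((((mul FG (mul FG (mul (one Fv) FS.conjugate)))).add
      ((mul FG (mul (one FS) FS.conjugate)).const_mul (-1))).add (mul (one FS) Fv.conjugate)).const_mul
      (Complex.I / 2)
    exact ⟨_, this.congr_left fun i x => by simp only [hG₁]; ring⟩
  have FS₁ : ∃ S₂, FamBound D₀ D₁ S₁ S₂ := by
    have := ((Fv.add ((mul FG (mul FG Fv)).const_mul (-1))).add (mul FG FS)).const_mul
      (-2 * Complex.I * (b * conj b))
    exact ⟨_, this.congr_left fun i x => by simp only [hS₁]; ring⟩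
  obtain ⟨G₂, FG₁⟩ := FG₁
  obtain ⟨S₂, FS₁⟩ := FS₁
  -- The transform has derivative -G²u' + B, with B = -2GG'u + G'S + GS'. Only u' is not C¹: B is
  -- differentiated classically, and G²u' by the Leibniz rule for weak derivatives.
  have FB := (((mul FG (mul (one FG₁) Fv)).const_mul (-2)).add (mul (one FG₁) FS)).add (mul FG FS₁)
  set B := fun i x => -2 * (Gf i x * (G₁ i x * v i x)) + G₁ i x * Sf i x + Gf i x * S₁ i x with hB
  obtain ⟨B', FB⟩ : ∃ B', FamBound D₀ D₁ B B' := ⟨_, FB⟩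
  obtain ⟨c, hc, hcb⟩ := FB.bound
  refine ⟨c + 1 + 2 * (|n| * |n|), by positivity, fun i =>
    ⟨fun x => -(Gf i x ^ 2) * w i x + B i x,
      fun x => (-(2 * Gf i x * G₁ i x) * w i x + -(Gf i x ^ 2) * g i x) + B' i x,
      fun x => ?_, ?_, ?_, fun x => ?_, fun x => ?_⟩⟩
  · refine ((dG i x).mul (((dG i x).neg.mul ((hv i).hasDerivAt x)).add (dS i x))).congr_deriv ?_
    simp only [hB, hGf, hSf, Pi.mul_apply, Pi.neg_apply, Pi.add_apply]; ring
  · exact (((cG i).pow 2).neg.mul (hv i).cont).add (FB.continuous i)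
  · refine (HasWeakDeriv.mul (A := fun x => -(Gf i x ^ 2)) (A' := fun x => -(2 * Gf i x * G₁ i x))
      (fun x => ?_) ?_ (hv i).weak).add (hasWeakDeriv_of_hasDerivAt (FB.hasDerivAt i) (FB.cont i))
    · exact ((dG i x).pow 2).neg.congr_deriv (by simp)
    · exact ((continuous_const.mul (cG i)).mul (cG₁ i)).neg
  · have e1 : ‖-(Gf i x ^ 2) * w i x‖ = ‖w i x‖ := by simp [nG]
    have e2 := (hcb i x).1
    have e3 := h0 i x
    have e4 : 0 ≤ |n| * |n| := by positivity
    refine (norm_add_le _ _).trans ?_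
    rw [e1]
    change _ ≤ _ * (D₀ i x + ‖w i x‖)
    nlinarith [norm_nonneg (w i x), mul_nonneg hc (norm_nonneg (w i x)),
      mul_nonneg e4 (norm_nonneg (w i x)), mul_nonneg e4 e3]
  · have e1 : ‖-(Gf i x ^ 2) * g i x‖ = ‖g i x‖ := by simp [nG]
    have e2 := (hcb i x).2
    have e3 := h1 i x
    have e5 : ‖-(2 * Gf i x * G₁ i x) * w i x‖ ≤ 2 * (|n| * |n|) * ‖w i x‖ := by
      rw [norm_mul, norm_neg, norm_mul, norm_mul, nG, Complex.norm_ofNat, mul_one]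
      have : ‖G₁ i x‖ ≤ |n| * |n| := (nG₁ i x).trans (by
        have := (hDn i x).trans (le_abs_self n)
        gcongr)
      gcongr
    have e4 : 0 ≤ |n| * |n| := by positivity
    have e6 : ‖w i x‖ ≤ D₁ i x := le_add_of_nonneg_left (h0 i x)
    refine (norm_add_le _ _).trans ((add_le_add_left (norm_add_le _ _) _).trans ?_)
    rw [e1]
    change _ ≤ _ * (D₁ i x + ‖g i x‖)
    nlinarith [norm_nonneg (g i x), mul_nonneg hc (norm_nonneg (g i x)),
      mul_nonneg e4 (norm_nonneg (g i x)), mul_le_mul_of_nonneg_left e6 e4]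

/-! ## Weighted square integrable functions -/

/-- The weight `1 + x²`. -/
def wt (x : ℝ) : ℝ := 1 + x ^ 2

theorem one_le_wt (x : ℝ) : 1 ≤ wt x := le_add_of_nonneg_right (sq_nonneg x)

theorem wt_pos (x : ℝ) : 0 < wt x := one_pos.trans_le (one_le_wt x)

theorem continuous_wt : Continuous wt := by unfold wt; fun_prop

/-- `f` is square integrable with weight `ρ`, with integral at most `C`. -/
structure WeightedBound (ρ f : ℝ → ℝ) (C : ℝ) : Prop where
  integrable : Integrable fun x => ρ x * f x ^ 2
  le : ∫ x, ρ x * f x ^ 2 ≤ C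

theorem weightedBound_zero (ρ : ℝ → ℝ) : WeightedBound ρ (fun _ => 0) 0 := by
  constructor <;> simp

/-- The four slots are meant for the potential, `S` and the first and second derivatives of the
potential; the zero function fills unused slots. -/
theorem WeightedBound.of_le {ρ : ℝ → ℝ} (hρ : Continuous ρ) (hρ0 : ∀ x, 0 ≤ ρ x)
    {f f₁ f₂ f₃ f₄ : ℝ → ℝ} (hf : AEStronglyMeasurable f volume) {A C₁ C₂ C₃ C₄ : ℝ}
    (h : ∀ x, |f x| ≤ A * (f₁ x + f₂ x + f₃ x + f₄ x)) (h₁ : WeightedBound ρ f₁ C₁)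
    (h₂ : WeightedBound ρ f₂ C₂) (h₃ : WeightedBound ρ f₃ C₃) (h₄ : WeightedBound ρ f₄ C₄) :
    WeightedBound ρ f (4 * A ^ 2 * (C₁ + C₂ + C₃ + C₄)) := by
  have hle : ∀ x, ρ x * f x ^ 2 ≤ 4 * A ^ 2 * (ρ x * f₁ x ^ 2 + ρ x * f₂ x ^ 2 + ρ x * f₃ x ^ 2 +
      ρ x * f₄ x ^ 2) := by
    intro x
    have e1 : f x ^ 2 ≤ (A * (f₁ x + f₂ x + f₃ x + f₄ x)) ^ 2 := by
      rw [← sq_abs]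
      have := h x
      gcongr
    have e2 : (f₁ x + f₂ x + f₃ x + f₄ x) ^ 2
        ≤ 4 * (f₁ x ^ 2 + f₂ x ^ 2 + f₃ x ^ 2 + f₄ x ^ 2) := by
      nlinarith [sq_nonneg (f₁ x - f₂ x), sq_nonneg (f₁ x - f₃ x), sq_nonneg (f₁ x - f₄ x),
        sq_nonneg (f₂ x - f₃ x), sq_nonneg (f₂ x - f₄ x), sq_nonneg (f₃ x - f₄ x)]
    have := hρ0 x
    calc _ ≤ ρ x * (A * (f₁ x + f₂ x + f₃ x + f₄ x)) ^ 2 := by gcongr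
      _ = ρ x * (A ^ 2 * (f₁ x + f₂ x + f₃ x + f₄ x) ^ 2) := by ring
      _ ≤ ρ x * (A ^ 2 * (4 * (f₁ x ^ 2 + f₂ x ^ 2 + f₃ x ^ 2 + f₄ x ^ 2))) := by gcongr
      _ = _ := by ring
  have i2 : Integrable fun x => ρ x * f₁ x ^ 2 + ρ x * f₂ x ^ 2 := h₁.integrable.add h₂.integrable
  have i3 : Integrable fun x => ρ x * f₁ x ^ 2 + ρ x * f₂ x ^ 2 + ρ x * f₃ x ^ 2 :=
    i2.add h₃.integrable
  have i4 : Integrable fun x => ρ x * f₁ x ^ 2 + ρ x * f₂ x ^ 2 + ρ x * f₃ x ^ 2 +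
    ρ x * f₄ x ^ 2 := i3.add h₄.integrable
  have hi := i4.const_mul (4 * A ^ 2)
  have hfi : Integrable fun x => ρ x * f x ^ 2 := by
    refine hi.mono' (hρ.aestronglyMeasurable.mul (hf.pow 2)) (Eventually.of_forall fun x => ?_)
    rw [Real.norm_eq_abs, abs_of_nonneg (mul_nonneg (hρ0 x) (sq_nonneg _))]
    exact hle x
  refine ⟨hfi, (integral_mono hfi hi hle).trans ?_⟩
  rw [integral_const_mul, integral_add i3 h₄.integrable, integral_add i2 h₃.integrable,
    integral_add h₁.integrable h₂.integrable]
  have := h₁.le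
  have := h₂.le
  have := h₃.le
  have := h₄.le
  gcongr

theorem WeightedBound.unweighted {f : ℝ → ℝ} {C : ℝ} (h : WeightedBound wt f C)
    (hf : AEStronglyMeasurable f volume) : WeightedBound (fun _ => 1) f C := by
  have hle : ∀ x, 1 * f x ^ 2 ≤ wt x * f x ^ 2 := fun x =>
    mul_le_mul_of_nonneg_right (one_le_wt x) (sq_nonneg _)
  have hi : Integrable fun x => 1 * f x ^ 2 := by
    refine h.integrable.mono' (aestronglyMeasurable_const.mul (hf.pow 2))
      (Eventually.of_forall fun x => ?_)
    rw [Real.norm_eq_abs, abs_of_nonneg (by positivity)]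
    exact hle x
  exact ⟨hi, (integral_mono hi h.integrable hle).trans h.le⟩

theorem WeightedBound.comp_neg {f : ℝ → ℝ} {C : ℝ} (h : WeightedBound wt f C) :
    WeightedBound wt (fun x => f (-x)) C := by
  have e : (fun x => wt x * f (-x) ^ 2) = fun x => (fun x => wt x * f x ^ 2) (-x) := by
    ext x; simp [wt]
  refine ⟨?_, ?_⟩
  · rw [e]; exact h.integrable.comp_neg
  · rw [e, integral_neg_eq_self (fun x => wt x * f x ^ 2)]
    exact h.le

theorem memL21_iff {f : ℝ → ℂ} (hf : AEStronglyMeasurable f volume) :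
    MemL21 f ↔ Integrable fun x => wt x * ‖f x‖ ^ 2 := by
  unfold MemL21
  rw [memLp_two_iff_integrable_sq_norm]
  · have : ∀ x, ‖((Real.sqrt (1 + x ^ 2) : ℝ) : ℂ) * f x‖ ^ 2 = wt x * ‖f x‖ ^ 2 := by
      intro x
      rw [norm_mul, mul_pow, Complex.norm_real, Real.norm_eq_abs, sq_abs, wt,
        Real.sq_sqrt (by positivity)]
    simp only [this]
  · refine AEStronglyMeasurable.mul (Continuous.aestronglyMeasurable ?_) hf
    exact Complex.continuous_ofReal.comp (Real.continuous_sqrt.comp (by fun_prop))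

theorem memLp_two_iff {f : ℝ → ℂ} (hf : AEStronglyMeasurable f volume) :
    MemLp f 2 volume ↔ Integrable fun x => (1 : ℝ) * ‖f x‖ ^ 2 := by
  simp only [one_mul]
  exact memLp_two_iff_integrable_sq_norm hf

theorem integral_norm_le_of_weightedBound {f : ℝ → ℂ} (hf : AEStronglyMeasurable f volume)
    {C : ℝ} (h : WeightedBound wt (fun x => ‖f x‖) C) :
    Integrable f ∧ ∫ x, ‖f x‖ ≤ Real.pi + C := by
  have hle : ∀ x, ‖f x‖ ≤ (1 + x ^ 2)⁻¹ + wt x * ‖f x‖ ^ 2 := by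
    intro x
    have hw := wt_pos x
    have hw1 : (1 + x ^ 2)⁻¹ * wt x = 1 := inv_mul_cancel₀ hw.ne'
    have h1 : 0 < (1 + x ^ 2)⁻¹ := inv_pos.2 hw
    -- Expanding the square gives 2|f| ≤ (1 + x²)⁻¹ + (1 + x²)|f|², and the integral of the first
    -- term is π.
    have : 0 ≤ (1 + x ^ 2)⁻¹ * (1 - wt x * ‖f x‖) ^ 2 := by positivity
    have h2 : (1 + x ^ 2)⁻¹ * (1 - wt x * ‖f x‖) ^ 2 = (1 + x ^ 2)⁻¹ - 2 * ((1 + x ^ 2)⁻¹ * wt x) * ‖f x‖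
      + ((1 + x ^ 2)⁻¹ * wt x) * (wt x * ‖f x‖ ^ 2) := by ring
    rw [h2, hw1] at this
    linarith [norm_nonneg (f x)]
  have hi := integrable_inv_one_add_sq.add h.integrable
  have hfi : Integrable f := hi.mono' hf (Eventually.of_forall hle)
  refine ⟨hfi, (integral_mono hfi.norm hi hle).trans ?_⟩
  simp only [Pi.add_apply]
  rw [integral_add integrable_inv_one_add_sq h.integrable, integral_univ_inv_one_add_sq]
  have := h.le
  gcongr

/-! ## One-sided exponential convolutions -/

/-- The convolution of `f` with the one-sided exponential of rate `α`. -/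
def expConv (α : ℝ) (f : ℝ → ℝ) (x : ℝ) : ℝ :=
  ∫ y in Set.Iic x, Real.exp (-(α * (x - y))) * f y

theorem integrableOn_expConv {α : ℝ} (hα : 0 ≤ α) {f : ℝ → ℝ} (hf : Integrable f) (x : ℝ) :
    IntegrableOn (fun y => Real.exp (-(α * (x - y))) * f y) (Set.Iic x) := by
  refine hf.norm.integrableOn.mono' ?_ ?_
  · exact (Continuous.aestronglyMeasurable (by fun_prop)).mul
      hf.aestronglyMeasurable.restrict
  · filter_upwards [ae_restrict_mem measurableSet_Iic] with y hy
    rw [norm_mul, Real.norm_eq_abs, abs_of_pos (Real.exp_pos _)]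
    refine mul_le_of_le_one_left (norm_nonneg _) (Real.exp_le_one_iff.2 ?_)
    have : 0 ≤ x - y := sub_nonneg.2 hy
    have : 0 ≤ α * (x - y) := by positivity
    linarith

theorem integrable_expConv {α : ℝ} (hα : 0 < α) {f : ℝ → ℝ} (hf : Integrable f) :
    Integrable (expConv α f) ∧ ∫ x, expConv α f x = α⁻¹ * ∫ x, f x := by
  set k : ℝ → ℝ := (Set.Ici 0).indicator fun t => Real.exp (-α * t) with hk
  have hki : Integrable k := by
    refine (integrable_indicator_iff measurableSet_Ici).2 ?_
    exact (integrableOn_Ici_iff_integrableOn_Ioi).2 (integrableOn_exp_mul_Ioi (by linarith) 0)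
  have hkI : ∫ t, k t = α⁻¹ := by
    rw [hk, integral_indicator measurableSet_Ici, integral_Ici_eq_integral_Ioi,
      integral_exp_mul_Ioi (by linarith)]
    simp [neg_div_neg_eq]
  have e : expConv α f = convolution f k (ContinuousLinearMap.mul ℝ ℝ) := by
    ext x
    rw [expConv, convolution, ← integral_indicator measurableSet_Iic]
    congr 1
    ext y
    simp only [Set.indicator_apply, Set.mem_Iic, ContinuousLinearMap.mul_apply', hk, Set.mem_Ici,
      sub_nonneg]
    split_ifs
    · rw [mul_comm]; congr 2; ring
    · simp
  rw [e]
  refine ⟨hf.integrable_convolution _ hki, ?_⟩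
  rw [integral_convolution _ hf hki, hkI]
  simp [mul_comm]

theorem expConv_one {α : ℝ} (hα : 0 < α) (x : ℝ) :
    IntegrableOn (fun y => Real.exp (-(α * (x - y)))) (Set.Iic x) ∧
      ∫ y in Set.Iic x, Real.exp (-(α * (x - y))) = α⁻¹ := by
  have e : (fun y => Real.exp (-(α * (x - y)))) = fun y => Real.exp (-(α * x)) * Real.exp (α * y) := by
    ext y; rw [← Real.exp_add]; congr 1; ring
  rw [e]
  refine ⟨(integrableOn_exp_mul_Iic hα x).const_mul _, ?_⟩
  rw [integral_const_mul, integral_exp_mul_Iic hα, ← mul_div_assoc, ← Real.exp_add]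
  simp

/-- The Cauchy–Schwarz inequality for the one-sided exponential kernel. -/
theorem expConv_sq_le {α : ℝ} (hα : 0 < α) {f : ℝ → ℝ} (hf : Integrable f)
    (hf2 : Integrable fun x => f x ^ 2) (x : ℝ) :
    expConv α f x ^ 2 ≤ α⁻¹ * expConv α (fun y => f y ^ 2) x := by
  set h := expConv α f x with hh
  obtain ⟨i0, e0⟩ := expConv_one hα x
  have i1 := integrableOn_expConv hα.le hf x
  have i2 := integrableOn_expConv hα.le hf2 x
  -- The kernel has mass 1/α, so α·h is the mean of `f`; Cauchy–Schwarz is the nonnegativity of the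
  -- variance.
  have key : 0 ≤ ∫ y in Set.Iic x, Real.exp (-(α * (x - y))) * (f y - α * h) ^ 2 :=
    setIntegral_nonneg measurableSet_Iic fun y _ => by positivity
  have e : ∀ y, Real.exp (-(α * (x - y))) * (f y - α * h) ^ 2
      = (Real.exp (-(α * (x - y))) * f y ^ 2 - 2 * α * h * (Real.exp (-(α * (x - y))) * f y)) +
        α ^ 2 * h ^ 2 * Real.exp (-(α * (x - y))) := fun y => by ring
  simp_rw [e] at key
  have i3 : IntegrableOn (fun y => Real.exp (-(α * (x - y))) * f y ^ 2 -
      2 * α * h * (Real.exp (-(α * (x - y))) * f y)) (Set.Iic x) := i2.sub (i1.const_mul _)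
  rw [integral_add i3 (i0.const_mul _), integral_sub i2 (i1.const_mul _),
    integral_const_mul, integral_const_mul, e0] at key
  change 0 ≤ expConv α (fun y => f y ^ 2) x - 2 * α * h * h + α ^ 2 * h ^ 2 * α⁻¹ at key
  have e2 : α ^ 2 * h ^ 2 * α⁻¹ = α * h ^ 2 := by field_simp
  rw [e2] at key
  rw [inv_mul_eq_div, le_div_iff₀ hα]
  nlinarith

/-- The constant in the weighted bound of the exponentially weighted mass. -/
def expConst (β : ℝ) : ℝ := (2 * β)⁻¹ * (2 * (1 + 2 / β ^ 2)) * β⁻¹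

theorem expConst_pos {β : ℝ} (hβ : 0 < β) : 0 < expConst β := by
  unfold expConst; positivity

/-- Half of the rate 2β is spent on absorbing the polynomial weight; a kernel of rate β remains. -/
theorem wt_le_exp {β : ℝ} (hβ : 0 < β) {t : ℝ} (ht : 0 ≤ t) :
    wt t ≤ (1 + 2 / β ^ 2) * Real.exp (β * t) := by
  have h1 := Real.quadratic_le_exp_of_nonneg (by positivity : 0 ≤ β * t)
  have h2 : 0 ≤ β * t := by positivity
  have h3 : 1 ≤ Real.exp (β * t) := Real.one_le_exp h2
  have h4 : t ^ 2 = 2 / β ^ 2 * ((β * t) ^ 2 / 2) := by field_simp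
  have h5 : 2 / β ^ 2 * ((β * t) ^ 2 / 2) ≤ 2 / β ^ 2 * Real.exp (β * t) := by
    have : (β * t) ^ 2 / 2 ≤ Real.exp (β * t) := by linarith
    gcongr
  rw [wt, add_mul, one_mul]
  linarith

/-- Peetre's inequality: the weight moves from x to y at the cost of a weight in x - y. -/
theorem wt_le_mul (x y : ℝ) : wt x ≤ 2 * (wt (x - y) * wt y) := by
  unfold wt
  nlinarith [sq_nonneg (x - 2 * y), sq_nonneg ((x - y) * y)]

/-- Cauchy–Schwarz bounds the squared mass by a convolution of |u|² at rate 2β. The weight is then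
moved onto |u|² inside the integral, and the remaining convolution at rate β preserves L¹ up to the
factor 1/β. -/
theorem weightedBound_expMass {β : ℝ} (hβ : 0 < β) {u : ℝ → ℂ} (hu : IsPotential u) {C : ℝ}
    (h : WeightedBound wt (fun x => ‖u x‖) C) :
    WeightedBound wt (expMass β u) (expConst β * C) := by
  have hu2 : Integrable fun x => ‖u x‖ ^ 2 := by
    have := (h.unweighted hu.cont.norm.aestronglyMeasurable).integrable
    simpa using this
  have hU := h.integrable
  obtain ⟨j1, j2⟩ := integrable_expConv hβ hU
  have m1 : AEStronglyMeasurable (expMass β u) volume :=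
    (integrable_expConv (by positivity : 0 < 2 * β) hu.integrable.norm).1.aestronglyMeasurable
  set c := (2 * β)⁻¹ * (2 * (1 + 2 / β ^ 2)) with hc
  have hc0 : 0 ≤ c := by positivity
  have hle : ∀ x, wt x * expMass β u x ^ 2 ≤ c * expConv β (fun y => wt y * ‖u y‖ ^ 2) x := by
    intro x
    have h1 := expConv_sq_le (by positivity : 0 < 2 * β) hu.integrable.norm hu2 x
    have h2 : wt x * expConv (2 * β) (fun y => ‖u y‖ ^ 2) x
        ≤ 2 * (1 + 2 / β ^ 2) * expConv β (fun y => wt y * ‖u y‖ ^ 2) x := by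
      rw [expConv, expConv, ← integral_const_mul, ← integral_const_mul]
      refine setIntegral_mono_on
        ((integrableOn_expConv (by positivity : 0 ≤ 2 * β) hu2 x).const_mul _)
        ((integrableOn_expConv hβ.le hU x).const_mul _) measurableSet_Iic fun y hy => ?_
      have ht : 0 ≤ x - y := sub_nonneg.2 hy
      have a1 := wt_le_mul x y
      have a2 := wt_le_exp hβ ht
      have a3 : Real.exp (-(2 * β * (x - y))) * Real.exp (β * (x - y)) = Real.exp (-(β * (x - y))) := by
        rw [← Real.exp_add]; congr 1; ring
      have := wt_pos y
      calc wt x * (Real.exp (-(2 * β * (x - y))) * ‖u y‖ ^ 2)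
          ≤ 2 * ((1 + 2 / β ^ 2) * Real.exp (β * (x - y)) * wt y) *
            (Real.exp (-(2 * β * (x - y))) * ‖u y‖ ^ 2) := by
            gcongr
            refine a1.trans ?_
            gcongr
        _ = 2 * (1 + 2 / β ^ 2) * ((Real.exp (-(2 * β * (x - y))) * Real.exp (β * (x - y))) *
            (wt y * ‖u y‖ ^ 2)) := by ring
        _ = _ := by rw [a3]
    have hw := wt_pos x
    calc wt x * expMass β u x ^ 2
        ≤ wt x * ((2 * β)⁻¹ * expConv (2 * β) (fun y => ‖u y‖ ^ 2) x) :=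
          mul_le_mul_of_nonneg_left h1 hw.le
      _ = (2 * β)⁻¹ * (wt x * expConv (2 * β) (fun y => ‖u y‖ ^ 2) x) := by ring
      _ ≤ (2 * β)⁻¹ * (2 * (1 + 2 / β ^ 2) * expConv β (fun y => wt y * ‖u y‖ ^ 2) x) := by gcongr
      _ = _ := by rw [hc]; ring
  have hi : Integrable fun x => wt x * expMass β u x ^ 2 := by
    refine (j1.const_mul c).mono' (continuous_wt.aestronglyMeasurable.mul (m1.pow 2))
      (Eventually.of_forall fun x => ?_)
    rw [Real.norm_eq_abs, abs_of_nonneg (mul_nonneg (wt_pos x).le (sq_nonneg _))]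
    exact hle x
  refine ⟨hi, (integral_mono hi (j1.const_mul c) hle).trans ?_⟩
  rw [integral_const_mul, j2]
  have := h.le
  calc _ = expConst β * ∫ x, wt x * ‖u x‖ ^ 2 := by rw [hc, expConst]; ring
    _ ≤ _ := by have := expConst_pos hβ; gcongr

theorem weightedBound_exp_abs {β : ℝ} (hβ : 0 < β) :
    WeightedBound wt (fun x => Real.exp (-(2 * β * |x|))) ((1 + 2 / β ^ 2) ^ 2 * Real.pi) := by
  set c := 1 + 2 / β ^ 2 with hc
  have hc0 : 0 < c := by positivity
  have hle : ∀ x, wt x * Real.exp (-(2 * β * |x|)) ^ 2 ≤ c ^ 2 * (1 + x ^ 2)⁻¹ := by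
    intro x
    have h1 := wt_le_exp hβ (abs_nonneg x)
    have h2 : wt |x| = wt x := by simp [wt]
    rw [h2] at h1
    have hw := wt_pos x
    rw [← div_eq_mul_inv, le_div_iff₀ (show 0 < 1 + x ^ 2 from hw)]
    have h3 : Real.exp (-(2 * β * |x|)) ≤ Real.exp (-(β * |x|)) := by
      apply Real.exp_le_exp.2
      nlinarith [abs_nonneg x]
    have h4 : wt x * Real.exp (-(β * |x|)) ≤ c := by
      calc _ ≤ c * Real.exp (β * |x|) * Real.exp (-(β * |x|)) := by gcongr
        _ = c := by rw [mul_assoc, ← Real.exp_add]; simp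
    calc _ = (wt x * Real.exp (-(2 * β * |x|))) ^ 2 := by unfold wt; ring
      _ ≤ (wt x * Real.exp (-(β * |x|))) ^ 2 := by gcongr
      _ ≤ c ^ 2 := by gcongr
  have hi : Integrable fun x => wt x * Real.exp (-(2 * β * |x|)) ^ 2 := by
    refine (integrable_inv_one_add_sq.const_mul (c ^ 2)).mono' ?_ (Eventually.of_forall fun x => ?_)
    · have := continuous_wt
      exact Continuous.aestronglyMeasurable (by fun_prop)
    · rw [Real.norm_eq_abs, abs_of_nonneg (mul_nonneg (wt_pos x).le (sq_nonneg _))]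
      exact hle x
  refine ⟨hi, (integral_mono hi (integrable_inv_one_add_sq.const_mul _) hle).trans ?_⟩
  rw [integral_const_mul, integral_univ_inv_one_add_sq]

/-! ## Quantitative consequences of a bound of the norm -/

theorem IsRep.weightedBounds {u v w g : ℝ → ℂ} (h : IsRep v w g) (hu : u =ᵐ[volume] v) {M : ℝ}
    (hM : normX u ≤ M) : WeightedBound wt (fun x => ‖v x‖) (M ^ 2) ∧
      WeightedBound wt (fun x => ‖w x‖) (M ^ 2) ∧
      WeightedBound (fun _ => 1) (fun x => ‖g x‖) (M ^ 2) := by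
  rw [(h.memX hu).2] at hM
  have i1 := (memL21_iff h.continuous.aestronglyMeasurable).1 h.memL21
  have i2 := (memL21_iff h.cont.aestronglyMeasurable).1 h.memL21'
  have i3 := (memLp_two_iff h.memLp.1).1 h.memLp
  have p1 : 0 ≤ ∫ x, ‖v x‖ ^ 2 := integral_nonneg fun _ => sq_nonneg _
  have p2 : 0 ≤ ∫ x, ‖w x‖ ^ 2 := integral_nonneg fun _ => sq_nonneg _
  have p3 : 0 ≤ ∫ x, ‖g x‖ ^ 2 := integral_nonneg fun _ => sq_nonneg _
  have p4 : 0 ≤ ∫ x : ℝ, (1 + x ^ 2) * ‖v x‖ ^ 2 := integral_nonneg fun x => by positivity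
  have p5 : 0 ≤ ∫ x : ℝ, (1 + x ^ 2) * ‖w x‖ ^ 2 := integral_nonneg fun x => by positivity
  have q1 := Real.sqrt_nonneg ((∫ x, ‖v x‖ ^ 2) + (∫ x, ‖w x‖ ^ 2) + ∫ x, ‖g x‖ ^ 2)
  have q2 := Real.sqrt_nonneg
    ((∫ x : ℝ, (1 + x ^ 2) * ‖v x‖ ^ 2) + ∫ x : ℝ, (1 + x ^ 2) * ‖w x‖ ^ 2)
  have r1 := (Real.sqrt_le_iff.1 ((le_add_of_nonneg_right q2).trans hM)).2
  have r2 := (Real.sqrt_le_iff.1 ((le_add_of_nonneg_left q1).trans hM)).2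
  refine ⟨⟨i1, ?_⟩, ⟨i2, ?_⟩, ⟨i3, ?_⟩⟩
  · simp only [wt]; linarith
  · simp only [wt]; linarith
  · simp only [one_mul]; linarith

theorem norm_le_integral_add_integral {v w : ℝ → ℂ} (hd : ∀ x, HasDerivAt v (w x) x)
    (hw : Continuous w) (hvi : Integrable v) (hwi : Integrable w) (x : ℝ) :
    ‖v x‖ ≤ (∫ y, ‖v y‖) + ∫ y, ‖w y‖ := by
  have h1 : ∀ y, ‖v x‖ ≤ ‖v y‖ + ∫ z, ‖w z‖ := by
    intro y
    have e := intervalIntegral.integral_eq_sub_of_hasDerivAt (fun z _ => hd z)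
      (hw.intervalIntegrable y x)
    have e2 : v x = v y + ∫ z in y..x, w z := by rw [e]; ring
    rw [e2]
    refine (norm_add_le _ _).trans (add_le_add_right ?_ _)
    refine (intervalIntegral.norm_integral_le_integral_norm_uIoc).trans ?_
    exact setIntegral_le_integral hwi.norm (Eventually.of_forall fun _ => norm_nonneg _)
  -- The pointwise bound is averaged in y over (0, 1], whatever x is: the full L¹ norm of `w`
  -- controls the difference of any two values of `v`.
  have h2 : ∫ _ in Set.Ioc (0 : ℝ) 1, ‖v x‖ ≤ ∫ y in Set.Ioc (0 : ℝ) 1, (‖v y‖ + ∫ z, ‖w z‖) :=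
    setIntegral_mono_on (by simp) (hvi.norm.integrableOn.add (by simp)) measurableSet_Ioc
      fun y _ => h1 y
  rw [integral_add hvi.norm.integrableOn (by simp)] at h2
  simp only [integral_const, MeasurableSet.univ, measureReal_restrict_apply, Set.univ_inter,
    Real.volume_real_Ioc, sub_zero, zero_le_one, sup_of_le_left, smul_eq_mul, one_mul] at h2
  have h3 : ∫ y in Set.Ioc (0 : ℝ) 1, ‖v y‖ ≤ ∫ y, ‖v y‖ :=
    setIntegral_le_integral hvi.norm (Eventually.of_forall fun _ => norm_nonneg _)
  linarith

/-- The bound of the `L¹` norms by the norm of `H² ∩ H^{1,1}`. -/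
theorem IsRep.isPotential {u v w g : ℝ → ℂ} (h : IsRep v w g) (hu : u =ᵐ[volume] v) {M : ℝ}
    (hM : normX u ≤ M) : IsPotential v ∧ (∫ x, ‖v x‖ ≤ Real.pi + M ^ 2) ∧
      ∀ x, ‖v x‖ ≤ 2 * (Real.pi + M ^ 2) := by
  obtain ⟨h1, h2, -⟩ := h.weightedBounds hu hM
  obtain ⟨i1, e1⟩ := integral_norm_le_of_weightedBound h.continuous.aestronglyMeasurable h1
  obtain ⟨i2, e2⟩ := integral_norm_le_of_weightedBound h.cont.aestronglyMeasurable h2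
  have hb : ∀ x, ‖v x‖ ≤ 2 * (Real.pi + M ^ 2) := fun x => by
    have := norm_le_integral_add_integral h.hasDerivAt h.cont i1 i2 x
    linarith
  exact ⟨⟨h.continuous, i1, _, hb⟩, e1, hb⟩

/-! ### Decay of `S` along the solution of the inverse transformation. -/

theorem norm_wronskian_le (η ξ : Fin 2 → ℂ) : ‖wronskian η ξ‖ ≤ 2 * ‖η‖ * ‖ξ‖ := by
  rw [wronskian]
  refine (norm_sub_le _ _).trans ?_
  rw [norm_mul, norm_mul]
  have h0 := norm_le_pi_norm η 0
  have h1 := norm_le_pi_norm η 1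
  have h2 := norm_le_pi_norm ξ 0
  have h3 := norm_le_pi_norm ξ 1
  calc _ ≤ ‖η‖ * ‖ξ‖ + ‖ξ‖ * ‖η‖ := by gcongr
    _ = _ := by ring

/-- The decay of `S` along the solution that defines the inverse Bäcklund transformation. -/
theorem norm_S_le_of_le_norm_a {v : ℝ → ℂ} (hv : IsPotential v) {b : ℂ} (hb : b ∈ CI) {N : ℝ}
    (hN : ∫ x, ‖v x‖ ≤ N) {δ K : ℝ} (hδ : 0 < δ) (hK : 0 < K) {γ : ℂ} (hγ1 : K⁻¹ ≤ ‖γ‖)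
    (hγ2 : ‖γ‖ ≤ K) (ha : δ ≤ ‖a v b‖) (x : ℝ) :
    γ⁻¹ • psiMinus v b x + psiPlus v b x ≠ 0 ∧
    ‖S b (γ⁻¹ • psiMinus v b x + psiPlus v b x)‖ ≤
      boundS b * (2 * jostBound b N / δ * (K + 1) ^ 2 * (jostBound b N * (‖b‖ + 1))) *
      (Real.exp (-(2 * (b ^ 2).im * |x|)) + expMass (b ^ 2).im v x +
        expMass (b ^ 2).im (reflect v) (-x)) := by
  set β := (b ^ 2).im with hβ
  set B := jostBound b N with hB
  set η := γ⁻¹ • psiMinus v b x + psiPlus v b x with hη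
  have hβ0 : 0 < β := CI_im_sq hb
  have hB0 : 0 < B := jostBound_pos b N
  have hBN := jostBound_mono b hN
  obtain ⟨-, m1, -, -, m2⟩ := (jostMinus_spec hv).1 b hb
  obtain ⟨-, p1, -, -, p2⟩ := (jostPlus_spec hv).1 b hb
  have em0 : ∀ x, 0 ≤ expMass β v x := fun x =>
    setIntegral_nonneg measurableSet_Iic fun _ _ => by positivity
  have ep0 : ∀ x, 0 ≤ expMass β (reflect v) x := fun x =>
    setIntegral_nonneg measurableSet_Iic fun _ _ => by positivity
  have hγ0 : γ ≠ 0 := norm_pos_iff.1 ((inv_pos.2 hK).trans_le hγ1)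
  have hγi : ‖γ⁻¹‖ ≤ K := by
    rw [norm_inv]
    exact inv_le_of_inv_le₀ hK hγ1
  have nm : ∀ i, ‖psiMinus v b x i‖ = Real.exp (β * x) * ‖jostMinus v b x i‖ := fun i => by
    rw [psiMinus, Pi.smul_apply, norm_smul, norm_exp_neg_I_mul]
  have np : ∀ i, ‖psiPlus v b x i‖ = Real.exp (-(β * x)) * ‖jostPlus v b x i‖ := fun i => by
    rw [psiPlus, Pi.smul_apply, norm_smul, norm_exp_I_mul]
  have nm' : ‖psiMinus v b x‖ ≤ Real.exp (β * x) * B := by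
    refine (pi_norm_le_iff_of_nonneg (by positivity)).2 fun i => ?_
    rw [nm]
    gcongr
    exact (m1 x i).trans hBN
  have np' : ‖psiPlus v b x‖ ≤ Real.exp (-(β * x)) * B := by
    refine (pi_norm_le_iff_of_nonneg (by positivity)).2 fun i => ?_
    rw [np]
    gcongr
    exact (p1 x i).trans hBN
  have hw := wronskian_psi hv hb x
  have w1 : wronskian η (psiMinus v b x) = -a v b := by
    rw [← hw, hη]; simp [wronskian]; ring
  have w2 : wronskian η (psiPlus v b x) = γ⁻¹ * a v b := by
    rw [← hw, hη]; simp [wronskian]; ring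
  -- The Wronskian with ψ₋ forces η to grow like e^{-βx} on the left, and the one with ψ₊ forces
  -- growth like e^{βx} on the right.
  have l1 : δ ≤ 2 * ‖η‖ * (Real.exp (β * x) * B) := by
    have := norm_wronskian_le η (psiMinus v b x)
    rw [w1, norm_neg] at this
    exact ha.trans (this.trans (by gcongr))
  have l2 : δ ≤ K * (2 * ‖η‖ * (Real.exp (-(β * x)) * B)) := by
    have := norm_wronskian_le η (psiPlus v b x)
    rw [w2, norm_mul] at this
    have h2 : ‖a v b‖ = ‖γ‖ * (‖γ⁻¹‖ * ‖a v b‖) := by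
      rw [← mul_assoc, ← norm_mul, mul_inv_cancel₀ hγ0, norm_one, one_mul]
    calc δ ≤ ‖a v b‖ := ha
      _ = ‖γ‖ * (‖γ⁻¹‖ * ‖a v b‖) := h2
      _ ≤ K * (2 * ‖η‖ * ‖psiPlus v b x‖) := by gcongr
      _ ≤ _ := by gcongr
  have hηp : 0 < ‖η‖ := by
    by_contra hcon
    have : ‖η‖ = 0 := le_antisymm (not_lt.1 hcon) (norm_nonneg _)
    rw [this] at l1
    simp only [mul_zero, zero_mul] at l1
    linarith
  have hη0 : η ≠ 0 := norm_pos_iff.1 hηp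
  refine ⟨hη0, ?_⟩
  set A := 2 * B / δ * (K + 1) ^ 2 * (B * (‖b‖ + 1)) with hA
  have hb0 : 0 ≤ ‖b‖ := norm_nonneg b
  have bS := boundS_nonneg hb
  have E0 : 0 ≤ Real.exp (-(2 * β * |x|)) := (Real.exp_pos _).le
  rw [mul_assoc]
  rcases le_total x 0 with hx | hx
  · refine (norm_S_le_div hb hη0 0).trans (mul_le_mul_of_nonneg_left ?_ bS)
    -- For x ≤ 0 the growing part ψ₊ is nearly parallel to e₂: its first component carries the extra
    -- factor `expMass` of the reflected potential. Division by the lower bound of η cancels the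
    -- growth.
    have n0 : ‖η 0‖ ≤ K * (Real.exp (β * x) * B) +
        Real.exp (-(β * x)) * (‖b‖ * B * expMass β (reflect v) (-x)) := by
      have : η 0 = γ⁻¹ * psiMinus v b x 0 + psiPlus v b x 0 := rfl
      rw [this]
      refine (norm_add_le _ _).trans (add_le_add ?_ ?_)
      · rw [norm_mul, nm]
        have := (m1 x 0).trans hBN
        gcongr
      · rw [np]
        have := ep0 (-x)
        have : ‖b‖ * jostBound b (∫ y, ‖v y‖) * expMass β (reflect v) (-x)
          ≤ ‖b‖ * B * expMass β (reflect v) (-x) := by gcongr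
        exact mul_le_mul_of_nonneg_left ((p2 x).trans this) (Real.exp_pos _).le
    have i1 : ‖η‖⁻¹ ≤ 2 * B / δ * Real.exp (β * x) := by
      rw [inv_le_iff_one_le_mul₀ hηp, div_mul_eq_mul_div, div_mul_eq_mul_div, le_div_iff₀ hδ]
      linarith
    have ex : Real.exp (-(2 * β * |x|)) = Real.exp (β * x) * Real.exp (β * x) := by
      rw [abs_of_nonpos hx, ← Real.exp_add]; congr 1; ring
    have ex1 : Real.exp (β * x) * Real.exp (-(β * x)) = 1 := by rw [← Real.exp_add]; simp
    -- These crude comparisons let one constant `A` serve both half lines.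
    have c1 : K ≤ (K + 1) ^ 2 * (‖b‖ + 1) := by nlinarith [sq_nonneg K, mul_nonneg hb0 hK.le]
    have c2 : ‖b‖ ≤ (K + 1) ^ 2 * (‖b‖ + 1) := by nlinarith [sq_nonneg K, mul_nonneg hb0 hK.le]
    have z1 := em0 x
    have z2 := ep0 (-x)
    calc ‖η 0‖ / ‖η‖ = ‖η‖⁻¹ * ‖η 0‖ := by rw [div_eq_inv_mul]
      _ ≤ 2 * B / δ * Real.exp (β * x) * (K * (Real.exp (β * x) * B) +
        Real.exp (-(β * x)) * (‖b‖ * B * expMass β (reflect v) (-x))) := by gcongr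
      _ = 2 * B / δ * B * (K * (Real.exp (β * x) * Real.exp (β * x)) +
        ‖b‖ * (Real.exp (β * x) * Real.exp (-(β * x))) * expMass β (reflect v) (-x)) := by ring
      _ = 2 * B / δ * B * (K * Real.exp (-(2 * β * |x|)) + ‖b‖ * expMass β (reflect v) (-x)) := by
        rw [ex, ex1, mul_one]
      _ ≤ 2 * B / δ * B * ((K + 1) ^ 2 * (‖b‖ + 1) * Real.exp (-(2 * β * |x|)) +
          (K + 1) ^ 2 * (‖b‖ + 1) * expMass β (reflect v) (-x)) := by gcongr
      _ = A * (Real.exp (-(2 * β * |x|)) + 0 + expMass β (reflect v) (-x)) := by rw [hA]; ring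
      _ ≤ _ := by gcongr
  · refine (norm_S_le_div hb hη0 1).trans (mul_le_mul_of_nonneg_left ?_ bS)
    have n1 : ‖η 1‖ ≤ K * (Real.exp (β * x) * (‖b‖ * B * expMass β v x)) +
        Real.exp (-(β * x)) * B := by
      have : η 1 = γ⁻¹ * psiMinus v b x 1 + psiPlus v b x 1 := rfl
      rw [this]
      refine (norm_add_le _ _).trans (add_le_add ?_ ?_)
      · rw [norm_mul, nm]
        have := em0 x
        have : ‖b‖ * jostBound b (∫ y, ‖v y‖) * expMass β v x ≤ ‖b‖ * B * expMass β v x := by gcongr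
        have := (m2 x).trans this
        gcongr
      · rw [np]
        have := (p1 x 1).trans hBN
        gcongr
    have i1 : ‖η‖⁻¹ ≤ 2 * B / δ * K * Real.exp (-(β * x)) := by
      rw [inv_le_iff_one_le_mul₀ hηp, div_mul_eq_mul_div, div_mul_eq_mul_div, div_mul_eq_mul_div,
        le_div_iff₀ hδ]
      linarith
    have ex : Real.exp (-(2 * β * |x|)) = Real.exp (-(β * x)) * Real.exp (-(β * x)) := by
      rw [abs_of_nonneg hx, ← Real.exp_add]; congr 1; ring
    have ex1 : Real.exp (-(β * x)) * Real.exp (β * x) = 1 := by rw [← Real.exp_add]; simp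
    have c1 : K ≤ (K + 1) ^ 2 * (‖b‖ + 1) := by nlinarith [sq_nonneg K, mul_nonneg hb0 hK.le]
    have c2 : K * K * ‖b‖ ≤ (K + 1) ^ 2 * (‖b‖ + 1) := by
      nlinarith [sq_nonneg K, mul_nonneg hb0 hK.le]
    have z1 := em0 x
    have z2 := ep0 (-x)
    calc ‖η 1‖ / ‖η‖ = ‖η‖⁻¹ * ‖η 1‖ := by rw [div_eq_inv_mul]
      _ ≤ 2 * B / δ * K * Real.exp (-(β * x)) * (K * (Real.exp (β * x) * (‖b‖ * B * expMass β v x)) +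
        Real.exp (-(β * x)) * B) := by gcongr
      _ = 2 * B / δ * B * (K * (Real.exp (-(β * x)) * Real.exp (-(β * x))) +
        K * K * ‖b‖ * (Real.exp (-(β * x)) * Real.exp (β * x)) * expMass β v x) := by ring
      _ = 2 * B / δ * B * (K * Real.exp (-(2 * β * |x|)) + K * K * ‖b‖ * expMass β v x) := by
        rw [ex, ex1, mul_one]
      _ ≤ 2 * B / δ * B * ((K + 1) ^ 2 * (‖b‖ + 1) * Real.exp (-(2 * β * |x|)) +
          (K + 1) ^ 2 * (‖b‖ + 1) * expMass β v x) := by gcongr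
      _ = A * (Real.exp (-(2 * β * |x|)) + expMass β v x + 0) := by rw [hA]; ring
      _ ≤ _ := by gcongr

/-! ### Uniform bound of the inverse transformation when `a` is bounded below. -/

theorem backlund_congr {b : ℂ} {η : ℝ → Fin 2 → ℂ} {u v : ℝ → ℂ} (h : u =ᵐ[volume] v) :
    backlund b η u =ᵐ[volume] backlund b η v := by
  filter_upwards [h] with x hx
  rw [backlund, backlund, hx]

theorem newPotential_congr {b : ℂ} {u v : ℝ → ℂ} (h : u =ᵐ[volume] v) :
    newPotential b u =ᵐ[volume] newPotential b v := by
  rw [newPotential, newPotential, psiMinus_congr h]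
  exact backlund_congr h

theorem etaOne_eq (b γ : ℂ) (u : ℝ → ℂ) (x : ℝ) : etaOne b γ u x =
    (1 / (conj b * a u b)) • (γ⁻¹ • psiMinus u b x + psiPlus u b x) := by
  rw [etaOne, smul_add, smul_smul]
  congr 2
  rw [mul_assoc, one_div, mul_inv, one_div, mul_comm]

/-- The inverse Bäcklund transformation is bounded where the scattering coefficient is bounded away
from zero. -/
theorem exists_inverseBound {b : ℂ} (hb : b ∈ CI) (M : ℝ) {K δ : ℝ} (hK : 0 < K) (hδ : 0 < δ) :
    ∃ C : ℝ, ∀ (u₁ : ℝ → ℂ) (γ : ℂ), MemX u₁ → normX u₁ ≤ M → K⁻¹ ≤ ‖γ‖ → ‖γ‖ ≤ K →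
      δ ≤ ‖a u₁ b‖ → InverseBound b γ u₁ C := by
  set N := Real.pi + M ^ 2 with hN
  set β := (b ^ 2).im with hβ
  have hβ0 : 0 < β := CI_im_sq hb
  -- The index set contains all admissible representatives and norming constants at once, so that
  -- the constant of `exists_backlund_bound` is fixed before a potential is chosen.
  let ι := {p : (ℝ → ℂ) × (ℝ → ℂ) × (ℝ → ℂ) × ℂ // IsRep p.1 p.2.1 p.2.2.1 ∧ normX p.1 ≤ M ∧
    K⁻¹ ≤ ‖p.2.2.2‖ ∧ ‖p.2.2.2‖ ≤ K ∧ δ ≤ ‖a p.1 b‖}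
  let ηf : ι → ℝ → Fin 2 → ℂ := fun i x =>
    i.1.2.2.2⁻¹ • psiMinus i.1.1 b x + psiPlus i.1.1 b x
  have hpot := fun i : ι => i.2.1.isPotential (ae_eq_refl _) i.2.2.1
  have hS := fun (i : ι) (x : ℝ) => norm_S_le_of_le_norm_a (hpot i).1 hb (hpot i).2.1 hδ hK
    i.2.2.2.1 i.2.2.2.2.1 i.2.2.2.2.2 x
  set A := boundS b * (2 * jostBound b N / δ * (K + 1) ^ 2 * (jostBound b N * (‖b‖ + 1))) with hA
  have hsol : ∀ i : ι, IsSol i.1.1 b (ηf i) := fun i =>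
    ((isSol_psiMinus (hpot i).1 hb).smul _).add (isSol_psiPlus (hpot i).1 hb)
  obtain ⟨C, hC0, hC⟩ := exists_backlund_bound hb (ι := ι) (v := fun i => i.1.1)
    (w := fun i => i.1.2.1) (g := fun i => i.1.2.2.1) (η := ηf) (fun i => i.2.1) hsol
    (fun i x => (hS i x).1) (fun i => (hpot i).2.2)
  -- σ bounds `S` in weighted L²; `X₀`, `X₁`, `X₂` bound the transform and its first two
  -- derivatives, the last without weight.
  set σ := 4 * A ^ 2 * ((1 + 2 / β ^ 2) ^ 2 * Real.pi + expConst β * M ^ 2 + expConst β * M ^ 2 + 0)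
    with hσ
  set X₀ := 4 * (1 : ℝ) ^ 2 * (M ^ 2 + σ + 0 + 0) with hX₀
  set X₁ := 4 * C ^ 2 * (M ^ 2 + σ + M ^ 2 + 0) with hX₁
  set X₂ := 4 * C ^ 2 * (M ^ 2 + σ + M ^ 2 + M ^ 2) with hX₂
  refine ⟨Real.sqrt (X₀ + X₁ + X₂) + Real.sqrt (X₀ + X₁), fun u₁ γ hu hM hγ1 hγ2 ha => ?_⟩
  obtain ⟨v, w, g, hrep, hae⟩ := exists_isRep_of_memX hu
  have hMv : normX v ≤ M := by
    rw [(hrep.memX (ae_eq_refl _)).2, ← (hrep.memX hae).2]; exact hM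
  have hav : a u₁ b = a v b := by rw [a_congr hae]
  let i : ι := ⟨(v, w, g, γ), hrep, hMv, hγ1, hγ2, hav ▸ ha⟩
  obtain ⟨V₁, V₂, d1, c1, d2, b1, b2⟩ := hC i
  obtain ⟨hv, -, -⟩ := hpot i
  obtain ⟨wv, ww, wg⟩ := hrep.weightedBounds (ae_eq_refl _) hMv
  have hbc : conj b ≠ 0 := (map_ne_zero _).2 fun h => by
    have : 0 < b.re := hb.1
    simp [h] at this
  have hane : a v b ≠ 0 := norm_pos_iff.1 (hδ.trans_le (hav ▸ ha))
  have hB : backlund b (etaOne b γ u₁) u₁ =ᵐ[volume] backlund b (ηf i) v := by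
    refine (backlund_congr hae).trans (ae_of_all _ fun x => ?_)
    have e : etaOne b γ u₁ = fun x => (1 / (conj b * a v b)) • ηf i x := by
      rw [etaOne_congr hae]
      ext x : 1
      exact etaOne_eq b γ v x
    rw [e, backlund_smul (one_div_ne_zero (mul_ne_zero hbc hane))]
  set V := backlund b (ηf i) v with hV
  have cV : Continuous V := continuous_iff_continuousAt.2 fun x => (d1 x).continuousAt
  have cη := (hsol i).continuous
  have cS : Continuous fun x => S b (ηf i x) := continuous_iff_continuousAt.2 fun x =>
    (continuousAt_S hb (z := ηf i x) (hS i x).1).comp cη.continuousAt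
  have wS : WeightedBound wt (fun x => ‖S b (ηf i x)‖) σ := by
    have wr : WeightedBound wt (fun x => ‖reflect v x‖) (M ^ 2) := by
      have := wv.comp_neg
      simpa [reflect] using this
    refine WeightedBound.of_le (A := A) continuous_wt (fun x => (wt_pos x).le)
      cS.norm.aestronglyMeasurable (fun x => ?_) (weightedBound_exp_abs hβ0)
      (weightedBound_expMass hβ0 hv wv) (weightedBound_expMass hβ0 hv.reflect wr).comp_neg
      (weightedBound_zero _)
    rw [abs_norm, add_zero]
    exact (hS i x).2
  have wV : WeightedBound wt (fun x => ‖V x‖) X₀ := by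
    refine WeightedBound.of_le (A := 1) continuous_wt (fun x => (wt_pos x).le)
      cV.norm.aestronglyMeasurable (fun x => ?_) wv wS (weightedBound_zero _) (weightedBound_zero _)
    rw [abs_norm, one_mul, add_zero, add_zero]
    exact norm_backlund_le hb (hS i x).1 v
  have wV₁ : WeightedBound wt (fun x => ‖V₁ x‖) X₁ := by
    refine WeightedBound.of_le (A := C) continuous_wt (fun x => (wt_pos x).le)
      c1.norm.aestronglyMeasurable (fun x => ?_) wv wS ww (weightedBound_zero _)
    rw [abs_norm, add_zero]
    exact b1 x
  have mV₂ : AEStronglyMeasurable V₂ volume := d2.2.1.aestronglyMeasurable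
  have wV₂ : WeightedBound (fun _ => 1) (fun x => ‖V₂ x‖) X₂ := by
    refine WeightedBound.of_le (A := C) continuous_const (fun x => zero_le_one) mV₂.norm
      (fun x => ?_) (wv.unweighted hrep.continuous.norm.aestronglyMeasurable)
      (wS.unweighted cS.norm.aestronglyMeasurable)
      (ww.unweighted hrep.cont.norm.aestronglyMeasurable) wg
    rw [abs_norm]
    exact b2 x
  have hrepV : IsRep V V₁ V₂ := ⟨d1, c1, d2, (memLp_two_iff mV₂).2 wV₂.integrable,
    (memL21_iff cV.aestronglyMeasurable).2 wV.integrable,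
    (memL21_iff c1.aestronglyMeasurable).2 wV₁.integrable⟩
  obtain ⟨r1, r2⟩ := hrepV.memX hB
  refine ⟨r1, r2.le.trans ?_⟩
  have q0 := (wV.unweighted cV.norm.aestronglyMeasurable).le
  have q1 := (wV₁.unweighted c1.norm.aestronglyMeasurable).le
  have q2 := wV₂.le
  have q3 := wV.le
  have q4 := wV₁.le
  simp only [one_mul] at q0 q1 q2
  simp only [wt] at q3 q4
  gcongr

/-! ## A Harnack inequality and the lower bound of `a` -/

/-- A lower bound for nonvanishing bounded holomorphic functions on a disc. -/
theorem half_mul_exp_le_norm {f : ℂ → ℂ} {R B : ℝ} (hR : 0 < R) (hB : 1 ≤ B)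
    (hf : DifferentiableOn ℂ f (Metric.ball 0 R)) (hne : ∀ z ∈ Metric.ball 0 R, f z ≠ 0)
    (hfB : ∀ z ∈ Metric.ball 0 R, ‖f z‖ ≤ B) (h0 : 1 / 2 ≤ ‖f 0‖) {z : ℂ}
    (hz : z ∈ Metric.ball 0 R) :
    1 / 2 * Real.exp (-(2 * Real.log (2 * B) * ‖z‖ / (R - ‖z‖))) ≤ ‖f z‖ := by
  have hmem0 : (0 : ℂ) ∈ Metric.ball 0 R := Metric.mem_ball_self hR
  have hd : DifferentiableOn ℂ (fun z => deriv f z / f z) (Metric.ball 0 R) :=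
    (hf.deriv Metric.isOpen_ball).div hf hne
  -- `g` is a primitive of f'/f with g(0) = 0, so f = f(0)e^g. The bounds on f give Re g ≤ log(2B),
  -- and Borel–Carathéodory turns this into a bound of |g|, hence a lower bound of Re g.
  obtain ⟨g, hg0, hg⟩ := hd.isExactOn_ball.with_val_at 0 0
  have hgd : DifferentiableOn ℂ g (Metric.ball 0 R) := fun w hw =>
    (hg w hw).differentiableAt.differentiableWithinAt
  have hconst : ∀ w ∈ Metric.ball 0 R, f w * Complex.exp (-g w) = f 0 := by
    intro w hw
    have hder : ∀ y ∈ Metric.ball (0 : ℂ) R, HasDerivAt (fun y => f y * Complex.exp (-g y)) 0 y := by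
      intro y hy
      have h1 := (hf.differentiableAt (Metric.isOpen_ball.mem_nhds hy)).hasDerivAt
      refine (h1.mul (hg y hy).neg.cexp).congr_deriv ?_
      have := hne y hy
      field_simp
      ring
    have := (convex_ball (0 : ℂ) R).is_const_of_fderivWithin_eq_zero (𝕜 := ℂ)
      (f := fun y => f y * Complex.exp (-g y))
      (fun y hy => (hder y hy).differentiableAt.differentiableWithinAt) (fun y hy => by
        rw [fderivWithin_of_isOpen Metric.isOpen_ball hy]
        have := (hder y hy).hasFDerivAt.fderiv
        rw [this]; ext; simp) hw hmem0
    simpa [hg0] using this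
  have hfe : ∀ w ∈ Metric.ball 0 R, ‖f w‖ = ‖f 0‖ * Real.exp (g w).re := by
    intro w hw
    rw [← hconst w hw, norm_mul, Complex.norm_exp, mul_assoc, ← Real.exp_add]
    simp
  have hlog : 0 < Real.log (2 * B) := Real.log_pos (by linarith)
  have hmaps : Set.MapsTo g (Metric.ball 0 R) {z | z.re ≤ Real.log (2 * B)} := by
    intro w hw
    have h1 := hfB w hw
    rw [hfe w hw] at h1
    have h2 := Real.exp_pos (g w).re
    have h3 : Real.exp (g w).re ≤ 2 * B := by nlinarith
    exact (Real.le_log_iff_exp_le (by linarith)).2 h3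
  have hbc := Complex.borelCaratheodory_zero hlog hgd hmaps hR hz hg0
  rw [hfe z hz]
  have h4 : -(2 * Real.log (2 * B) * ‖z‖ / (R - ‖z‖)) ≤ (g z).re := by
    have := Complex.abs_re_le_norm (g z)
    have := neg_abs_le (g z).re
    linarith
  gcongr

/-- The principal square root takes the upper half plane into the first quadrant: in the variable λ²
the quadrant is a half plane, to which Möbius maps apply. -/
theorem exp_half_log_mem_CI {w : ℂ} (hw : 0 < w.im) :
    Complex.exp (Complex.log w / 2) ∈ CI ∧ Complex.exp (Complex.log w / 2) ^ 2 = w := by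
  have hw0 : w ≠ 0 := fun h => by simp [h] at hw
  have hsq : Complex.exp (Complex.log w / 2) ^ 2 = w := by
    rw [← Complex.exp_nat_mul]
    have : ((2 : ℕ) : ℂ) * (Complex.log w / 2) = Complex.log w := by push_cast; ring
    rw [this, Complex.exp_log hw0]
  set s := Complex.exp (Complex.log w / 2) with hs
  have hre : 0 ≤ s.re := by
    rw [hs, Complex.exp_re]
    refine mul_nonneg (Real.exp_pos _).le (Real.cos_nonneg_of_mem_Icc ?_)
    have e : (Complex.log w / 2).im = w.arg / 2 := by
      simp [Complex.log_im]
    rw [e, Set.mem_Icc]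
    constructor
    · linarith [Complex.neg_pi_lt_arg w]
    · linarith [Complex.arg_le_pi w]
  have him : 0 < s.re * s.im := by
    have h2 : (s ^ 2).im = 2 * (s.re * s.im) := by rw [sq, Complex.mul_im]; ring
    rw [hsq] at h2
    linarith
  refine ⟨?_, hsq⟩
  have hre' : 0 < s.re := lt_of_le_of_ne hre fun h => by rw [← h, zero_mul] at him; exact him.false
  exact ⟨hre', (mul_pos_iff_of_pos_left hre').1 him⟩

theorem im_moebius {w₀ ζ : ℂ} :
    ((w₀ - conj w₀ * ζ) / (1 - ζ)).im = w₀.im * (1 - ‖ζ‖ ^ 2) / Complex.normSq (1 - ζ) := by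
  rw [Complex.div_im, ← Complex.normSq_eq_norm_sq, Complex.normSq_apply ζ]
  simp only [Complex.sub_im, Complex.sub_re, Complex.mul_im, Complex.mul_re, Complex.conj_re,
    Complex.conj_im, Complex.one_re, Complex.one_im]
  ring

theorem ofReal_mul_mem_CI {b : ℂ} (hb : b ∈ CI) {t : ℝ} (ht : 0 < t) : (t : ℂ) * b ∈ CI := by
  have h1 : 0 < b.re := hb.1
  have h2 : 0 < b.im := hb.2
  constructor
  · rw [Complex.re_ofReal_mul]; positivity
  · rw [Complex.im_ofReal_mul]; positivity

/-- Without eigenvalues, `a` is bounded away from zero by a constant depending on the mass. -/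
theorem exists_le_norm_a {b : ℂ} (hb : b ∈ CI) {N : ℝ} (hN : 0 ≤ N) :
    ∃ δ, 0 < δ ∧ ∀ v : ℝ → ℂ, IsPotential v → ∫ x, ‖v x‖ ≤ N → (∀ lam ∈ CI, a v lam ≠ 0) →
      δ ≤ ‖a v b‖ := by
  -- This choice gives |tb|·N ≤ 1/40, the smallness required by `half_le_norm_a`.
  set t : ℝ := 1 / (40 * (‖b‖ * N + 1)) with ht
  have hbN : 0 ≤ ‖b‖ * N := by positivity
  have ht0 : 0 < t := by positivity
  set b₀ : ℂ := (t : ℂ) * b with hb₀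
  have hb₀CI : b₀ ∈ CI := ofReal_mul_mem_CI hb ht0
  have hsmall : ‖b₀‖ * N ≤ 1 / 40 := by
    rw [hb₀, norm_mul, Complex.norm_real, Real.norm_eq_abs, abs_of_pos ht0, ht]
    rw [mul_assoc, one_div_mul_eq_div, div_le_div_iff₀ (by positivity) (by norm_num)]
    linarith
  set w₀ := b₀ ^ 2 with hw₀
  set w₁ := b ^ 2 with hw₁
  have hi₀ : 0 < w₀.im := CI_im_sq hb₀CI
  have hi₁ : 0 < w₁.im := CI_im_sq hb
  have hden : w₁ - conj w₀ ≠ 0 := fun h => by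
    have := congrArg Complex.im h
    simp at this
    linarith
  -- The image of b² under the Möbius map of the upper half plane to the unit disc that sends (tb)²
  -- to the centre; `W` is the inverse map.
  set ζ₁ := (w₁ - w₀) / (w₁ - conj w₀) with hζ₁
  have hζlt : ‖ζ₁‖ < 1 := by
    rw [hζ₁, norm_div, div_lt_one (norm_pos_iff.2 hden)]
    refine lt_of_pow_lt_pow_left₀ 2 (norm_nonneg _) ?_
    rw [← Complex.normSq_eq_norm_sq, ← Complex.normSq_eq_norm_sq, Complex.normSq_apply,
      Complex.normSq_apply]
    simp only [Complex.sub_re, Complex.sub_im, Complex.conj_re, Complex.conj_im]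
    nlinarith [mul_pos hi₀ hi₁]
  -- A radius strictly between |ζ₁| and 1: the smaller disc contains ζ₁, and on it `W` stays
  -- bounded, hence so do λ and a.
  set R := (1 + ‖ζ₁‖) / 2 with hR
  have hR0 : 0 < R := by have := norm_nonneg ζ₁; positivity
  have hR1 : R < 1 := by rw [hR]; linarith
  have hζmem : ζ₁ ∈ Metric.ball (0 : ℂ) R := by
    rw [mem_ball_zero_iff, hR]; linarith
  set W : ℂ → ℂ := fun ζ => (w₀ - conj w₀ * ζ) / (1 - ζ) with hW
  set s : ℂ → ℂ := fun ζ => Complex.exp (Complex.log (W ζ) / 2) with hs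
  have hn1 : ∀ ζ ∈ Metric.ball (0 : ℂ) R, 1 - ζ ≠ 0 := fun ζ hζ h => by
    rw [mem_ball_zero_iff] at hζ
    have : ζ = 1 := (sub_eq_zero.1 h).symm
    rw [this, norm_one] at hζ
    linarith
  have hWim : ∀ ζ ∈ Metric.ball (0 : ℂ) R, 0 < (W ζ).im := by
    intro ζ hζ
    have h1 := hn1 ζ hζ
    rw [mem_ball_zero_iff] at hζ
    simp only [hW]
    rw [im_moebius]
    refine div_pos (mul_pos hi₀ ?_) (Complex.normSq_pos.2 h1)
    nlinarith [norm_nonneg ζ]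
  have hsCI : ∀ ζ ∈ Metric.ball (0 : ℂ) R, s ζ ∈ CI := fun ζ hζ =>
    (exp_half_log_mem_CI (hWim ζ hζ)).1
  have hssq : ∀ ζ ∈ Metric.ball (0 : ℂ) R, s ζ ^ 2 = W ζ := fun ζ hζ =>
    (exp_half_log_mem_CI (hWim ζ hζ)).2
  have hsd : DifferentiableOn ℂ s (Metric.ball 0 R) := by
    have hWd : DifferentiableOn ℂ W (Metric.ball 0 R) :=
      DifferentiableOn.div (by fun_prop) (by fun_prop) hn1
    exact ((hWd.clog fun ζ hζ => Or.inr (hWim ζ hζ).ne').div_const 2).cexp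
  have hmem0 : (0 : ℂ) ∈ Metric.ball (0 : ℂ) R := Metric.mem_ball_self hR0
  have hs0 : s 0 = b₀ := eq_of_sq_eq_sq_of_mem_CI (hsCI 0 hmem0) hb₀CI (by
    rw [hssq 0 hmem0, hW]; simp [hw₀])
  have hs1 : s ζ₁ = b := eq_of_sq_eq_sq_of_mem_CI (hsCI ζ₁ hζmem) hb (by
    rw [hssq ζ₁ hζmem]
    have h1 := hn1 ζ₁ hζmem
    simp only [hW]
    rw [div_eq_iff h1, hζ₁]
    field_simp
    ring)
  -- From |s|² = |W| ≤ L - 1 and 2|s| ≤ |s|² + 1 one gets |s| ≤ L.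
  set L := 2 * ‖w₀‖ / (1 - R) + 1 with hL
  have hL0 : 0 ≤ L := by
    have : 0 < 1 - R := by linarith
    positivity
  have hsL : ∀ ζ ∈ Metric.ball (0 : ℂ) R, ‖s ζ‖ ≤ L := by
    intro ζ hζ
    have h1 : ‖W ζ‖ ≤ 2 * ‖w₀‖ / (1 - R) := by
      have hζ' := hζ
      rw [mem_ball_zero_iff] at hζ'
      simp only [hW]
      rw [norm_div]
      have a1 : ‖w₀ - conj w₀ * ζ‖ ≤ 2 * ‖w₀‖ := by
        refine (norm_sub_le _ _).trans ?_
        rw [norm_mul, RCLike.norm_conj]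
        nlinarith [norm_nonneg w₀, norm_nonneg ζ]
      have a2 : 1 - R ≤ ‖1 - ζ‖ := by
        have := norm_sub_norm_le (1 : ℂ) ζ
        rw [norm_one] at this
        linarith
      have : 0 < 1 - R := by linarith
      gcongr
    have h2 : ‖s ζ‖ ^ 2 = ‖W ζ‖ := by rw [← norm_pow, hssq ζ hζ]
    nlinarith [norm_nonneg (s ζ), sq_nonneg (‖s ζ‖ - 1)]
  set B := 8 * Real.exp (4 * L * N) with hB
  have hB1 : 1 ≤ B := by
    have : 1 ≤ Real.exp (4 * L * N) := Real.one_le_exp (by positivity)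
    rw [hB]; linarith
  refine ⟨1 / 2 * Real.exp (-(2 * Real.log (2 * B) * ‖ζ₁‖ / (R - ‖ζ₁‖))), by positivity,
    fun v hv hvN hva => ?_⟩
  have key := half_mul_exp_le_norm (f := fun ζ => a v (s ζ)) hR0 hB1
    ((differentiableOn_a hv).comp hsd hsCI) (fun ζ hζ => hva _ (hsCI ζ hζ))
    (fun ζ hζ => norm_a_le hv (hsCI ζ hζ) (hsL ζ hζ) hvN) (by
      rw [hs0]
      refine half_le_norm_a hv hb₀CI (le_trans ?_ hsmall)
      gcongr) hζmem
  simpa only [hs1] using key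

/-! ## The Bäcklund transformation at a simple eigenvalue -/

/-- The formulas for continuous potentials pass to arbitrary elements of the space through
representatives; membership of the new potential supplies the integrability they need. -/
theorem newPotential_scattering {u : ℝ → ℂ} {b γ : ℂ} (hu : MemX u) (hb : b ∈ CI)
    (ha : a u b = 0) (hγ : IsNormingCoeff u b γ) (hγ0 : γ ≠ 0) (hX : MemX (newPotential b u)) :
    ‖a (newPotential b u) b‖ = ‖b ^ 2 - conj b ^ 2‖ / (2 * ‖b‖) * ‖deriv (a u) b‖ ∧
      ∀ lam ∈ CI, lam ≠ b → a (newPotential b u) lam =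
        (b / conj b) ^ 2 * (lam ^ 2 - conj b ^ 2) / (lam ^ 2 - b ^ 2) * a u lam := by
  obtain ⟨v, w, g, hrep, hae⟩ := exists_isRep_of_memX hu
  obtain ⟨v', w', g', hrep', hae'⟩ := exists_isRep_of_memX hX
  obtain ⟨hv, -⟩ := hrep.isPotential hae le_rfl
  obtain ⟨hv', -⟩ := hrep'.isPotential hae' le_rfl
  have hnew := newPotential_congr (b := b) hae
  have hi : Integrable (newPotential b v) := hv'.integrable.congr (hae'.symm.trans hnew)
  have hγ' : IsNormingCoeff v b γ := by
    intro x
    have := hγ x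
    rwa [psiMinus_congr hae, psiPlus_congr hae] at this
  rw [a_congr hae] at ha
  rw [a_congr hae, a_congr hnew]
  exact ⟨norm_a_newPotential_self hv hb hγ0 hγ' ha hi,
    fun lam hlam hne => a_newPotential hv hb hγ0 hγ' hi hlam hne⟩

theorem InverseBound.mono {b γ : ℂ} {u₁ : ℝ → ℂ} {C C' : ℝ} (h : InverseBound b γ u₁ C)
    (hC : C ≤ C') : InverseBound b γ u₁ C' :=
  ⟨h.1, h.2.trans hC⟩

theorem norm_sq_sub_conj_sq_div_pos {b : ℂ} (hb : b ∈ CI) :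
    0 < ‖b ^ 2 - conj b ^ 2‖ / (2 * ‖b‖) := by
  have hb0 : b ≠ 0 := fun h => by
    have : 0 < b.re := hb.1
    simp [h] at this
  have h1 : b ^ 2 - conj b ^ 2 ≠ 0 := fun h => by
    have h2 := congrArg Complex.im h
    rw [← map_pow, Complex.sub_im, Complex.conj_im, Complex.zero_im] at h2
    linarith [CI_im_sq hb]
  have := norm_pos_iff.2 hb0
  have := norm_pos_iff.2 h1
  positivity

/-- The inverse Bäcklund transformation is bounded on potentials without eigenvalues. -/
theorem exists_inverseBound_of_no_zero {b : ℂ} (hb : b ∈ CI) (M : ℝ) {K : ℝ} (hK : 0 < K) :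
    ∃ C : ℝ, ∀ (u₁ : ℝ → ℂ) (γ : ℂ), MemX u₁ → normX u₁ ≤ M → K⁻¹ ≤ ‖γ‖ → ‖γ‖ ≤ K →
      (∀ lam ∈ CI, a u₁ lam ≠ 0) → InverseBound b γ u₁ C := by
  have hN : 0 ≤ Real.pi + M ^ 2 := by have := Real.pi_pos; positivity
  obtain ⟨δ, hδ, hδa⟩ := exists_le_norm_a hb hN
  obtain ⟨C, hC⟩ := exists_inverseBound hb M hK hδ
  refine ⟨C, fun u₁ γ hu hM hγ1 hγ2 hne => hC u₁ γ hu hM hγ1 hγ2 ?_⟩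
  obtain ⟨v, w, g, hrep, hae⟩ := exists_isRep_of_memX hu
  obtain ⟨hv, hvN, -⟩ := hrep.isPotential hae hM
  rw [a_congr hae] at hne ⊢
  exact hδa v hv hvN hne

end KaupNewell

end

/-! ### Assembly of the two statements. -/

theorem mainTheorem4 (lam1 : ℂ) (hlam1 : lam1 ∈ KaupNewell.CI) (M K : ℝ) (hM : 0 < M)
    (hK : 0 < K) :
    (∀ δ : ℝ, 0 < δ → ∃ C : ℝ,
      (∀ (u : ℝ → ℂ) (γ1 : ℂ), KaupNewell.MemX u →
        KaupNewell.IsSimpleEigenvalue u lam1 →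
        KaupNewell.IsNormingCoeff u lam1 γ1 → K⁻¹ ≤ ‖γ1‖ → ‖γ1‖ ≤ K →
        δ ≤ ‖deriv (KaupNewell.a u) lam1‖ →
        KaupNewell.MemX (KaupNewell.newPotential lam1 u) →
        KaupNewell.normX (KaupNewell.newPotential lam1 u) ≤ M →
        KaupNewell.a (KaupNewell.newPotential lam1 u) lam1 ≠ 0 ∧
          KaupNewell.InverseBound lam1 γ1 (KaupNewell.newPotential lam1 u) C) ∧
      (∀ (u1 : ℝ → ℂ) (γ1 : ℂ), KaupNewell.MemX u1 → KaupNewell.normX u1 ≤ M →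
        K⁻¹ ≤ ‖γ1‖ → ‖γ1‖ ≤ K → δ ≤ ‖KaupNewell.a u1 lam1‖ →
        KaupNewell.InverseBound lam1 γ1 u1 C)) ∧
    (∃ C : ℝ,
      (∀ (u : ℝ → ℂ) (γ1 : ℂ), KaupNewell.MemX u →
        KaupNewell.IsSimpleEigenvalue u lam1 →
        (∀ lam ∈ KaupNewell.CI, KaupNewell.a u lam = 0 → lam = lam1) →
        KaupNewell.IsNormingCoeff u lam1 γ1 → K⁻¹ ≤ ‖γ1‖ → ‖γ1‖ ≤ K →
        KaupNewell.MemX (KaupNewell.newPotential lam1 u) →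
        KaupNewell.normX (KaupNewell.newPotential lam1 u) ≤ M →
        KaupNewell.a (KaupNewell.newPotential lam1 u) lam1 ≠ 0 ∧
          KaupNewell.InverseBound lam1 γ1 (KaupNewell.newPotential lam1 u) C) ∧
      (∀ (u1 : ℝ → ℂ) (γ1 : ℂ), KaupNewell.MemX u1 → KaupNewell.normX u1 ≤ M →
        K⁻¹ ≤ ‖γ1‖ → ‖γ1‖ ≤ K → (∀ lam ∈ KaupNewell.CI, KaupNewell.a u1 lam ≠ 0) →
        KaupNewell.InverseBound lam1 γ1 u1 C)) := by
  have hc := KaupNewell.norm_sq_sub_conj_sq_div_pos hlam1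
  set c := ‖lam1 ^ 2 - conj lam1 ^ 2‖ / (2 * ‖lam1‖)
  have hγ0 : ∀ γ : ℂ, K⁻¹ ≤ ‖γ‖ → γ ≠ 0 := fun γ h => norm_pos_iff.1 ((inv_pos.2 hK).trans_le h)
  constructor
  · intro δ hδ
    -- For (a) the threshold is c·δ, since |a⁽¹⁾(λ₁)| = c·|a'(λ₁)|.
    obtain ⟨C₁, hC₁⟩ := KaupNewell.exists_inverseBound hlam1 M hK (mul_pos hc hδ)
    obtain ⟨C₂, hC₂⟩ := KaupNewell.exists_inverseBound hlam1 M hK hδ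
    refine ⟨max C₁ C₂, fun u γ hu he hγ hγ1 hγ2 hd hX hXM => ?_,
      fun u₁ γ hu hM hγ1 hγ2 ha => (hC₂ u₁ γ hu hM hγ1 hγ2 ha).mono (le_max_right _ _)⟩
    obtain ⟨h1, -⟩ := KaupNewell.newPotential_scattering hu hlam1 he.2.1 hγ (hγ0 γ hγ1) hX
    have hle : c * δ ≤ ‖KaupNewell.a (KaupNewell.newPotential lam1 u) lam1‖ := by
      rw [h1]
      exact mul_le_mul_of_nonneg_left hd hc.le
    exact ⟨norm_pos_iff.1 ((mul_pos hc hδ).trans_le hle),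
      (hC₁ _ γ hX hXM hγ1 hγ2 hle).mono (le_max_left _ _)⟩
  · obtain ⟨C, hC⟩ := KaupNewell.exists_inverseBound_of_no_zero hlam1 M hK
    refine ⟨C, fun u γ hu he honly hγ hγ1 hγ2 hX hXM => ?_, hC⟩
    obtain ⟨h1, h2⟩ := KaupNewell.newPotential_scattering hu hlam1 he.2.1 hγ (hγ0 γ hγ1) hX
    have hne : KaupNewell.a (KaupNewell.newPotential lam1 u) lam1 ≠ 0 := by
      rw [← norm_pos_iff, h1]
      exact mul_pos hc (norm_pos_iff.2 he.2.2)
    refine ⟨hne, hC _ γ hX hXM hγ1 hγ2 fun lam hlam => ?_⟩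
    by_cases hl : lam = lam1
    · rwa [hl]
    · have hb0 : lam1 ≠ 0 := fun h => by
        have : 0 < lam1.re := hlam1.1
        simp [h] at this
      have n1 : lam ^ 2 - lam1 ^ 2 ≠ 0 := sub_ne_zero.2 fun h =>
        hl (KaupNewell.eq_of_sq_eq_sq_of_mem_CI hlam hlam1 h)
      -- Squares of points of the quadrant lie in the upper half plane, while the conjugate of λ₁²
      -- lies in the lower one. Away from λ₁, a⁽¹⁾ can therefore vanish only where a does.
      have n2 : lam ^ 2 - conj lam1 ^ 2 ≠ 0 := fun h => by
        have h3 := congrArg Complex.im h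
        rw [← map_pow, Complex.sub_im, Complex.conj_im, Complex.zero_im] at h3
        linarith [KaupNewell.CI_im_sq hlam1, KaupNewell.CI_im_sq hlam]
      rw [h2 lam hlam hl]
      refine mul_ne_zero (div_ne_zero (mul_ne_zero (pow_ne_zero 2 (div_ne_zero hb0
        ((map_ne_zero _).2 hb0))) n2) n1) fun h => hl (honly lam hlam h)
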